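/- **Setting.** A local tensor $\mathbb A=(\mathbb A^{ij})_{i,j=1}^{d}$ of complex $\chi\times\chi$ matrices generates, for every ring length $L\ge 1$, the (unnormalized) operator $$\rho_L=\sum_{i,j}\operatorname{tr}\big(\mathbb A^{i_1j_1}\cdots\mathbb A^{i_Lj_L}\big)\,|i_1\cdots i_L\rangle\langle j_1\cdots j_L| .$$ The tensor is a *strong injective MPDO* if (1) $X\mapsto\big(\sum_{\alpha\beta}\mathbb A^{ij}_{\alpha\beta}X_{\alpha\beta}\big)_{ij}$ is injective on $\mathbb C^{\chi\times\chi}$; (2) $\mathbb T=\sum_i\mathbb A^{ii}$ has a unique largest eigenvalue, i.e. a real eigenvalue $r$ with one-dimensional eigenspace such that all other eigenvalues have modulus $<r$; and every $\rho_L$ is Hermitian and positive semidefinite. Let $G,K$ be groups and $u$ a unitary representation of $G\times K$ on $\mathbb C^d$; put $U=u^{\otimes L}$. $G$ is a *strong* symmetry if for all $g$ and $L$ there is a phase with $U_g\rho_L=e^{i\theta}\rho_L$ and $\rho_LU_g^\dagger=e^{-i\theta}\rho_L$; $K$ is a *weak* symmetry if $U_k\rho_LU_k^\dagger=\rho_L$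 for all $k$ and $L$. Let $\mathbb G=(G_l\times G_r\times K)\rtimes\mathbb Z_2^{\mathbb H}$ with $G_l=G_r=G$, where $\mathbb H$ exchanges $G_l$ and $G_r$ and fixes $K$. The element $(g,h,k)$ acts on a site of the doubled state (ket $\otimes$ bra) by $u_{(g,k)}\otimes \overline{u_{(h,k)}}$, and $\mathbb H$ acts anti-unitarily by $\mathbb A^{ij}\mapsto\overline{\mathbb A^{ji}}$. Let $\mathrm U_T(1)$ be $\mathrm U(1)$ with elements of $\mathbb G$ outside $G_l\times G_r\times K$ acting by complex conjugation. For $x\in\mathbb G$ write ${}^xM=M$ or $\overline M$ accordingly. A *virtual representation* consists of invertible matrices $V_x$ and $\omega(x,y)\in\mathrm U(1)$ such that, for every $x$, the action of $x$ on $\mathbb A$ is $e^{i\theta_x}V_x^{-1}\mathbb A^{ij}V_x$ for some phase $e^{i\theta_x}$, and $V_x\,{}^xV_y=\omega(x,y)V_{xy}$. For a class $[\omega]\in H^2(\mathbb G,\mathrm U_T(1))$ let $[\omega_L],[\omega_R],[\omega_K]$ be its restrictions to $G_l,G_r,K$, and for commuting unitary $x,y$ let $i_y\omega(x)=\omega(x,y)/\omega(y,x)$.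 The slant products $i_{h^r}\omega(g^l)$, $i_{k}\omega(g^l)$, $i_{k}\omega(h^r)$ define elements of $H^1(G,H^1(G,\mathrm U(1)))$, $H^1(G,H^1(K,\mathrm U(1)))$ and $H^1(G,H^1(K,\mathrm U(1)))$. (For trivial coefficients $H^1$ is the group of homomorphisms; cohomology is that of abstract groups.) **Theorem.** 1. For every strong injective MPDO with strong symmetry $G$ and weak symmetry $K$ a virtual representation exists; every such $\omega$ is a 2-cocycle, and its class $[\omega]\in H^2(\mathbb G,\mathrm U_T(1))$ depends only on the tensor $\mathbb A$ and the representation $u$. 2. Every class $[\omega]$ that arises in this way satisfies: * the restrictions of $[\omega]$ to $\mathbb Z_2^{\mathbb H}$, to $K$, and to $K\times\mathbb Z_2^{\mathbb H}$ are trivial (Hermiticity and weak symmetry protect nothing, alone or together); * it has a representative with $\omega(x,\mathbb H)=\omega(\mathbb H,x)=\omega(\mathbb H,\mathbb H)=1$ and $\omega(x,y)=\overline{\omega(\mathbb Hx\mathbb H,\mathbb Hy\mathbb H)}$ for all $x,y\in G_l\times G_r\times K$; * $[\omega_R]=-[\omega_L]$ and $[i_k\omega(h^r)]=-[i_k\omega(g^l)]$;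 * $i_{h^r}\omega(g^l)=1$ for all $g,h$ (no mixed anomaly between $G_l$ and $G_r$). 3. Let $P\le H^2(\mathbb G,\mathrm U_T(1))$ be the subgroup of all classes with trivial restriction to $K\times\mathbb Z_2^{\mathbb H}$, $[\omega_R]=-[\omega_L]$, $[i_{h^r}\omega(g^l)]=0$ and $[i_k\omega(h^r)]=-[i_k\omega(g^l)]$; by 2 it contains every class that arises. Then $[\omega]\mapsto([\omega_L],[i_k\omega(g^l)])$ is an isomorphism of groups $$P\;\cong\;H^2(G,\mathrm U(1))\oplus H^1(G,H^1(K,\mathrm U(1))).$$ If $G$ and $K$ are finite, the classes that arise are exactly the elements of $P$. 4. (Time reversal.) Let $\mathcal T=w\circ(\text{complex conjugation})$ be an on-site anti-unitary operator with $w$ unitary and $\mathcal T^2=w\overline w=\pm1$, and suppose that a strong injective MPDO satisfies $w^{\otimes L}\,\overline{\rho_L}\,(w^{\otimes L})^\dagger=\rho_L$ for all $L\ge1$. Let $\mathbb Z_2^{\mathcal T}\times\mathbb Z_2^{\mathbb H}$ act on the doubled state, the generators acting anti-unitarily by $\mathbb A^{ij}\mapsto\sum_{i'j'}w_{ii'}\overline{w_{jj'}}\,\overline{\mathbb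 A^{i'j'}}$ and $\mathbb A^{ij}\mapsto\overline{\mathbb A^{ji}}$. Then a virtual representation of $\mathbb Z_2^{\mathcal T}\times\mathbb Z_2^{\mathbb H}$ exists, and its class in $H^2(\mathbb Z_2^{\mathcal T}\times\mathbb Z_2^{\mathbb H},\mathrm U_T(1))$ is trivial. -/

import Mathlib

open scoped ComplexOrder Kronecker

noncomputable section

namespace MixedSPT

/-! ### Group cohomology in degree two with values in `U_T(1)` -/

section Cohomology

/-- The coefficient module `U_T(1)`: the circle group `U(1)`, on which `g` acts trivially if
`s g = 1` (unitary) and by complex conjugation if `s g = -1` (anti-unitary). -/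
def UT {Γ : Type*} [Group Γ] (_s : Γ →* ℤˣ) : Type := Circle

instance {Γ : Type*} [Group Γ] (s : Γ →* ℤˣ) : CommGroup (UT s) :=
  inferInstanceAs (CommGroup Circle)

/-- On the unit circle, `z ^ (-1) = conj z`. -/
instance {Γ : Type*} [Group Γ] (s : Γ →* ℤˣ) : MulDistribMulAction Γ (UT s) where
  smul g z := z ^ ((s g : ℤˣ) : ℤ)
  one_smul z := by
    change z ^ ((s 1 : ℤˣ) : ℤ) = z
    simp
  mul_smul g h z := by
    change z ^ ((s (g * h) : ℤˣ) : ℤ) = (z ^ ((s h : ℤˣ) : ℤ)) ^ ((s g : ℤˣ) : ℤ)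
    rw [← zpow_mul, map_mul, Units.val_mul, mul_comm]
  smul_mul g z w := mul_zpow z w _
  smul_one g := one_zpow _

theorem UT.smul_def {Γ : Type*} [Group Γ] (s : Γ →* ℤˣ) (g : Γ) (z : UT s) :
    g • z = z ^ ((s g : ℤˣ) : ℤ) := rfl

/-- The group of 2-cocycles. -/
def Z2 (Γ M : Type*) [Group Γ] [CommGroup M] [MulDistribMulAction Γ M] :
    Subgroup (Γ × Γ → M) where
  carrier := {ω | groupCohomology.IsMulCocycle₂ ω}
  one_mem' g h j := by simp
  mul_mem' {a b} ha hb g h j := by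
    have h1 := ha g h j
    have h2 := hb g h j
    simp only [Pi.mul_apply, smul_mul']
    rw [mul_mul_mul_comm, h1, h2, mul_mul_mul_comm]
  inv_mem' {a} ha g h j := by
    have h1 := ha g h j
    simp only [Pi.inv_apply, smul_inv']
    rw [← mul_inv, ← mul_inv, h1]

/-- The group of 2-coboundaries, inside the 2-cocycles. -/
def B2 (Γ M : Type*) [Group Γ] [CommGroup M] [MulDistribMulAction Γ M] :
    Subgroup (Z2 Γ M) where
  carrier := {ω | groupCohomology.IsMulCoboundary₂ (ω : Γ × Γ → M)}
  one_mem' := ⟨fun _ => 1, fun g h => by simp⟩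
  mul_mem' {a b} := by
    rintro ⟨x, hx⟩ ⟨y, hy⟩
    refine ⟨fun g => x g * y g, fun g h => ?_⟩
    simp only [Subgroup.coe_mul, Pi.mul_apply, ← hx, ← hy, smul_mul', div_eq_mul_inv, mul_inv]
    ac_rfl
  inv_mem' {a} := by
    rintro ⟨x, hx⟩
    refine ⟨fun g => (x g)⁻¹, fun g h => ?_⟩
    simp only [Subgroup.coe_inv, Pi.inv_apply, ← hx, smul_inv', div_eq_mul_inv, mul_inv]

/-- The second cohomology group. -/
abbrev H2 (Γ M : Type*) [Group Γ] [CommGroup M] [MulDistribMulAction Γ M] : Type _ :=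
  Z2 Γ M ⧸ B2 Γ M

/-- Pull-back of cocycles along a homomorphism compatible with the gradings. -/
def resZ2 {Γ Δ : Type*} [Group Γ] [Group Δ] (s : Γ →* ℤˣ) (t : Δ →* ℤˣ) (f : Δ →* Γ)
    (hf : ∀ x, s (f x) = t x) : Z2 Γ (UT s) →* Z2 Δ (UT t) where
  toFun ω := ⟨fun p => (ω : Γ × Γ → UT s) (f p.1, f p.2), fun g h j => by
    have h1 := ω.2 (f g) (f h) (f j)
    rw [UT.smul_def, hf, ← map_mul, ← map_mul] at h1
    exact h1⟩
  map_one' := rfl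
  map_mul' _ _ := rfl

/-- Restriction in second cohomology along a homomorphism compatible with the gradings. -/
def resH2 {Γ Δ : Type*} [Group Γ] [Group Δ] (s : Γ →* ℤˣ) (t : Δ →* ℤˣ) (f : Δ →* Γ)
    (hf : ∀ x, s (f x) = t x) : H2 Γ (UT s) →* H2 Δ (UT t) :=
  QuotientGroup.map _ _ (resZ2 s t f hf) (by
    rintro ω ⟨x, hx⟩
    refine ⟨fun g => x (f g), fun g h => ?_⟩
    have h1 := hx (f g) (f h)
    rw [UT.smul_def, hf, ← map_mul] at h1
    exact h1)

/-- `H¹(Γ, M)` for a trivial `Γ`-module `M`: 1-cocycles are homomorphisms and 1-coboundaries are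
trivial. -/
abbrev H1 (Γ M : Type*) [Group Γ] [CommGroup M] : Type _ := Γ →* M

/-- `H²(Γ, U(1))` with trivial action. -/
abbrev H2U (Γ : Type*) [Group Γ] : Type _ := H2 Γ (UT (1 : Γ →* ℤˣ))

private theorem slant_aux {M : Type*} [CommGroup M] {A B C D E P Q X Y : M}
    (e1 : P * A = C * X) (e2 : P * B = D * Q) (e3 : Y * C = E * Q) :
    X / Y = A / B * (D / E) := by
  rw [div_mul_div_comm, div_eq_div_iff_mul_eq_mul]
  apply mul_right_cancel (b := C * P * Q)
  calc X * (B * E) * (C * P * Q) = (C * X) * (P * B) * (E * Q) := by ac_rfl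
    _ = (P * A) * (D * Q) * (Y * C) := by rw [← e1, e2, e3]
    _ = A * D * Y * (C * P * Q) := by ac_rfl

/-- If the images of `a` and `b` commute elementwise and act trivially on `U_T(1)`, the slant
product `(x, y) ↦ ω(a x, b y) / ω(b y, a x)` of a 2-cocycle is multiplicative in both arguments,
that is, an element of `H¹(X, H¹(Y, U(1)))`. -/
def slantZ2 {Γ X Y : Type*} [Group Γ] [Group X] [Group Y] (s : Γ →* ℤˣ) (a : X →* Γ) (b : Y →* Γ)
    (hab : ∀ x y, Commute (a x) (b y)) (ha : ∀ x, s (a x) = 1) (hb : ∀ y, s (b y) = 1) :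
    Z2 Γ (UT s) →* H1 X (H1 Y Circle) :=
  have smulA : ∀ (x : X) (z : UT s), a x • z = z := fun x z => by rw [UT.smul_def, ha]; simp
  have smulB : ∀ (y : Y) (z : UT s), b y • z = z := fun y z => by rw [UT.smul_def, hb]; simp
  { toFun := fun ω => MonoidHom.mk' (fun x => MonoidHom.mk'
        (fun y => ((ω : Γ × Γ → UT s) (a x, b y) / (ω : Γ × Γ → UT s) (b y, a x) : UT s))
        (fun y y' => by
          have h1 := ω.2 (a x) (b y) (b y')
          have h2 := ω.2 (b y) (a x) (b y')
          have h3 := ω.2 (b y) (b y') (a x)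
          simp only [smulA, smulB] at h1 h2 h3
          rw [(hab x y).eq] at h1
          rw [← (hab x y').eq] at h3
          rw [map_mul]
          exact slant_aux h1 h2 h3))
        (fun x x' => by
          ext1 y
          have h1 := ω.2 (b y) (a x) (a x')
          have h2 := ω.2 (a x) (b y) (a x')
          have h3 := ω.2 (a x) (a x') (b y)
          simp only [smulA, smulB] at h1 h2 h3
          rw [← (hab x y).eq] at h1
          rw [(hab x' y).eq] at h3
          have h4 := slant_aux h1 h2 h3
          have h5 := congrArg (fun z : UT s => z⁻¹) h4
          simp only [mul_inv, inv_div] at h5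
          rw [← map_mul] at h5
          exact h5)
    map_one' := by
      ext x y
      exact congrArg Circle.coeHom (div_self' (1 : Circle))
    map_mul' := fun ω ω' => by
      ext1 x
      ext1 y
      exact mul_div_mul_comm (α := UT s) _ _ _ _ }

/-- The slant product on cohomology classes. -/
def slantH2 {Γ X Y : Type*} [Group Γ] [Group X] [Group Y] (s : Γ →* ℤˣ) (a : X →* Γ) (b : Y →* Γ)
    (hab : ∀ x y, Commute (a x) (b y)) (ha : ∀ x, s (a x) = 1) (hb : ∀ y, s (b y) = 1) :
    H2 Γ (UT s) →* H1 X (H1 Y Circle) :=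
  QuotientGroup.lift _ (slantZ2 s a b hab ha hb) (by
    rintro ω ⟨φ, hφ⟩
    ext1 x
    ext1 y
    have h1 := hφ (a x) (b y)
    have h2 := hφ (b y) (a x)
    rw [UT.smul_def, ha, Units.val_one, zpow_one] at h1
    rw [UT.smul_def, hb, Units.val_one, zpow_one] at h2
    change ((ω : Γ × Γ → UT s) (a x, b y) / (ω : Γ × Γ → UT s) (b y, a x) : UT s) = 1
    rw [← h1, ← h2, (hab x y).eq, div_eq_one, div_mul_eq_mul_div, div_mul_eq_mul_div,
      mul_comm (φ (b y))])

end Cohomology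

/-! ### The symmetry group of the doubled state -/

section DoubledGroup

variable (G K : Type*) [Group G] [Group K]

/-- The action of the Hermiticity symmetry on the physical symmetry `G_l × G_r × K`:
the nontrivial element `-1` swaps `G_l` and `G_r`. -/
def hermAut : ℤˣ →* MulAut (G × G × K) :=
  MonoidHom.mk'
    (fun ε => if ε = 1 then 1 else
      { toFun := fun x => (x.2.1, x.1, x.2.2)
        invFun := fun x => (x.2.1, x.1, x.2.2)
        left_inv := fun _ => rfl
        right_inv := fun _ => rfl
        map_mul' := fun _ _ => rfl })
    (fun ε ε' => by
      rcases Int.units_eq_one_or ε with rfl | rfl <;>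
      rcases Int.units_eq_one_or ε' with rfl | rfl <;>
      ext x <;> simp)

/-- `(G_l × G_r × K) ⋊ Z₂^H`, with `Z₂^H = {1, -1}`. -/
abbrev DoubledGroup : Type _ := (G × G × K) ⋊[hermAut G K] ℤˣ

/-- The grading: elements outside `G_l × G_r × K` are anti-unitary. -/
abbrev dsgn : DoubledGroup G K →* ℤˣ := SemidirectProduct.rightHom

/-- The Hermiticity symmetry. -/
def hermElt : DoubledGroup G K := SemidirectProduct.inr (-1)

/-- `g ↦ (g, e, e)`. -/
def inclL : G →* DoubledGroup G K :=
  SemidirectProduct.inl.comp (MonoidHom.inl G (G × K))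

/-- `h ↦ (e, h, e)`. -/
def inclR : G →* DoubledGroup G K :=
  SemidirectProduct.inl.comp ((MonoidHom.inr G (G × K)).comp (MonoidHom.inl G K))

/-- `k ↦ (e, e, k)`. -/
def inclK : K →* DoubledGroup G K :=
  SemidirectProduct.inl.comp ((MonoidHom.inr G (G × K)).comp (MonoidHom.inr G K))

/-- The subgroup `K × Z₂^H`. -/
def inclKH : K × ℤˣ →* DoubledGroup G K :=
  MonoidHom.mk' (fun p => ⟨(1, 1, p.1), p.2⟩) (fun p q => by
    obtain ⟨p, ε⟩ := p
    refine SemidirectProduct.ext ?_ rfl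
    rw [SemidirectProduct.mul_left]
    rcases Int.units_eq_one_or ε with rfl | rfl <;> ext <;> simp [hermAut])

/-- The doubled-state phase data `H²((G_l × G_r × K) ⋊ Z₂^H, U_T(1))`. -/
abbrev DoubledH2 : Type _ := H2 (DoubledGroup G K) (UT (dsgn G K))

/-- `[ω] ↦ [ω_L]`. -/
def resL : DoubledH2 G K →* H2U G := resH2 _ _ (inclL G K) (fun _ => rfl)

/-- `[ω] ↦ [ω_R]`. -/
def resR : DoubledH2 G K →* H2U G := resH2 _ _ (inclR G K) (fun _ => rfl)

/-- `[ω] ↦ [ω_K]`. -/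
def resK : DoubledH2 G K →* H2U K := resH2 _ _ (inclK G K) (fun _ => rfl)

/-- Restriction to `Z₂^H`. -/
def resH : DoubledH2 G K →* H2 ℤˣ (UT (MonoidHom.id ℤˣ)) :=
  resH2 _ _ SemidirectProduct.inr (fun _ => rfl)

/-- Restriction to `K × Z₂^H`. -/
def resKH : DoubledH2 G K →* H2 (K × ℤˣ) (UT (MonoidHom.snd K ℤˣ)) :=
  resH2 _ _ (inclKH G K) (fun _ => rfl)

/-- The slant product of `G_l` with `G_r`. -/
def slantLR : DoubledH2 G K →* H1 G (H1 G Circle) :=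
  slantH2 _ (inclL G K) (inclR G K)
    (fun x y => by ext <;> simp [inclL, inclR]) (fun _ => rfl) (fun _ => rfl)

/-- The slant product of `G_l` with `K`. -/
def slantLK : DoubledH2 G K →* H1 G (H1 K Circle) :=
  slantH2 _ (inclL G K) (inclK G K)
    (fun x y => by ext <;> simp [inclL, inclK]) (fun _ => rfl) (fun _ => rfl)

/-- The slant product of `G_r` with `K`. -/
def slantRK : DoubledH2 G K →* H1 G (H1 K Circle) :=
  slantH2 _ (inclR G K) (inclK G K)
    (fun x y => by ext <;> simp [inclR, inclK]) (fun _ => rfl) (fun _ => rfl)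

/-- The classes satisfying the constraints: no phase protected by `K` and Hermiticity alone,
`[ω_R] = -[ω_L]`, no mixed anomaly between `G_l` and `G_r`, and opposite mixed anomalies of `K`
with `G_l` and with `G_r` (group laws written multiplicatively). -/
def constrainedClasses : Subgroup (DoubledH2 G K) :=
  (resKH G K).ker ⊓ (resL G K * resR G K).ker ⊓ (slantLR G K).ker ⊓
    (slantLK G K * slantRK G K).ker

end DoubledGroup

/-! ### Matrix product density operators -/

section MPDO

variable {ι κ : Type*} [Fintype ι] [DecidableEq ι] [Fintype κ] [DecidableEq κ]

/-- The local tensor: a family of bond matrices indexed by the ket and the bra basis. -/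
abbrev Tensor (ι κ : Type*) : Type _ := ι → ι → Matrix κ κ ℂ

/-- The (unnormalized) density operator on a ring of `L` sites. -/
def mpdo (A : Tensor ι κ) (L : ℕ) : Matrix (Fin L → ι) (Fin L → ι) ℂ :=
  Matrix.of fun i j => ((List.ofFn fun x => A (i x) (j x)).prod).trace

/-- `⨂ₓ u` on `L` sites. -/
def sitePow (u : Matrix ι ι ℂ) (L : ℕ) : Matrix (Fin L → ι) (Fin L → ι) ℂ :=
  Matrix.of fun i j => ∏ x, u (i x) (j x)

/-- The local tensor is injective as a map from the virtual to the (ket and bra) physical space. -/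
def IsInjective (A : Tensor ι κ) : Prop :=
  Function.Injective fun (X : κ → κ → ℂ) (p : ι × ι) => ∑ a, ∑ b, A p.1 p.2 a b * X a b

/-- The transfer matrix. -/
def transfer (A : Tensor ι κ) : Matrix κ κ ℂ := ∑ i, A i i

/-- There is a real nondegenerate eigenvalue that exceeds the modulus of every other eigenvalue. -/
def HasUniqueLargestEigenvalue (T : Matrix κ κ ℂ) : Prop :=
  ∃ r : ℝ, Module.finrank ℂ (Module.End.eigenspace (Matrix.toLin' T) (r : ℂ)) = 1 ∧
    ∀ μ : ℂ, Module.End.HasEigenvalue (Matrix.toLin' T) μ → μ ≠ (r : ℂ) → ‖μ‖ < r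

/-- The two conditions of strong injectivity. -/
structure IsStrongInjective (A : Tensor ι κ) : Prop where
  injective : IsInjective A
  transfer : HasUniqueLargestEigenvalue (transfer A)

/-- The tensor generates a Hermitian positive semidefinite operator on every ring. -/
def IsDensity (A : Tensor ι κ) : Prop :=
  ∀ L : ℕ, 1 ≤ L → (mpdo A L).PosSemidef

/-- `U ρ = e^{iθ} ρ` and `ρ U† = e^{-iθ} ρ` on every ring. -/
def IsStronglySymmetric (u : Matrix ι ι ℂ) (A : Tensor ι κ) : Prop :=
  ∀ L : ℕ, 1 ≤ L → ∃ θ : Circle,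
    sitePow u L * mpdo A L = (θ : ℂ) • mpdo A L ∧
    mpdo A L * (sitePow u L).conjTranspose = ((θ⁻¹ : Circle) : ℂ) • mpdo A L

/-- `U ρ U† = ρ` on every ring. -/
def IsWeaklySymmetric (u : Matrix ι ι ℂ) (A : Tensor ι κ) : Prop :=
  ∀ L : ℕ, 1 ≤ L → sitePow u L * mpdo A L * (sitePow u L).conjTranspose = mpdo A L

/-- `U ρ* U† = ρ` on every ring, that is, invariance under the anti-unitary operator `U ∘ conj`. -/
def IsAntiunitarySymmetric (u : Matrix ι ι ℂ) (A : Tensor ι κ) : Prop :=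
  ∀ L : ℕ, 1 ≤ L →
    sitePow u L * (mpdo A L).map star * (sitePow u L).conjTranspose = mpdo A L

/-- A strong injective MPDO with strong symmetry `G` and weak symmetry `K`, acting on each site
through a unitary representation of `G × K`. -/
structure IsSymmetricMPDO {G K : Type*} [Group G] [Group K]
    (u : G × K →* Matrix.unitaryGroup ι ℂ) (A : Tensor ι κ) : Prop where
  strongInjective : IsStrongInjective A
  density : IsDensity A
  strong : ∀ g : G, IsStronglySymmetric (u (g, 1) : Matrix ι ι ℂ) A
  weak : ∀ k : K, IsWeaklySymmetric (u (1, k) : Matrix ι ι ℂ) A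

/-- A strong injective MPDO with an on-site time-reversal symmetry `U ∘ conj` squaring to `±1`. -/
structure IsTimeReversalMPDO (u : Matrix.unitaryGroup ι ℂ) (A : Tensor ι κ) : Prop where
  strongInjective : IsStrongInjective A
  density : IsDensity A
  square : (u : Matrix ι ι ℂ) * (u : Matrix ι ι ℂ).map star = 1 ∨
    (u : Matrix ι ι ℂ) * (u : Matrix ι ι ℂ).map star = -1
  symm : IsAntiunitarySymmetric (u : Matrix ι ι ℂ) A

/-! ### Symmetry action on the doubled state and the projective class -/

/-- `M` or its entrywise complex conjugate. -/
def twist {m n : Type*} (ε : ℤˣ) (M : Matrix m n ℂ) : Matrix m n ℂ :=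
  if ε = 1 then M else M.map star

/-- The action of the on-site (anti-)unitary operator `D g` of the doubled state on the tensor. -/
def tensorAct {Γ : Type*} [Group Γ] (s : Γ →* ℤˣ) (D : Γ → Matrix (ι × ι) (ι × ι) ℂ)
    (g : Γ) (A : Tensor ι κ) : Tensor ι κ :=
  fun i j => ∑ p : ι × ι, D g (i, j) p • twist (s g) (A p.1 p.2)

/-- `V` is the action of the symmetry on the virtual space, with `U(1)` factor system `ω`.
The phase `θ` is the charge per site. -/
structure IsVirtualRep {Γ : Type*} [Group Γ] (s : Γ →* ℤˣ)
    (D : Γ → Matrix (ι × ι) (ι × ι) ℂ) (A : Tensor ι κ)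
    (V : Γ → (Matrix κ κ ℂ)ˣ) (ω : Γ × Γ → Circle) : Prop where
  covariant : ∀ g, ∃ θ : Circle, ∀ i j, tensorAct s D g A i j =
    (θ : ℂ) • ((↑(V g)⁻¹ : Matrix κ κ ℂ) * A i j * (V g : Matrix κ κ ℂ))
  mul : ∀ g h, (V g : Matrix κ κ ℂ) * twist (s g) (V h : Matrix κ κ ℂ) =
    (ω (g, h) : ℂ) • (V (g * h) : Matrix κ κ ℂ)

/-- `c` is the class of the projective representation on the virtual space. -/
def HasClass {Γ : Type*} [Group Γ] (s : Γ →* ℤˣ) (D : Γ → Matrix (ι × ι) (ι × ι) ℂ)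
    (A : Tensor ι κ) (c : H2 Γ (UT s)) : Prop :=
  ∃ (V : Γ → (Matrix κ κ ℂ)ˣ) (ω : Z2 Γ (UT s)),
    IsVirtualRep s D A V (ω : Γ × Γ → UT s) ∧ QuotientGroup.mk ω = c

/-- The power of the swap of ket and bra: identity for `1`, swap for `-1`. -/
def swapPow (ι : Type*) [DecidableEq ι] (ε : ℤˣ) : Matrix (ι × ι) (ι × ι) ℂ :=
  Matrix.of fun p q => if (if ε = 1 then p else p.swap) = q then 1 else 0

/-- The on-site action of `(G_l × G_r × K) ⋊ Z₂^H` on ket and bra: `(g, h, k)` acts by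
`u(g, k) ⊗ u(h, k)*`, and the Hermiticity symmetry by the swap (and complex conjugation). -/
def doubledOp {G K : Type*} [Group G] [Group K] (u : G × K →* Matrix.unitaryGroup ι ℂ)
    (x : DoubledGroup G K) : Matrix (ι × ι) (ι × ι) ℂ :=
  ((u (x.left.1, x.left.2.2) : Matrix ι ι ℂ) ⊗ₖ
    ((u (x.left.2.1, x.left.2.2) : Matrix ι ι ℂ).map star)) * swapPow ι x.right

/-- The class in `H²((G_l × G_r × K) ⋊ Z₂^H, U_T(1))` is realized by some strong injective MPDO. -/
def IsRealized {G K : Type*} [Group G] [Group K] (c : DoubledH2 G K) : Prop :=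
  ∃ (d χ : ℕ) (u : G × K →* Matrix.unitaryGroup (Fin d) ℂ) (A : Tensor (Fin d) (Fin χ)),
    IsSymmetricMPDO u A ∧ HasClass (dsgn G K) (doubledOp u) A c

/-- The grading of `Z₂^T × Z₂^H`: both generators are anti-unitary. -/
def trsgn : ℤˣ × ℤˣ →* ℤˣ := MonoidHom.fst ℤˣ ℤˣ * MonoidHom.snd ℤˣ ℤˣ

/-- The on-site action of `Z₂^T × Z₂^H` on ket and bra. -/
def trOp (u : Matrix.unitaryGroup ι ℂ) (x : ℤˣ × ℤˣ) : Matrix (ι × ι) (ι × ι) ℂ :=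
  (if x.1 = 1 then 1 else (u : Matrix ι ι ℂ) ⊗ₖ ((u : Matrix ι ι ℂ).map star)) * swapPow ι x.2

end MPDO

end MixedSPT

end

/-!
The classification rests on four facts.

*Virtual representations.* The matrices of an injective tensor span the full matrix algebra. If an
on-site operation preserves the generated operators up to phases, then the traces over two and
three sites show that the linear map between the old and the new tensor is, up to a phase, an
automorphism of the matrix algebra, hence inner (`exists_gauge`). The resulting gauge
transformations are unique up to scalars (`gauge_unique`), which gives the virtual representation,
the cocycle condition and the uniqueness of the class. An operation that moreover preserves the
transfer matrix preserves its leading eigenvector up to a scalar; these scalars trivialize the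
class (`IsVirtualRep.exists_coboundary`). This settles weak symmetry, Hermiticity and time reversal.

*Cohomology.* Classes are studied through the group extension `CocycleExt ω`: a restriction is trivial
if and only if the subgroup lifts, and slant products are commutators of lifts. If the restriction to
`Z₂^H` is trivial, then rescaling lifts by square roots of phases produces a representative that is
adapted to the Hermiticity symmetry (`exists_isHermNormal`), from which the relations between `G_l`
and `G_r` can be read off. A constrained class with trivial `[ω_L]` and trivial slant product of
`G_l` with `K` has a split extension (`eq_one_of_resL_of_slantLK`), and the cocycles
`doubledCocycle β` with `β = α χ` realize all values of these two invariants.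

*Positivity.* Let `T` be the transfer matrix, `a` the virtual matrix of `g` in `G_l` and `τ` the
antilinear automorphism of the bond algebra implemented by Hermiticity. The powers of `T / r`
converge to a projection `P` of rank one (`exists_tendsto_transfer_pow`), and `a τ(a)` commutes with
`T`, so `P a τ(a) = c_g P`. The number `c_g` is the long-range order of a string operator for `g`. The
Gram matrix of such string operators with many far separated end points is positive semidefinite,
and all its entries above the diagonal have the limit `c_g`; this is possible only if `c_g ≥ 0`
(`stringOrder_nonneg`). Since `c_g` is multiplicative in `g` up to the slant product of `G_l` with
`G_r`, that phase is positive, hence `1` (`slantLR_eq_one_of_hasClass`).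

*Realization.* For finite groups, let `V` be the regular projective representation of `G × K` with
cocycle `β`. The fixed-point matrix product state with sites `V* ⊗ V`, in which neighbouring sites
share maximally entangled pairs, is symmetric, and its density operator has the class of
`doubledCocycle β` (`isVirtualRep_pairVirtual`).
-/

noncomputable section

namespace MixedSPT

set_option linter.unusedSectionVars false

/-! ### The extension defined by a 2-cocycle -/

section Extension

variable {Γ M : Type*} [Group Γ] [CommGroup M] [MulDistribMulAction Γ M]

/-- Cocycles that differ by the coboundary of `φ` have the same class. -/
theorem mk_eq_of_mul_coboundary {ω ω' : Z2 Γ M} (φ : Γ → M)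
    (h : ∀ g k, ω'.1 (g, k) = φ g * g • φ k * ω.1 (g, k) / φ (g * k)) :
    (QuotientGroup.mk ω' : H2 Γ M) = QuotientGroup.mk ω := by
  symm
  rw [QuotientGroup.eq]
  refine ⟨φ, fun g k => ?_⟩
  simp only [Subgroup.coe_mul, InvMemClass.coe_inv, Pi.mul_apply, Pi.inv_apply, h,
    div_eq_mul_inv]
  rw [mul_comm (φ g * g • φ k) (ω.1 (g, k)), mul_assoc (ω.1 (g, k)), inv_mul_cancel_left]
  ac_rfl

/-- The extension of `Γ` by `M` defined by the 2-cocycle `ω`: the set `M × Γ` with the product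
`(a, g) (b, h) = (a · g • b · ω(g, h), gh)`. -/
@[ext]
structure CocycleExt (ω : Z2 Γ M) where
  /-- the component in the coefficient module -/
  val : M
  /-- the component in the group -/
  pt : Γ

namespace CocycleExt

variable {ω : Z2 Γ M}

instance : Mul (CocycleExt ω) := ⟨fun x y => ⟨x.val * x.pt • y.val * ω.1 (x.pt, y.pt), x.pt * y.pt⟩⟩
instance : One (CocycleExt ω) := ⟨⟨(ω.1 (1, 1))⁻¹, 1⟩⟩
instance : Inv (CocycleExt ω) :=
  ⟨fun x => ⟨(ω.1 (1, 1))⁻¹ * (x.pt⁻¹ • x.val)⁻¹ * (ω.1 (x.pt⁻¹, x.pt))⁻¹, x.pt⁻¹⟩⟩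

theorem mul_def (x y : CocycleExt ω) :
    x * y = ⟨x.val * x.pt • y.val * ω.1 (x.pt, y.pt), x.pt * y.pt⟩ := rfl

theorem one_def : (1 : CocycleExt ω) = ⟨(ω.1 (1, 1))⁻¹, 1⟩ := rfl

instance : Group (CocycleExt ω) := Group.ofLeftAxioms
  (fun x y z => by
    have h := ω.2 x.pt y.pt z.pt
    refine CocycleExt.ext ?_ (mul_assoc _ _ _)
    simp only [mul_def, smul_mul', mul_smul]
    calc _ = x.val * x.pt • y.val * x.pt • y.pt • z.val *
          (ω.1 (x.pt * y.pt, z.pt) * ω.1 (x.pt, y.pt)) := by ac_rfl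
      _ = _ := by rw [h]; ac_rfl)
  (fun x => by
    refine CocycleExt.ext ?_ (one_mul _)
    have h := groupCohomology.map_one_fst_of_isMulCocycle₂ ω.2 x.pt
    simp only [mul_def, one_def, one_smul]
    rw [h, mul_right_comm, inv_mul_cancel, one_mul])
  (fun x => by
    refine CocycleExt.ext ?_ (inv_mul_cancel _)
    change (ω.1 (1, 1))⁻¹ * (x.pt⁻¹ • x.val)⁻¹ * (ω.1 (x.pt⁻¹, x.pt))⁻¹ * x.pt⁻¹ • x.val *
      ω.1 (x.pt⁻¹, x.pt) = (ω.1 (1, 1))⁻¹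
    rw [mul_right_comm, inv_mul_cancel_right, inv_mul_cancel_right])

@[simp] theorem pt_mul (x y : CocycleExt ω) : (x * y).pt = x.pt * y.pt := rfl

@[simp] theorem pt_inv (x : CocycleExt ω) : x⁻¹.pt = x.pt⁻¹ := rfl

/-- The embedding of the coefficients in the extension. The factor `ω(1, 1)⁻¹` is needed because
the cocycle is not assumed to be normalized. -/
def incl (ω : Z2 Γ M) : M →* CocycleExt ω where
  toFun a := ⟨a * (ω.1 (1, 1))⁻¹, 1⟩
  map_one' := by rw [one_mul]; rfl
  map_mul' a b := by
    refine CocycleExt.ext ?_ (one_mul _).symm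
    simp only [mul_def, one_smul]
    rw [mul_assoc _ _ (ω.1 (1, 1)), inv_mul_cancel_right]
    ac_rfl

theorem incl_mul (a : M) (x : CocycleExt ω) : incl ω a * x = ⟨a * x.val, x.pt⟩ := by
  refine CocycleExt.ext ?_ (one_mul _)
  change a * (ω.1 (1, 1))⁻¹ * (1 : Γ) • x.val * ω.1 (1, x.pt) = a * x.val
  simp only [groupCohomology.map_one_fst_of_isMulCocycle₂ ω.2, one_smul]
  rw [mul_right_comm, inv_mul_cancel_right]

theorem mul_incl (x : CocycleExt ω) (a : M) : x * incl ω a = incl ω (x.pt • a) * x := by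
  rw [incl_mul]
  refine CocycleExt.ext ?_ (mul_one _)
  change x.val * x.pt • (a * (ω.1 (1, 1))⁻¹) * ω.1 (x.pt, 1) = x.pt • a * x.val
  rw [groupCohomology.map_one_snd_of_isMulCocycle₂ ω.2 x.pt, smul_mul', smul_inv']
  rw [← mul_assoc, inv_mul_cancel_right, mul_comm]

theorem incl_injective : Function.Injective (incl ω) := fun _ _ h =>
  mul_right_cancel (congrArg CocycleExt.val h)

theorem eq_one_of_eq_incl_mul {a : M} {x : CocycleExt ω} (h : x = incl ω a * x) : a = 1 :=
  incl_injective (ω := ω) ((right_eq_mul.mp h).trans (map_one _).symm)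

theorem exists_incl_mul {x y : CocycleExt ω} (h : x.pt = y.pt) : ∃ a : M, x = incl ω a * y :=
  ⟨x.val * y.val⁻¹, by rw [incl_mul]; ext <;> simp [h]⟩

/-- Every set-theoretic section of the extension has a factor system, which is a cocycle in the
class of `ω`. -/
theorem exists_cocycle_of_section (σ : Γ → CocycleExt ω) (hσ : ∀ g, (σ g).pt = g) :
    ∃ ω' : Z2 Γ M, (QuotientGroup.mk ω' : H2 Γ M) = QuotientGroup.mk ω ∧
      ∀ g h, σ g * σ h = incl ω (ω'.1 (g, h)) * σ (g * h) := by
  let φ : Γ → M := fun g => (σ g).val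
  let b : Z2 Γ M := ⟨fun p => p.1 • φ p.2 / φ (p.1 * p.2) * φ p.1, fun g h j => by
    simp only [smul_mul', mul_smul, mul_assoc, div_eq_mul_inv]
    calc _ = g • h • φ j * (φ (g * (h * j)))⁻¹ * g • φ h * φ g *
          ((φ (g * h))⁻¹ * φ (g * h)) := by ac_rfl
      _ = g • h • φ j * (φ (g * (h * j)))⁻¹ * g • φ h * φ g *
          ((g • φ (h * j))⁻¹ * g • φ (h * j)) := by rw [inv_mul_cancel, inv_mul_cancel]
      _ = _ := by simp only [smul_inv']; ac_rfl⟩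
  refine ⟨b * ω, mk_eq_of_mul_coboundary φ fun g k => ?_, fun g h => ?_⟩
  · change g • φ k / φ (g * k) * φ g * ω.1 (g, k) = _
    simp only [div_eq_mul_inv]
    ac_rfl
  · rw [incl_mul]
    refine CocycleExt.ext ?_ (by simp [hσ])
    change (σ g).val * (σ g).pt • (σ h).val * ω.1 ((σ g).pt, (σ h).pt) =
      g • φ h / φ (g * h) * φ g * ω.1 (g, h) * φ (g * h)
    rw [hσ, hσ]
    change φ g * g • φ h * ω.1 (g, h) = _
    rw [div_eq_mul_inv, mul_comm (φ g), mul_right_comm _ (φ (g * h))⁻¹,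
      mul_right_comm _ (φ (g * h))⁻¹, inv_mul_cancel_right]

/-- A cocycle whose extension splits is trivial in cohomology. -/
theorem mk_eq_one_of_splitting (σ : Γ →* CocycleExt ω) (hσ : ∀ g, (σ g).pt = g) :
    (QuotientGroup.mk ω : H2 Γ M) = 1 := by
  obtain ⟨ω', h1, h2⟩ := exists_cocycle_of_section σ hσ
  have : ω' = 1 := by
    refine Subtype.ext (funext fun p => ?_)
    have := h2 p.1 p.2
    rw [← map_mul] at this
    exact eq_one_of_eq_incl_mul this
  rw [← h1, this]
  rfl

end CocycleExt

open CocycleExt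

variable {Δ : Type*} [Group Δ]

/-- If the restriction of a class along `f` is trivial, then `f` lifts to the extension. -/
theorem exists_lift_of_resH2_eq_one {s : Γ →* ℤˣ} {t : Δ →* ℤˣ} {f : Δ →* Γ}
    {hf : ∀ x, s (f x) = t x} {ω : Z2 Γ (UT s)}
    (h : resH2 s t f hf (QuotientGroup.mk ω) = 1) :
    ∃ σ : Δ →* CocycleExt ω, ∀ x, (σ x).pt = f x := by
  obtain ⟨φ, hφ⟩ := (QuotientGroup.eq_one_iff (N := B2 Δ (UT t)) (resZ2 s t f hf ω)).mp h
  let ψ : Δ → UT s := φ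
  have hψ : ∀ x y, f x • ψ y / ψ (x * y) * ψ x = ω.1 (f x, f y) := fun x y => by
    rw [UT.smul_def, hf]
    exact hφ x y
  refine ⟨MonoidHom.mk' (fun x => ⟨(ψ x)⁻¹, f x⟩) fun x y => ?_, fun x => rfl⟩
  refine CocycleExt.ext ?_ (map_mul _ _ _)
  change (ψ (x * y))⁻¹ = (ψ x)⁻¹ * f x • (ψ y)⁻¹ * ω.1 (f x, f y)
  rw [← hψ, smul_inv', ← mul_inv, inv_mul_eq_div, eq_div_iff_mul_eq', div_eq_mul_inv]
  ac_rfl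

/-- The slant product is the commutator of lifts to the extension. -/
theorem mul_eq_slantH2_mul {X Y : Type*} [Group X] [Group Y] {s : Γ →* ℤˣ} {a : X →* Γ}
    {b : Y →* Γ} {hab : ∀ x y, Commute (a x) (b y)} {ha : ∀ x, s (a x) = 1}
    {hb : ∀ y, s (b y) = 1} {ω : Z2 Γ (UT s)} {x : X} {y : Y} {e e' : CocycleExt ω}
    (he : e.pt = a x) (he' : e'.pt = b y) :
    e * e' = incl ω (slantH2 s a b hab ha hb (QuotientGroup.mk ω) x y : Circle) * (e' * e) := by
  change e * e' = incl ω (ω.1 (a x, b y) / ω.1 (b y, a x) : UT s) * (e' * e)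
  rw [incl_mul]
  refine CocycleExt.ext ?_ (by simp only [pt_mul, he, he', (hab x y).eq])
  change e.val * e.pt • e'.val * ω.1 (e.pt, e'.pt) =
    (ω.1 (a x, b y) / ω.1 (b y, a x) : UT s) * (e'.val * e'.pt • e.val * ω.1 (e'.pt, e.pt))
  rw [he, he', UT.smul_def, UT.smul_def, ha, hb]
  simp only [Units.val_one, zpow_one]
  rw [div_eq_mul_inv, mul_comm (e'.val * e.val), mul_assoc (ω.1 (a x, b y)),
    inv_mul_cancel_left, mul_comm (ω.1 _), mul_comm e.val]

end Extension

/-! ### Classes on the doubled symmetry group -/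

section Doubled

open CocycleExt

variable {G K : Type*} [Group G] [Group K]

theorem hermAut_neg_one (x : G × G × K) : hermAut G K (-1) x = (x.2.1, x.1, x.2.2) := rfl

theorem hermAut_neg_one_neg_one (x : G × G × K) :
    hermAut G K (-1) (hermAut G K (-1) x) = x := rfl

/-- A square root on the circle that fixes `1`; it is not continuous. -/
theorem Circle.exists_sqrt : ∃ f : Circle → Circle, f 1 = 1 ∧ ∀ z, f z * f z = z :=
  ⟨fun z => Circle.exp (Complex.arg z / 2), by simp, fun z => by
    rw [← Circle.exp_add, add_halves, Circle.exp_arg]⟩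

theorem UT.smul_of_eq_one {Γ : Type*} [Group Γ] {s : Γ →* ℤˣ} {g : Γ} (h : s g = 1) (z : UT s) :
    g • z = z := by simp [UT.smul_def, h]

theorem UT.smul_of_eq_neg_one {Γ : Type*} [Group Γ] {s : Γ →* ℤˣ} {g : Γ} (h : s g = -1)
    (z : UT s) : g • z = z⁻¹ := by simp [UT.smul_def, h]

/-- A cocycle on the doubled symmetry group that does not see the Hermiticity symmetry, except
that the latter acts on the remaining cocycle by inversion. -/
def IsHermNormal (ω : Z2 (DoubledGroup G K) (UT (dsgn G K))) : Prop :=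
  ω.1 (hermElt G K, hermElt G K) = 1 ∧
  (∀ x : G × G × K, ω.1 (SemidirectProduct.inl x, hermElt G K) = 1 ∧
    ω.1 (hermElt G K, SemidirectProduct.inl x) = 1) ∧
  ∀ x y : G × G × K, ω.1 (SemidirectProduct.inl x, SemidirectProduct.inl y) =
    (ω.1 (SemidirectProduct.inl (hermAut G K (-1) x),
      SemidirectProduct.inl (hermAut G K (-1) y)))⁻¹

/-- A class with trivial restriction to `Z₂^H` has a normalized representative: a lift `h` of the
Hermiticity symmetry with `h² = 1` acts by conjugation on lifts of `G_l × G_r × K` up to phases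
`c_x`, which are invariant under the swap; rescaling the lifts by `√c_x` removes the phases. -/
theorem exists_isHermNormal {c : DoubledH2 G K} (hc : resH G K c = 1) :
    ∃ ω : Z2 (DoubledGroup G K) (UT (dsgn G K)), QuotientGroup.mk ω = c ∧ IsHermNormal ω := by
  obtain ⟨ω, rfl⟩ := QuotientGroup.mk_surjective c
  obtain ⟨t, ht⟩ := exists_lift_of_resH2_eq_one hc
  set h := t (-1) with hh
  have hpt : h.pt = hermElt G K := ht _
  have hsq : h * h = 1 := by rw [hh, ← map_mul]; simp
  have hι : ∀ a, h * incl ω a = incl ω a⁻¹ * h := fun a => by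
    rw [mul_incl, UT.smul_of_eq_neg_one (by rw [hpt]; rfl)]
  -- The component `ω(1, 1)⁻¹` makes the lift of the identity the identity.
  let s : G × G × K → CocycleExt ω := fun x => ⟨(ω.1 (1, 1))⁻¹, SemidirectProduct.inl x⟩
  have hs1 : s 1 = 1 := rfl
  have hmul : ∀ x : G × G × K, hermElt G K * SemidirectProduct.inl x =
      SemidirectProduct.inl (hermAut G K (-1) x) * hermElt G K := fun x => by
    ext <;> simp [hermElt]
  have hex : ∀ x, ∃ a, h * s x = incl ω a * (s (hermAut G K (-1) x) * h) := fun x =>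
    exists_incl_mul (by rw [pt_mul, pt_mul, hpt]; exact hmul x)
  choose c hc using hex
  -- Conjugating twice by `h` is the identity, and `h` inverts phases.
  have hcσ : ∀ x, c (hermAut G K (-1) x) = c x := fun x => by
    have h1 : s x = incl ω ((c x)⁻¹ * c (hermAut G K (-1) x)) * s x := by
      calc s x = h * h * s x := by rw [hsq, one_mul]
        _ = h * incl ω (c x) * s (hermAut G K (-1) x) * h := by
          rw [mul_assoc, hc]; simp only [mul_assoc]
        _ = incl ω (c x)⁻¹ * (h * s (hermAut G K (-1) x)) * h := by
          rw [hι]; simp only [mul_assoc]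
        _ = incl ω ((c x)⁻¹ * c (hermAut G K (-1) x)) * s x * (h * h) := by
          rw [hc, map_mul, hermAut_neg_one_neg_one]; simp only [mul_assoc]
        _ = _ := by rw [hsq, mul_one]
    exact (inv_mul_eq_one.mp (eq_one_of_eq_incl_mul h1)).symm
  have hc1 : c 1 = 1 := by
    have h1 := hc 1
    rw [map_one, hs1, mul_one, one_mul] at h1
    exact eq_one_of_eq_incl_mul h1
  obtain ⟨f, f1, hf⟩ := Circle.exists_sqrt
  let φ : G × G × K → UT (dsgn G K) := fun x => f (c x)
  have hφ : ∀ x, φ x * φ x = c x := fun x => hf _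
  let s' : G × G × K → CocycleExt ω := fun x => incl ω (φ x) * s x
  have hs'1 : s' 1 = 1 := by
    have : φ 1 = 1 := (congrArg f hc1).trans f1
    simp only [s', this, hs1, map_one, mul_one]
  have hs'h : ∀ x, h * s' x = s' (hermAut G K (-1) x) * h := fun x => by
    calc h * s' x = incl ω (φ x)⁻¹ * (h * s x) := by
          simp only [s', ← mul_assoc, hι]
      _ = incl ω (φ x) * (s (hermAut G K (-1) x) * h) := by
          rw [hc, ← mul_assoc, ← map_mul, ← hφ, inv_mul_cancel_left]
      _ = _ := by
          have : φ (hermAut G K (-1) x) = φ x := congrArg f (hcσ x)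
          simp only [s', this, mul_assoc]
  have hs'pt : ∀ x, (s' x).pt = SemidirectProduct.inl x := fun x => one_mul _
  clear_value s'
  obtain ⟨ω', h1, h2⟩ := exists_cocycle_of_section (ω := ω)
    (fun x : DoubledGroup G K => s' x.left * t x.right) (fun x => by
      rw [pt_mul, hs'pt, ht, SemidirectProduct.inl_left_mul_inr_right])
  have hcanc : ∀ {a : UT (dsgn G K)} {x y : CocycleExt ω}, x = incl ω a * y → x = y → a = 1 := by
    rintro a x y h rfl
    exact eq_one_of_eq_incl_mul h
  refine ⟨ω', h1, ?_, fun x => ⟨?_, ?_⟩, fun x y => ?_⟩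
  · refine hcanc (h2 _ _) ?_
    simp [hermElt, ← hh, hs'1, hsq]
  · refine hcanc (h2 _ _) ?_
    simp [hermElt, ← hh, hs'1]
  · refine hcanc (h2 _ _) ?_
    simp [hermElt, ← hh, hs'1, hs'h]
  · have e1 := h2 (SemidirectProduct.inl x) (SemidirectProduct.inl y)
    have e2 := h2 (SemidirectProduct.inl (hermAut G K (-1) x))
      (SemidirectProduct.inl (hermAut G K (-1) y))
    simp only [SemidirectProduct.left_inl, SemidirectProduct.right_inl, map_one, mul_one,
      ← map_mul] at e1 e2
    have e3 : incl ω ((ω'.1 (SemidirectProduct.inl x, SemidirectProduct.inl y))⁻¹) *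
        s' (hermAut G K (-1) (x * y)) * h =
        incl ω (ω'.1 (SemidirectProduct.inl (hermAut G K (-1) x),
          SemidirectProduct.inl (hermAut G K (-1) y))) * s' (hermAut G K (-1) (x * y)) * h := by
      rw [← e2, mul_assoc, ← hs'h, ← mul_assoc, ← hι, mul_assoc, ← e1, ← mul_assoc, hs'h,
        mul_assoc, hs'h, mul_assoc]
    have e4 := incl_injective (mul_right_cancel (mul_right_cancel e3))
    rw [← e4, inv_inv]

end Doubled

/-! ### The constrained classes -/

section Constrained

open CocycleExt

variable {G K : Type*} [Group G] [Group K]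

theorem resH2_comp {Γ Δ Λ : Type*} [Group Γ] [Group Δ] [Group Λ] {s : Γ →* ℤˣ} {t : Δ →* ℤˣ}
    {r : Λ →* ℤˣ} {f : Δ →* Γ} {f' : Λ →* Δ} (hf : ∀ x, s (f x) = t x)
    (hf' : ∀ x, t (f' x) = r x) (c : H2 Γ (UT s)) :
    resH2 s r (f.comp f') (fun x => (hf _).trans (hf' x)) c =
      resH2 t r f' hf' (resH2 s t f hf c) := by
  obtain ⟨ω, rfl⟩ := QuotientGroup.mk_surjective c
  rfl

theorem resH_eq_one_of_resKH {c : DoubledH2 G K} (h : resKH G K c = 1) : resH G K c = 1 := by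
  have := resH2_comp (f' := MonoidHom.inr K ℤˣ) (r := MonoidHom.id ℤˣ)
    (f := inclKH G K) (s := dsgn G K) (t := MonoidHom.snd K ℤˣ) (fun _ => rfl) (fun _ => rfl) c
  change resH G K c = resH2 _ _ _ _ (resKH G K c) at this
  rw [this, h, map_one]

theorem resK_eq_one_of_resKH {c : DoubledH2 G K} (h : resKH G K c = 1) : resK G K c = 1 := by
  have := resH2_comp (f' := MonoidHom.inl K ℤˣ) (r := (1 : K →* ℤˣ))
    (f := inclKH G K) (s := dsgn G K) (t := MonoidHom.snd K ℤˣ) (fun _ => rfl) (fun _ => rfl) c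
  change resK G K c = resH2 _ _ _ _ (resKH G K c) at this
  rw [this, h, map_one]

/-- Hermiticity inverts the cocycle of `G_r` relative to that of `G_l`. -/
theorem IsHermNormal.resR_eq {ω : Z2 (DoubledGroup G K) (UT (dsgn G K))} (h : IsHermNormal ω) :
    resR G K (QuotientGroup.mk ω) = (resL G K (QuotientGroup.mk ω))⁻¹ := by
  have : resZ2 (dsgn G K) (1 : G →* ℤˣ) (inclR G K) (fun _ => rfl) ω =
      (resZ2 (dsgn G K) (1 : G →* ℤˣ) (inclL G K) (fun _ => rfl) ω)⁻¹ :=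
    Subtype.ext (funext fun p => h.2.2 (1, p.1, 1) (1, p.2, 1))
  exact congrArg QuotientGroup.mk this

theorem IsHermNormal.slantRK_eq {ω : Z2 (DoubledGroup G K) (UT (dsgn G K))}
    (h : IsHermNormal ω) :
    slantRK G K (QuotientGroup.mk ω) = (slantLK G K (QuotientGroup.mk ω))⁻¹ := by
  ext1 g
  ext1 k
  have h1 := h.2.2 (1, g, 1) (1, 1, k)
  have h2 := h.2.2 (1, 1, k) (1, g, 1)
  have h3 : (ω.1 (inclR G K g, inclK G K k) / ω.1 (inclK G K k, inclR G K g) : UT (dsgn G K)) =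
      (ω.1 (inclL G K g, inclK G K k) / ω.1 (inclK G K k, inclL G K g))⁻¹ := by
    refine (congrArg₂ (· / ·) h1 h2).trans ?_
    rw [inv_div_inv, inv_div]
    rfl
  exact h3

theorem mem_constrainedClasses {c : DoubledH2 G K} :
    c ∈ constrainedClasses G K ↔ resKH G K c = 1 ∧ resR G K c = (resL G K c)⁻¹ ∧
      slantLR G K c = 1 ∧ slantRK G K c = (slantLK G K c)⁻¹ := by
  simp only [constrainedClasses, Subgroup.mem_inf, MonoidHom.mem_ker, MonoidHom.mul_apply,
    mul_eq_one_iff_eq_inv', and_assoc]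

/-- A constrained class is determined by `[ω_L]` and the slant product of `G_l` and `K`: if both
are trivial, then lifts of `G_l`, of its conjugate `G_r` and of `K × Z₂^H` generate a splitting of
the extension. -/
theorem eq_one_of_resL_of_slantLK {c : DoubledH2 G K} (hc : c ∈ constrainedClasses G K)
    (hL : resL G K c = 1) (hLK : slantLK G K c = 1) : c = 1 := by
  rw [mem_constrainedClasses] at hc
  obtain ⟨hKH, -, hLR, hRK⟩ := hc
  obtain ⟨ω, rfl⟩ := QuotientGroup.mk_surjective c
  rw [hLK, inv_one] at hRK
  obtain ⟨sL, hsL⟩ := exists_lift_of_resH2_eq_one hL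
  obtain ⟨sKH, hsKH⟩ := exists_lift_of_resH2_eq_one hKH
  set sH : ℤˣ →* CocycleExt ω := sKH.comp (MonoidHom.inr K ℤˣ) with hsH
  set sK : K →* CocycleExt ω := sKH.comp (MonoidHom.inl K ℤˣ) with hsK
  have hHpt : ∀ ε, (sH ε).pt = SemidirectProduct.inr ε := fun ε => hsKH _
  have hKpt : ∀ k, (sK k).pt = inclK G K k := fun k => hsKH _
  have hHK : ∀ ε k, Commute (sH ε) (sK k) := fun ε k => by
    simp only [hsH, hsK, Commute, SemiconjBy, MonoidHom.comp_apply, ← map_mul]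
    simp
  -- The lift of `G_r` is the conjugate of the lift of `G_l`, so the two are exchanged by
  -- Hermiticity by construction.
  let sR : G →* CocycleExt ω := (MulAut.conj (sH (-1))).toMonoidHom.comp sL
  have hRdef : ∀ g, sR g = sH (-1) * sL g * (sH (-1))⁻¹ := fun g => rfl
  have hHH : sH (-1) * sH (-1) = 1 := by rw [← map_mul]; simp
  have hHinv : (sH (-1))⁻¹ = sH (-1) := inv_eq_of_mul_eq_one_left hHH
  have hRpt : ∀ g, (sR g).pt = inclR G K g := fun g => by
    rw [hRdef, pt_mul, pt_mul, pt_inv, hHpt, hsL, ← map_inv]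
    change SemidirectProduct.inr (-1) * SemidirectProduct.inl (g, 1, 1) *
      SemidirectProduct.inr (-1)⁻¹ = _
    rw [← SemidirectProduct.inl_aut]
    rfl
  have cLR : ∀ g h, Commute (sL g) (sR h) := fun g h => by
    have h1 : slantLR G K (QuotientGroup.mk ω) g h = 1 := by rw [hLR]; rfl
    have h2 := mul_eq_slantH2_mul (ω := ω) (hab := fun x y => by ext <;> simp [inclL, inclR])
      (ha := fun _ => rfl) (hb := fun _ => rfl) (hsL g) (hRpt h)
    change _ = incl ω (slantLR G K (QuotientGroup.mk ω) g h : Circle) * _ at h2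
    rw [h1] at h2
    exact h2.trans (by erw [map_one]; rw [one_mul])
  have cLK : ∀ g k, Commute (sL g) (sK k) := fun g k => by
    have h1 : slantLK G K (QuotientGroup.mk ω) g k = 1 := by rw [hLK]; rfl
    have h2 := mul_eq_slantH2_mul (ω := ω) (hab := fun x y => by ext <;> simp [inclL, inclK])
      (ha := fun _ => rfl) (hb := fun _ => rfl) (hsL g) (hKpt k)
    change _ = incl ω (slantLK G K (QuotientGroup.mk ω) g k : Circle) * _ at h2
    rw [h1] at h2
    exact h2.trans (by erw [map_one]; rw [one_mul])
  have cRK : ∀ g k, Commute (sR g) (sK k) := fun g k => by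
    have h1 : slantRK G K (QuotientGroup.mk ω) g k = 1 := by rw [hRK]; rfl
    have h2 := mul_eq_slantH2_mul (ω := ω) (hab := fun x y => by ext <;> simp [inclR, inclK])
      (ha := fun _ => rfl) (hb := fun _ => rfl) (hRpt g) (hKpt k)
    change _ = incl ω (slantRK G K (QuotientGroup.mk ω) g k : Circle) * _ at h2
    rw [h1] at h2
    exact h2.trans (by erw [map_one]; rw [one_mul])
  let sN : G × G × K →* CocycleExt ω :=
    sL.noncommCoprod (sR.noncommCoprod sK cRK) (fun g p => (cLR g p.1).mul_right (cLK g p.2))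
  have hN : ∀ x, sN x = sL x.1 * (sR x.2.1 * sK x.2.2) := fun x => rfl
  have hconj : ∀ x, sN (hermAut G K (-1) x) = sH (-1) * sN x * (sH (-1))⁻¹ := fun x => by
    rw [hN, hN, hermAut_neg_one]
    have e1 : sL x.2.1 = sH (-1) * sR x.2.1 * (sH (-1))⁻¹ := by
      rw [hRdef, hHinv]
      simp only [mul_assoc]
      rw [hHH, mul_one, ← mul_assoc, hHH, one_mul]
    have e2 : sK x.2.2 = sH (-1) * sK x.2.2 * (sH (-1))⁻¹ := by
      rw [(hHK _ _).eq, mul_inv_cancel_right]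
    change sL x.2.1 * (sR x.1 * sK x.2.2) = _
    have e3 : sH (-1) * (sL x.1 * (sR x.2.1 * sK x.2.2)) * (sH (-1))⁻¹ =
        (sH (-1) * sL x.1 * (sH (-1))⁻¹) * ((sH (-1) * sR x.2.1 * (sH (-1))⁻¹) *
          (sH (-1) * sK x.2.2 * (sH (-1))⁻¹)) := by group
    rw [e3, ← e1, ← e2, ← hRdef, ← mul_assoc, ← mul_assoc, (cLR _ _).eq]
  let σ : DoubledGroup G K →* CocycleExt ω := SemidirectProduct.lift sN sH (fun ε => by
    ext1 x
    rcases Int.units_eq_one_or ε with rfl | rfl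
    · simp
    · exact hconj x)
  refine mk_eq_one_of_splitting σ fun x => ?_
  have hσ : σ x = sN x.left * sH x.right := rfl
  rw [hσ, pt_mul, hHpt, hN, pt_mul, pt_mul, hsL, hRpt, hKpt]
  refine Eq.trans ?_ (SemidirectProduct.inl_left_mul_inr_right x)
  congr 1
  change SemidirectProduct.inl _ * (SemidirectProduct.inl _ * SemidirectProduct.inl _) = _
  rw [← map_mul, ← map_mul]
  congr 1
  ext <;> simp

/-- The class of the doubled state `|ψ⟩⟨ψ|`, in which the bra carries the complex conjugate of the
cocycle `β` of the ket, and the Hermiticity symmetry swaps the two. -/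
def doubledCocycle (β : Z2 (G × K) (UT (1 : G × K →* ℤˣ))) :
    Z2 (DoubledGroup G K) (UT (dsgn G K)) :=
  ⟨fun p => (β.1 ((p.1.left.1, p.1.left.2.2),
      ((hermAut G K p.1.right p.2.left).1, p.2.left.2.2)) /
    β.1 ((p.1.left.2.1, p.1.left.2.2),
      ((hermAut G K p.1.right p.2.left).2.1, p.2.left.2.2)) : Circle), by
    have hβ : ∀ x y z, (β.1 (x * y, z) * β.1 (x, y) : Circle) = β.1 (y, z) * β.1 (x, y * z) :=
      fun x y z => by
        have := β.2 x y z
        rwa [UT.smul_of_eq_one rfl] at this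
    have aux : ∀ {a b c d a' b' c' d' : Circle}, a * b = c * d → a' * b' = c' * d' →
        (a / a') * (b / b') = (c / c') * (d / d') := fun h h' => by
      rw [div_mul_div_comm, div_mul_div_comm, h, h']
    rintro ⟨⟨g, h, k⟩, ε⟩ ⟨⟨g', h', k'⟩, ε'⟩ ⟨⟨g'', h'', k''⟩, ε''⟩
    rcases Int.units_eq_one_or ε with rfl | rfl
    · rcases Int.units_eq_one_or ε' with rfl | rfl
      · exact (aux (hβ (g, k) (g', k') (g'', k'')) (hβ (h, k) (h', k') (h'', k''))).trans
          (congrArg (· * _) (UT.smul_of_eq_one (s := dsgn G K) rfl _).symm)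
      · exact (aux (hβ (g, k) (g', k') (h'', k'')) (hβ (h, k) (h', k') (g'', k''))).trans
          (congrArg (· * _) (UT.smul_of_eq_one (s := dsgn G K) rfl _).symm)
    · rcases Int.units_eq_one_or ε' with rfl | rfl
      · exact (aux (hβ (g, k) (h', k') (h'', k'')) (hβ (h, k) (g', k') (g'', k''))).trans
          (congrArg (· * _) ((UT.smul_of_eq_neg_one (s := dsgn G K) rfl _).trans
            (inv_div _ _)).symm)
      · exact (aux (hβ (g, k) (h', k') (g'', k'')) (hβ (h, k) (g', k') (h'', k''))).trans
          (congrArg (· * _) ((UT.smul_of_eq_neg_one (s := dsgn G K) rfl _).trans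
            (inv_div _ _)).symm)⟩

/-- The values of a cocycle as elements of the circle group, without the type synonym `UT`. -/
def circleVal {Γ : Type*} [Group Γ] {s : Γ →* ℤˣ} (ω : Z2 Γ (UT s)) (p : Γ × Γ) : Circle := ω.1 p

/-- The cocycle `α(g, g') χ(g, k')` on `G × K`. -/
def productCocycle (α : Z2 G (UT (1 : G →* ℤˣ))) (χ : H1 G (H1 K Circle)) :
    Z2 (G × K) (UT (1 : G × K →* ℤˣ)) :=
  ⟨fun p => (circleVal α (p.1.1, p.2.1) * χ p.1.1 p.2.2 : Circle), by
    rintro ⟨g, k⟩ ⟨g', k'⟩ ⟨g'', k''⟩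
    have h := α.2 g g' g''
    rw [UT.smul_of_eq_one rfl] at h
    refine Eq.trans ?_ (congrArg (fun z : UT (1 : G × K →* ℤˣ) => z * _)
      (UT.smul_of_eq_one rfl _).symm)
    change (circleVal α (g * g', g'') * χ (g * g') k'' * (circleVal α (g, g') * χ g k') : Circle) =
      circleVal α (g', g'') * χ g' k'' * (circleVal α (g, g' * g'') * χ g (k' * k''))
    have h' : (circleVal α (g * g', g'') * circleVal α (g, g') : Circle) =
        circleVal α (g', g'') * circleVal α (g, g' * g'') := h
    rw [map_mul, map_mul, MonoidHom.mul_apply]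
    calc _ = (circleVal α (g * g', g'') * circleVal α (g, g') : Circle) *
          (χ g k'' * χ g' k'' * χ g k') := by ac_rfl
      _ = _ := by rw [h']; ac_rfl⟩

variable (α : Z2 G (UT (1 : G →* ℤˣ))) (χ : H1 G (H1 K Circle))

/-- The class with prescribed `[ω_L]` and slant product of `G_l` and `K`. -/
def doubledClass : DoubledH2 G K := QuotientGroup.mk (doubledCocycle (productCocycle α χ))

theorem cocycle_one_left (g : G) : circleVal α (1, g) = circleVal α (1, 1) :=
  groupCohomology.map_one_fst_of_isMulCocycle₂ α.2 g

theorem cocycle_one_right (g : G) : circleVal α (g, 1) = circleVal α (1, 1) :=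
  (groupCohomology.map_one_snd_of_isMulCocycle₂ α.2 g).trans (UT.smul_of_eq_one rfl _)

theorem resL_doubledClass : resL G K (doubledClass α χ) = QuotientGroup.mk α := by
  refine mk_eq_of_mul_coboundary (ω' := resZ2 (dsgn G K) (1 : G →* ℤˣ) (inclL G K) (fun _ => rfl)
    (doubledCocycle (productCocycle α χ))) (fun _ => (circleVal α (1, 1))⁻¹) fun g h => ?_
  rw [UT.smul_of_eq_one rfl]
  change (circleVal α (g, h) * χ g 1 / (circleVal α (1, 1) * χ 1 1) : Circle) =
    (circleVal α (1, 1))⁻¹ * (circleVal α (1, 1))⁻¹ * circleVal α (g, h) / (circleVal α (1, 1))⁻¹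
  simp only [map_one, mul_one, div_eq_mul_inv, inv_inv]
  rw [mul_right_comm, inv_mul_cancel_right, mul_comm]

/-- The slant products of `doubledClass` in terms of its defining cocycle. -/
theorem slant_doubledClass {X Y : Type*} [Group X] [Group Y] (a : X →* G × G × K)
    (b : Y →* G × G × K) (hab ha hb) (x : X) (y : Y) {z : Circle}
    (hz : (circleVal α ((a x).1, (b y).1) * χ (a x).1 (b y).2.2 /
        (circleVal α ((a x).2.1, (b y).2.1) * χ (a x).2.1 (b y).2.2) : Circle) /
      (circleVal α ((b y).1, (a x).1) * χ (b y).1 (a x).2.2 /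
        (circleVal α ((b y).2.1, (a x).2.1) * χ (b y).2.1 (a x).2.2) : Circle) = z) :
    slantH2 (dsgn G K) (SemidirectProduct.inl.comp a) (SemidirectProduct.inl.comp b) hab ha hb
      (doubledClass α χ) x y = z := hz

theorem slantLK_doubledClass : slantLK G K (doubledClass α χ) = χ := by
  ext1 g
  ext1 k
  refine slant_doubledClass α χ (MonoidHom.inl G (G × K))
    ((MonoidHom.inr G (G × K)).comp (MonoidHom.inr G K)) _ _ _ g k ?_
  change (circleVal α (g, 1) * χ g k / (circleVal α (1, 1) * χ 1 k) : Circle) /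
    (circleVal α (1, g) * χ 1 1 / (circleVal α (1, 1) * χ 1 1)) = χ g k
  rw [cocycle_one_left α g, cocycle_one_right α g]
  simp

theorem slantRK_doubledClass : slantRK G K (doubledClass α χ) = χ⁻¹ := by
  ext1 g
  ext1 k
  refine slant_doubledClass α χ ((MonoidHom.inr G (G × K)).comp (MonoidHom.inl G K))
    ((MonoidHom.inr G (G × K)).comp (MonoidHom.inr G K)) _ _ _ g k ?_
  change (circleVal α (1, 1) * χ 1 k / (circleVal α (g, 1) * χ g k) : Circle) /
    (circleVal α (1, 1) * χ 1 1 / (circleVal α (1, g) * χ 1 1)) = (χ g k)⁻¹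
  rw [cocycle_one_left α g, cocycle_one_right α g]
  simp

theorem slantLR_doubledClass : slantLR G K (doubledClass α χ) = 1 := by
  ext1 g
  ext1 h
  refine slant_doubledClass α χ (MonoidHom.inl G (G × K))
    ((MonoidHom.inr G (G × K)).comp (MonoidHom.inl G K)) _ _ _ g h ?_
  change (circleVal α (g, 1) * χ g 1 / (circleVal α (1, h) * χ 1 1) : Circle) /
    (circleVal α (1, g) * χ 1 1 / (circleVal α (h, 1) * χ h 1)) = 1
  rw [cocycle_one_left α g, cocycle_one_left α h, cocycle_one_right α g, cocycle_one_right α h]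
  simp

theorem doubledClass_mem : doubledClass α χ ∈ constrainedClasses G K := by
  rw [mem_constrainedClasses]
  refine ⟨?_, ?_, slantLR_doubledClass α χ, ?_⟩
  · have : resZ2 (dsgn G K) (MonoidHom.snd K ℤˣ) (inclKH G K) (fun _ => rfl)
        (doubledCocycle (productCocycle α χ)) = 1 := by
      refine Subtype.ext (funext fun ⟨⟨k, ε⟩, ⟨k', ε'⟩⟩ => ?_)
      rcases Int.units_eq_one_or ε with rfl | rfl <;>
      exact div_self' (circleVal α (1, 1) * χ 1 k' : Circle)
    exact congrArg QuotientGroup.mk this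
  · have : resZ2 (dsgn G K) (1 : G →* ℤˣ) (inclR G K) (fun _ => rfl)
        (doubledCocycle (productCocycle α χ)) =
        (resZ2 (dsgn G K) (1 : G →* ℤˣ) (inclL G K) (fun _ => rfl)
          (doubledCocycle (productCocycle α χ)))⁻¹ := by
      refine Subtype.ext (funext fun p => ?_)
      change (circleVal α (1, 1) * χ 1 1 / (circleVal α p * χ p.1 1) : Circle) =
        (circleVal α p * χ p.1 1 / (circleVal α (1, 1) * χ 1 1))⁻¹
      rw [inv_div]
    exact congrArg QuotientGroup.mk this
  · rw [slantLK_doubledClass, slantRK_doubledClass]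

/-- The constrained classes form the group `H²(G, U(1)) ⊕ H¹(G, H¹(K, U(1)))`. -/
theorem bijective_resL_slantLK : Function.Bijective
    (((resL G K).prod (slantLK G K)).comp (constrainedClasses G K).subtype) := by
  refine ⟨(injective_iff_map_eq_one _).mpr fun c hc => ?_, fun p => ?_⟩
  · have := Prod.ext_iff.mp hc
    exact Subtype.ext (eq_one_of_resL_of_slantLK c.2 this.1 this.2)
  · obtain ⟨a, χ⟩ := p
    obtain ⟨α, rfl⟩ := QuotientGroup.mk_surjective a
    exact ⟨⟨_, doubledClass_mem α χ⟩, Prod.ext (resL_doubledClass α χ) (slantLK_doubledClass α χ)⟩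

/-- Every constrained class is the class of a product cocycle. -/
theorem exists_eq_doubledClass {c : DoubledH2 G K} (hc : c ∈ constrainedClasses G K) :
    ∃ α χ, c = doubledClass α χ := by
  obtain ⟨α, hα⟩ := QuotientGroup.mk_surjective (resL G K c)
  refine ⟨α, slantLK G K c, ?_⟩
  have := bijective_resL_slantLK.1 (a₁ := ⟨c, hc⟩)
    (a₂ := ⟨_, doubledClass_mem α (slantLK G K c)⟩)
    (Prod.ext (hα.symm.trans (resL_doubledClass _ _).symm) (slantLK_doubledClass _ _).symm)
  exact congrArg Subtype.val this

end Constrained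

/-! ### Injective tensors with equal traces are gauge equivalent -/

section Fundamental

open Matrix

variable {ι κ P : Type*} [Fintype κ] [DecidableEq κ]

/-- Injectivity means that the matrices of the tensor span the full matrix algebra. -/
theorem IsInjective.span_eq_top {A : Tensor ι κ} (hA : IsInjective A) :
    Submodule.span ℂ (Set.range fun p : ι × ι => A p.1 p.2) = ⊤ := by
  by_contra hne
  obtain ⟨f, hf0, hf⟩ := Submodule.exists_le_ker_of_lt_top _ (lt_top_iff_ne_top.mpr hne)
  let X : κ → κ → ℂ := fun a b => f (Matrix.single a b 1)
  have hX : ∀ M : Matrix κ κ ℂ, f M = ∑ a, ∑ b, M a b * X a b := fun M => by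
    conv_lhs => rw [Matrix.matrix_eq_sum_single M]
    simp only [map_sum, X]
    refine Finset.sum_congr rfl fun a _ => Finset.sum_congr rfl fun b _ => ?_
    rw [← smul_eq_mul, ← map_smul, Matrix.smul_single, smul_eq_mul, mul_one]
  have h0 : X = 0 := hA (a₂ := 0) (by
    ext1 p
    have : f (A p.1 p.2) = 0 := hf (Submodule.subset_span ⟨p, rfl⟩)
    rw [hX] at this
    simpa using this)
  exact hf0 (LinearMap.ext fun M => by rw [hX, h0]; simp)

/-- Every automorphism of a matrix algebra is inner (Skolem–Noether). -/
theorem exists_conj_of_algEquiv (f : Matrix κ κ ℂ ≃ₐ[ℂ] Matrix κ κ ℂ) :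
    ∃ V : (Matrix κ κ ℂ)ˣ, ∀ X, f X = (↑V⁻¹ : Matrix κ κ ℂ) * X * V := by
  let e : Matrix κ κ ℂ ≃ₐ[ℂ] Module.End ℂ (κ → ℂ) := Matrix.toLinAlgEquiv'
  obtain ⟨T, hT⟩ := ((e.symm.trans f).trans e).eq_linearEquivConjAlgEquiv
  have h1 : e.symm T.symm.toLinearMap * e.symm T.toLinearMap = 1 := by
    rw [← map_mul, Module.End.mul_eq_comp, ← LinearEquiv.coe_trans, LinearEquiv.self_trans_symm,
      LinearEquiv.refl_toLinearMap, ← Module.End.one_eq_id, map_one]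
  have h2 : e.symm T.toLinearMap * e.symm T.symm.toLinearMap = 1 := by
    rw [← map_mul, Module.End.mul_eq_comp, ← LinearEquiv.coe_trans, LinearEquiv.symm_trans_self,
      LinearEquiv.refl_toLinearMap, ← Module.End.one_eq_id, map_one]
  refine ⟨⟨e.symm T.symm.toLinearMap, e.symm T.toLinearMap, h1, h2⟩, fun X => ?_⟩
  have h3 := DFunLike.congr_fun hT (e X)
  have h4 : e (f X) = T.toLinearMap * e X * T.symm.toLinearMap := by
    simpa [LinearEquiv.conjAlgEquiv_apply, Module.End.mul_eq_comp, LinearMap.comp_assoc] using h3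
  change f X = e.symm T.toLinearMap * X * e.symm T.symm.toLinearMap
  apply e.injective
  rw [h4]
  simp

/-- Two families of matrices, the first of which spans the matrix algebra, whose two-site and
three-site traces agree up to phases, are related by a gauge transformation. The linear map `Φ`
that sends one family to the other satisfies `Φ(X) Φ(Y) = θ Φ(XY)`, so `Φ / θ` is an automorphism
of the matrix algebra. -/
theorem exists_gauge {A B : P → Matrix κ κ ℂ}
    (hA : Submodule.span ℂ (Set.range A) = ⊤) (z₂ z₃ : Circle)
    (h₂ : ∀ p q, (B p * B q).trace = z₂ * (A p * A q).trace)
    (h₃ : ∀ p q r, (B p * B q * B r).trace = z₃ * (A p * A q * A r).trace) :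
    ∃ (θ : Circle) (V : (Matrix κ κ ℂ)ˣ), ∀ p,
      B p = (θ : ℂ) • ((↑V⁻¹ : Matrix κ κ ℂ) * A p * V) := by
  let TA := Finsupp.linearCombination ℂ A
  let TB := Finsupp.linearCombination ℂ B
  have hTA : ∀ p, TA (Finsupp.single p 1) = A p := fun p => by simp [TA]
  have hTB : ∀ p, TB (Finsupp.single p 1) = B p := fun p => by simp [TB]
  have h2T : ∀ c q, (TB c * B q).trace = z₂ * (TA c * A q).trace := fun c q => by
    have : (Matrix.traceLinearMap κ ℂ ℂ) ∘ₗ (LinearMap.mulRight ℂ (B q)) ∘ₗ TB =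
        (z₂ : ℂ) • ((Matrix.traceLinearMap κ ℂ ℂ) ∘ₗ (LinearMap.mulRight ℂ (A q)) ∘ₗ TA) := by
      refine Finsupp.lhom_ext' fun p => LinearMap.ext_ring ?_
      simp only [LinearMap.comp_apply, Finsupp.lsingle_apply, LinearMap.smul_apply, hTA, hTB]
      exact h₂ p q
    exact LinearMap.congr_fun this c
  have hker : LinearMap.ker TB ≤ LinearMap.ker TA := fun c hc => by
    rw [LinearMap.mem_ker] at hc ⊢
    refine Matrix.ext_iff_trace_mul_right.mpr fun X => ?_
    have hz : (Matrix.traceLinearMap κ ℂ ℂ) ∘ₗ (LinearMap.mulLeft ℂ (TA c)) = 0 :=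
      LinearMap.ext_on_range hA fun q => by
        have := h2T c q
        rw [hc, zero_mul, Matrix.trace_zero] at this
        simpa using this.symm
    simpa using LinearMap.congr_fun hz X
  -- `A` factors through `B`, so `B` spans as well by dimension, and the factorization is invertible.
  obtain ⟨g, hg⟩ := TB.rangeRestrict.exists_rightInverse_of_surjective
    (LinearMap.range_eq_top.mpr TB.surjective_rangeRestrict)
  obtain ⟨Ψ, hΨ⟩ := LinearMap.exists_extend (TA ∘ₗ g)
  have hΨB : ∀ p, Ψ (B p) = A p := fun p => by
    let b : LinearMap.range TB := TB.rangeRestrict (Finsupp.single p 1)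
    have e1 : Ψ (B p) = TA (g b) := by
      have := LinearMap.congr_fun hΨ b
      rw [← hTB]
      exact this
    have e2 : g b - Finsupp.single p 1 ∈ LinearMap.ker TB := by
      have := LinearMap.congr_fun hg b
      rw [LinearMap.mem_ker, map_sub, sub_eq_zero]
      exact congrArg Subtype.val this
    have e3 := hker e2
    rw [LinearMap.mem_ker, map_sub, sub_eq_zero, hTA] at e3
    rw [e1, e3]
  have hΨsurj : Function.Surjective Ψ := by
    rw [← LinearMap.range_eq_top, eq_top_iff, ← hA, Submodule.span_le]
    rintro _ ⟨p, rfl⟩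
    exact ⟨_, hΨB p⟩
  let eΨ := LinearEquiv.ofBijective Ψ ⟨LinearMap.injective_iff_surjective.mpr hΨsurj, hΨsurj⟩
  let Φ : Matrix κ κ ℂ →ₗ[ℂ] Matrix κ κ ℂ := eΨ.symm.toLinearMap
  have hΦ : ∀ p, Φ (A p) = B p := fun p => eΨ.symm_apply_eq.mpr (hΨB p).symm
  have hΦbij : Function.Bijective Φ := eΨ.symm.bijective
  clear_value Φ
  have tr2 : ∀ X Y, (Φ X * Φ Y).trace = z₂ * (X * Y).trace := by
    have h1 : ∀ X q, (Φ X * B q).trace = z₂ * (X * A q).trace := fun X q => by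
      have : (Matrix.traceLinearMap κ ℂ ℂ) ∘ₗ (LinearMap.mulRight ℂ (B q)) ∘ₗ Φ =
          (z₂ : ℂ) • ((Matrix.traceLinearMap κ ℂ ℂ) ∘ₗ (LinearMap.mulRight ℂ (A q))) :=
        LinearMap.ext_on_range hA fun p => by simpa [hΦ] using h₂ p q
      exact LinearMap.congr_fun this X
    intro X Y
    have : (Matrix.traceLinearMap κ ℂ ℂ) ∘ₗ (LinearMap.mulLeft ℂ (Φ X)) ∘ₗ Φ =
        (z₂ : ℂ) • ((Matrix.traceLinearMap κ ℂ ℂ) ∘ₗ (LinearMap.mulLeft ℂ X)) :=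
      LinearMap.ext_on_range hA fun p => by simpa [hΦ] using h1 X p
    exact LinearMap.congr_fun this Y
  have tr3 : ∀ X Y Z, (Φ X * Φ Y * Φ Z).trace = z₃ * (X * Y * Z).trace := by
    have h1 : ∀ X q r, (Φ X * B q * B r).trace = z₃ * (X * A q * A r).trace := fun X q r => by
      have : (Matrix.traceLinearMap κ ℂ ℂ) ∘ₗ (LinearMap.mulRight ℂ (B r)) ∘ₗ
            (LinearMap.mulRight ℂ (B q)) ∘ₗ Φ =
          (z₃ : ℂ) • ((Matrix.traceLinearMap κ ℂ ℂ) ∘ₗ (LinearMap.mulRight ℂ (A r)) ∘ₗ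
            (LinearMap.mulRight ℂ (A q))) :=
        LinearMap.ext_on_range hA fun p => by simpa [hΦ] using h₃ p q r
      exact LinearMap.congr_fun this X
    have h2 : ∀ X Y r, (Φ X * Φ Y * B r).trace = z₃ * (X * Y * A r).trace := fun X Y r => by
      have : (Matrix.traceLinearMap κ ℂ ℂ) ∘ₗ (LinearMap.mulRight ℂ (B r)) ∘ₗ
            (LinearMap.mulLeft ℂ (Φ X)) ∘ₗ Φ =
          (z₃ : ℂ) • ((Matrix.traceLinearMap κ ℂ ℂ) ∘ₗ (LinearMap.mulRight ℂ (A r)) ∘ₗ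
            (LinearMap.mulLeft ℂ X)) :=
        LinearMap.ext_on_range hA fun p => by simpa [hΦ] using h1 X p r
      exact LinearMap.congr_fun this Y
    intro X Y Z
    have : (Matrix.traceLinearMap κ ℂ ℂ) ∘ₗ (LinearMap.mulLeft ℂ (Φ X * Φ Y)) ∘ₗ Φ =
        (z₃ : ℂ) • ((Matrix.traceLinearMap κ ℂ ℂ) ∘ₗ (LinearMap.mulLeft ℂ (X * Y))) :=
      LinearMap.ext_on_range hA fun p => by
        simpa [hΦ, mul_assoc] using h2 X Y p
    exact LinearMap.congr_fun this Z
  let θ : Circle := z₃ / z₂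
  have hθ : (θ : ℂ) * z₂ = z₃ := by rw [← Circle.coe_mul, div_mul_cancel]
  have hθ0 : (θ : ℂ) ≠ 0 := Circle.coe_ne_zero θ
  have hmul : ∀ X Y, Φ X * Φ Y = (θ : ℂ) • Φ (X * Y) := fun X Y => by
    refine Matrix.ext_iff_trace_mul_right.mpr fun W => ?_
    obtain ⟨Z, rfl⟩ := hΦbij.2 W
    rw [tr3, Matrix.smul_mul, Matrix.trace_smul, tr2, smul_eq_mul, ← mul_assoc, hθ]
  let F : Matrix κ κ ℂ →ₗ[ℂ] Matrix κ κ ℂ := (θ : ℂ)⁻¹ • Φ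
  have hFmul : ∀ X Y, F (X * Y) = F X * F Y := fun X Y => by
    simp only [F, LinearMap.smul_apply, Matrix.smul_mul, Matrix.mul_smul, hmul]
    rw [inv_smul_smul₀ hθ0]
  have hFbij : Function.Bijective F := by
    refine ⟨fun X Y h => hΦbij.1 ?_, fun Y => ?_⟩
    · exact smul_right_injective _ (inv_ne_zero hθ0) h
    · obtain ⟨X, hX⟩ := hΦbij.2 ((θ : ℂ) • Y)
      exact ⟨X, by rw [LinearMap.smul_apply, hX, inv_smul_smul₀ hθ0]⟩
  have hF1 : F 1 = 1 := by
    obtain ⟨X, hX⟩ := hFbij.2 1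
    have := hFmul 1 X
    rw [one_mul, hX, mul_one] at this
    exact this.symm
  obtain ⟨V, hV⟩ := exists_conj_of_algEquiv
    (AlgEquiv.ofBijective (AlgHom.ofLinearMap F hF1 hFmul) hFbij)
  refine ⟨θ, V, fun p => ?_⟩
  rw [← hV]
  change B p = (θ : ℂ) • (θ : ℂ)⁻¹ • Φ (A p)
  rw [smul_inv_smul₀ hθ0, hΦ]

/-- The gauge transformation relating two tensors is unique up to a scalar. -/
theorem gauge_unique [Nonempty κ] {A : P → Matrix κ κ ℂ}
    (hA : Submodule.span ℂ (Set.range A) = ⊤) {θ θ' : ℂ} (hθ : θ ≠ 0)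
    {V W : (Matrix κ κ ℂ)ˣ}
    (h : ∀ p, θ • ((↑V⁻¹ : Matrix κ κ ℂ) * A p * V) = θ' • ((↑W⁻¹ : Matrix κ κ ℂ) * A p * W)) :
    θ = θ' ∧ ∃ c : ℂˣ, (V : Matrix κ κ ℂ) = (c : ℂ) • (W : Matrix κ κ ℂ) := by
  have h' : ∀ X : Matrix κ κ ℂ,
      θ • ((↑V⁻¹ : Matrix κ κ ℂ) * X * V) = θ' • ((↑W⁻¹ : Matrix κ κ ℂ) * X * W) := fun X => by
    have : θ • ((LinearMap.mulRight ℂ (V : Matrix κ κ ℂ)) ∘ₗ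
          (LinearMap.mulLeft ℂ (↑V⁻¹ : Matrix κ κ ℂ))) =
        θ' • ((LinearMap.mulRight ℂ (W : Matrix κ κ ℂ)) ∘ₗ
          (LinearMap.mulLeft ℂ (↑W⁻¹ : Matrix κ κ ℂ))) :=
      LinearMap.ext_on_range hA fun p => by simpa using h p
    exact LinearMap.congr_fun this X
  have e : θ = θ' := by
    have h1 := h' 1
    rw [mul_one, mul_one, Units.inv_mul, Units.inv_mul] at h1
    exact smul_left_injective ℂ (one_ne_zero (α := Matrix κ κ ℂ)) h1
  subst e
  refine ⟨rfl, ?_⟩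
  have hcomm : ∀ X : Matrix κ κ ℂ, Commute X ((V : Matrix κ κ ℂ) * (↑W⁻¹ : Matrix κ κ ℂ)) :=
    fun X => by
      have h1 := smul_right_injective _ hθ (h' X)
      rw [commute_iff_eq]
      calc X * ((V : Matrix κ κ ℂ) * (↑W⁻¹ : Matrix κ κ ℂ))
          = V * (↑V⁻¹ * X * V) * ↑W⁻¹ := by simp only [← mul_assoc, Units.mul_inv, one_mul]
        _ = V * (↑W⁻¹ * X * W) * ↑W⁻¹ := by rw [show (↑V⁻¹ : Matrix κ κ ℂ) * X * V = _ from h1]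
        _ = V * ↑W⁻¹ * X := by simp only [mul_assoc, Units.mul_inv, mul_one]
  obtain ⟨c, hc⟩ := Matrix.mem_range_scalar_iff_commute_single'.mpr fun i j => hcomm _
  have hV : (V : Matrix κ κ ℂ) = c • (W : Matrix κ κ ℂ) := by
    have : (V : Matrix κ κ ℂ) * (↑W⁻¹ : Matrix κ κ ℂ) * W = scalar κ c * W := by rw [hc]
    rwa [mul_assoc, Units.inv_mul, mul_one, Matrix.scalar_apply, ← Matrix.smul_eq_diagonal_mul]
      at this
  refine ⟨Units.mk0 c fun h0 => ?_, hV⟩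
  rw [h0, zero_smul] at hV
  exact V.ne_zero hV

end Fundamental

/-! ### Virtual representations -/

section Twist

variable {κ m n : Type*} [Fintype κ] [DecidableEq κ]

/-- The identity (for `1`) or the complex conjugation (for `-1`) of `ℂ`. -/
def ctwist (ε : ℤˣ) : ℂ →+* ℂ := if ε = 1 then RingHom.id ℂ else starRingEnd ℂ

@[simp] theorem ctwist_one (z : ℂ) : ctwist 1 z = z := by simp [ctwist]

@[simp] theorem ctwist_neg_one (z : ℂ) : ctwist (-1) z = star z := by simp [ctwist]

theorem twist_eq_map (ε : ℤˣ) (M : Matrix m n ℂ) : twist ε M = M.map (ctwist ε) := by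
  rcases Int.units_eq_one_or ε with rfl | rfl <;> ext i j <;> simp [twist]

theorem ctwist_ctwist (ε δ : ℤˣ) (z : ℂ) : ctwist ε (ctwist δ z) = ctwist (ε * δ) z := by
  rcases Int.units_eq_one_or ε with rfl | rfl <;>
  rcases Int.units_eq_one_or δ with rfl | rfl <;> simp

theorem twist_twist (ε δ : ℤˣ) (M : Matrix m n ℂ) : twist ε (twist δ M) = twist (ε * δ) M := by
  simp only [twist_eq_map]
  ext i j
  simp [ctwist_ctwist]

theorem twist_mul {l : Type*} (ε : ℤˣ) (M : Matrix m κ ℂ) (N : Matrix κ l ℂ) :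
    twist ε (M * N) = twist ε M * twist ε N := by
  simp only [twist_eq_map, Matrix.map_mul]

@[simp] theorem twist_one_matrix (ε : ℤˣ) : twist ε (1 : Matrix κ κ ℂ) = 1 := by
  simp [twist_eq_map]

@[simp] theorem twist_one (M : Matrix m n ℂ) : twist 1 M = M := by simp [twist]

theorem twist_neg_one (M : Matrix m n ℂ) : twist (-1) M = M.map star := by simp [twist]

theorem twist_smul (ε : ℤˣ) (c : ℂ) (M : Matrix m n ℂ) :
    twist ε (c • M) = ctwist ε c • twist ε M := by
  simp only [twist_eq_map]
  ext i j
  simp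

theorem twist_sum {α : Type*} (ε : ℤˣ) (t : Finset α) (f : α → Matrix m n ℂ) :
    twist ε (∑ a ∈ t, f a) = ∑ a ∈ t, twist ε (f a) := by
  simp only [twist_eq_map]
  ext i j
  simp [Matrix.sum_apply]

theorem ctwist_circle (ε : ℤˣ) (z : Circle) : ctwist ε z = ((z ^ (ε : ℤ) : Circle) : ℂ) := by
  rcases Int.units_eq_one_or ε with rfl | rfl
  · simp
  · simp [← Circle.coe_inv_eq_conj]

/-- Entrywise application of `ctwist` to an invertible matrix. -/
def twistUnit (ε : ℤˣ) (V : (Matrix κ κ ℂ)ˣ) : (Matrix κ κ ℂ)ˣ :=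
  Units.map (ctwist ε).mapMatrix.toMonoidHom V

theorem coe_twistUnit (ε : ℤˣ) (V : (Matrix κ κ ℂ)ˣ) :
    (twistUnit ε V : Matrix κ κ ℂ) = twist ε (V : Matrix κ κ ℂ) := by
  rw [twist_eq_map]; rfl

theorem coe_twistUnit_inv (ε : ℤˣ) (V : (Matrix κ κ ℂ)ˣ) :
    (↑(twistUnit ε V)⁻¹ : Matrix κ κ ℂ) = twist ε (↑V⁻¹ : Matrix κ κ ℂ) := by
  rw [twistUnit, ← map_inv, ← twistUnit, coe_twistUnit]

/-- A complex number of modulus one as an element of the circle group. -/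
def toCircle (z : ℂ) (h : ‖z‖ = 1) : Circle := ⟨z, mem_sphere_zero_iff_norm.2 h⟩

@[simp] theorem coe_toCircle (z : ℂ) (h : ‖z‖ = 1) : (toCircle z h : ℂ) = z := rfl

/-- The phase `z / |z|` of a nonzero complex number. -/
def phase : ℂˣ →* Circle where
  toFun z := toCircle ((z : ℂ) / (‖(z : ℂ)‖ : ℂ)) (by
    have : ‖(z : ℂ)‖ ≠ 0 := norm_ne_zero_iff.mpr z.ne_zero
    rw [norm_div, Complex.norm_real, norm_norm, div_self this])
  map_one' := by ext; simp
  map_mul' z w := by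
    ext
    simp [mul_div_mul_comm]

theorem coe_phase (z : ℂˣ) : (phase z : ℂ) = (z : ℂ) / (‖(z : ℂ)‖ : ℂ) := rfl

theorem phase_circle (z : Circle) : phase (Circle.toUnits z) = z := by
  ext
  rw [coe_phase, Circle.toUnits_apply, Units.val_mk0, Circle.norm_coe, Complex.ofReal_one, div_one]

theorem phase_ctwist (ε : ℤˣ) (z : ℂˣ) :
    phase (Units.map (ctwist ε).toMonoidHom z) = phase z ^ (ε : ℤ) := by
  ext
  rw [← ctwist_circle, coe_phase, coe_phase, map_div₀]
  rcases Int.units_eq_one_or ε with rfl | rfl <;> simp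

end Twist

section VirtualRep

variable {ι κ : Type*} [Fintype ι] [DecidableEq ι] [Fintype κ] [DecidableEq κ]
  {Γ : Type*} [Group Γ] {s : Γ →* ℤˣ} {D : Γ → Matrix (ι × ι) (ι × ι) ℂ} {A : Tensor ι κ}

/-- The on-site operators `D` represent `Γ` and preserve the generated operators up to phases. -/
structure IsSymmetryAction (s : Γ →* ℤˣ) (D : Γ → Matrix (ι × ι) (ι × ι) ℂ) (A : Tensor ι κ) :
    Prop where
  mul : ∀ g h, D g * twist (s g) (D h) = D (g * h)
  phase : ∀ g L, 1 ≤ L → ∃ θ : Circle, mpdo (tensorAct s D g A) L = (θ : ℂ) • mpdo A L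

theorem tensorAct_tensorAct (hD : ∀ g h, D g * twist (s g) (D h) = D (g * h)) (g h : Γ)
    (A : Tensor ι κ) : tensorAct s D g (tensorAct s D h A) = tensorAct s D (g * h) A := by
  funext i j
  simp only [tensorAct, twist_sum, twist_smul, twist_twist, Finset.smul_sum, smul_smul, ← hD,
    Matrix.mul_apply, Finset.sum_smul, map_mul, twist_eq_map (s g) (D h), Matrix.map_apply]
  exact Finset.sum_comm

theorem tensorAct_gauge {A B : Tensor ι κ} {c : ℂ} {W : (Matrix κ κ ℂ)ˣ}
    (h : ∀ i j, B i j = c • ((↑W⁻¹ : Matrix κ κ ℂ) * A i j * (W : Matrix κ κ ℂ))) (g : Γ) (i j : ι) :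
    tensorAct s D g B i j = ctwist (s g) c • ((↑(twistUnit (s g) W)⁻¹ : Matrix κ κ ℂ) *
      tensorAct s D g A i j * (twistUnit (s g) W : Matrix κ κ ℂ)) := by
  simp only [tensorAct, h, twist_smul, twist_mul, coe_twistUnit, coe_twistUnit_inv, Finset.mul_sum,
    Finset.sum_mul, Finset.smul_sum, Matrix.mul_smul, Matrix.smul_mul]
  refine Finset.sum_congr rfl fun p _ => ?_
  rw [smul_comm]

theorem mpdo_two (A : Tensor ι κ) (p q : ι × ι) :
    mpdo A 2 ![p.1, q.1] ![p.2, q.2] = (A p.1 p.2 * A q.1 q.2).trace := by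
  simp [mpdo, List.ofFn_succ]

theorem mpdo_three (A : Tensor ι κ) (p q r : ι × ι) :
    mpdo A 3 ![p.1, q.1, r.1] ![p.2, q.2, r.2] =
      (A p.1 p.2 * A q.1 q.2 * A r.1 r.2).trace := by
  simp [mpdo, List.ofFn_succ, mul_assoc]

theorem mpdo_one (A : Tensor ι κ) (i j : Fin 1 → ι) : mpdo A 1 i j = (A (i 0) (j 0)).trace := by
  simp [mpdo, List.ofFn_succ]

/-- Composite of two gauge transformations that realize symmetry operations. -/
theorem covariant_mul (hD : ∀ g h, D g * twist (s g) (D h) = D (g * h)) {g h : Γ} {a b : ℂ}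
    {V W : (Matrix κ κ ℂ)ˣ}
    (hV : ∀ i j, tensorAct s D g A i j = a • ((↑V⁻¹ : Matrix κ κ ℂ) * A i j * V))
    (hW : ∀ i j, tensorAct s D h A i j = b • ((↑W⁻¹ : Matrix κ κ ℂ) * A i j * W)) (i j : ι) :
    tensorAct s D (g * h) A i j = (ctwist (s g) b * a) •
      ((↑(V * twistUnit (s g) W)⁻¹ : Matrix κ κ ℂ) * A i j *
        (↑(V * twistUnit (s g) W) : Matrix κ κ ℂ)) := by
  rw [← tensorAct_tensorAct hD, tensorAct_gauge hW, hV]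
  simp only [mul_inv_rev, Units.val_mul, Matrix.mul_smul, Matrix.smul_mul, smul_smul, mul_assoc]

/-- A gauge transformation can be rescaled to have a determinant of modulus one. -/
theorem exists_scaled_unit [Nonempty κ] (V : (Matrix κ κ ℂ)ˣ) :
    ∃ W : (Matrix κ κ ℂ)ˣ, ‖(W : Matrix κ κ ℂ).det‖ = 1 ∧
      ∀ X : Matrix κ κ ℂ, (↑W⁻¹ : Matrix κ κ ℂ) * X * W = (↑V⁻¹ : Matrix κ κ ℂ) * X * V := by
  have hd : 0 < ‖(V : Matrix κ κ ℂ).det‖ :=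
    norm_pos_iff.mpr ((Matrix.isUnit_iff_isUnit_det _).mp V.isUnit).ne_zero
  set t : ℝ := ‖(V : Matrix κ κ ℂ).det‖ ^ (-(1 / (Fintype.card κ : ℝ))) with ht
  have ht0 : 0 < t := Real.rpow_pos_of_pos hd _
  have htn : t ^ Fintype.card κ * ‖(V : Matrix κ κ ℂ).det‖ = 1 := by
    rw [ht, ← Real.rpow_natCast, ← Real.rpow_mul hd.le, neg_mul, one_div,
      inv_mul_cancel₀ (by exact_mod_cast Fintype.card_ne_zero), Real.rpow_neg hd.le, Real.rpow_one,
      inv_mul_cancel₀ hd.ne']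
  have ht' : (t : ℂ) ≠ 0 := by exact_mod_cast ht0.ne'
  refine ⟨⟨(t : ℂ) • (V : Matrix κ κ ℂ), (t : ℂ)⁻¹ • (↑V⁻¹ : Matrix κ κ ℂ), ?_, ?_⟩, ?_, fun X => ?_⟩
  · rw [Matrix.smul_mul, Matrix.mul_smul, smul_inv_smul₀ ht', Units.mul_inv]
  · rw [Matrix.smul_mul, Matrix.mul_smul, inv_smul_smul₀ ht', Units.inv_mul]
  · rw [Matrix.det_smul, norm_mul, norm_pow, Complex.norm_real, Real.norm_of_nonneg ht0.le, htn]
  · change ((t : ℂ)⁻¹ • (↑V⁻¹ : Matrix κ κ ℂ)) * X * ((t : ℂ) • (V : Matrix κ κ ℂ)) = _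
    rw [Matrix.smul_mul, Matrix.smul_mul, Matrix.mul_smul, inv_smul_smul₀ ht']

/-- A symmetry of an injective tensor acts on the virtual space by gauge transformations. Fixing
`|det V_g| = 1` makes the factor system unitary. -/
theorem IsSymmetryAction.exists_isVirtualRep [Nonempty κ] (hA : IsInjective A)
    (h : IsSymmetryAction s D A) :
    ∃ (V : Γ → (Matrix κ κ ℂ)ˣ) (ω : Γ × Γ → Circle), IsVirtualRep s D A V ω := by
  have hspan := hA.span_eq_top
  have hex : ∀ g, ∃ (θ : Circle) (V : (Matrix κ κ ℂ)ˣ), ‖(V : Matrix κ κ ℂ).det‖ = 1 ∧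
      ∀ i j, tensorAct s D g A i j = (θ : ℂ) • ((↑V⁻¹ : Matrix κ κ ℂ) * A i j * V) := fun g => by
    -- Rings of two and three sites determine the tensor up to gauge.
    obtain ⟨z₂, hz₂⟩ := h.phase g 2 (by norm_num)
    obtain ⟨z₃, hz₃⟩ := h.phase g 3 (by norm_num)
    obtain ⟨θ, V, hV⟩ := exists_gauge (B := fun p : ι × ι => tensorAct s D g A p.1 p.2) hspan z₂ z₃
      (fun p q => by
        rw [← mpdo_two, ← mpdo_two, hz₂]; rfl)
      (fun p q r => by
        rw [← mpdo_three, ← mpdo_three, hz₃]; rfl)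
    obtain ⟨W, hW1, hW⟩ := exists_scaled_unit V
    exact ⟨θ, W, hW1, fun i j => by rw [hW]; exact hV (i, j)⟩
  choose θ V hdet hV using hex
  have hmul : ∀ p : Γ × Γ, ∃ z : Circle,
      (V p.1 : Matrix κ κ ℂ) * twist (s p.1) (V p.2 : Matrix κ κ ℂ) =
        (z : ℂ) • (V (p.1 * p.2) : Matrix κ κ ℂ) := fun ⟨g, k⟩ => by
    obtain ⟨-, c, hc⟩ := gauge_unique hspan
      (mul_ne_zero ((map_ne_zero _).mpr (Circle.coe_ne_zero _)) (Circle.coe_ne_zero _))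
      (fun p => (covariant_mul h.mul (hV g) (hV k) p.1 p.2).symm.trans (hV (g * k) p.1 p.2))
    rw [Units.val_mul, coe_twistUnit] at hc
    have h1 := congrArg (fun M : Matrix κ κ ℂ => ‖M.det‖) hc
    have h2 : ‖(twist (s g) (V k : Matrix κ κ ℂ)).det‖ = 1 := by
      rw [twist_eq_map, ← RingHom.mapMatrix_apply, ← RingHom.map_det, ← hdet k]
      rcases Int.units_eq_one_or (s g) with h | h <;> simp [h]
    simp only [Matrix.det_mul, Matrix.det_smul, norm_mul, hdet, h2, norm_pow, mul_one] at h1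
    have h3 : ‖(c : ℂ)‖ = 1 :=
      (pow_eq_one_iff_of_nonneg (norm_nonneg _) Fintype.card_ne_zero).mp h1.symm
    exact ⟨toCircle c h3, hc⟩
  choose ω hω using hmul
  exact ⟨V, ω, ⟨fun g => ⟨θ g, hV g⟩, fun g k => hω (g, k)⟩⟩

/-- Associativity makes the factor system of a virtual representation a 2-cocycle. -/
theorem IsVirtualRep.isMulCocycle₂ [Nonempty κ] {V : Γ → (Matrix κ κ ℂ)ˣ} {ω : Γ × Γ → UT s}
    (h : IsVirtualRep s D A V ω) : groupCohomology.IsMulCocycle₂ ω := by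
  intro g k l
  let w : Γ × Γ → Circle := ω
  have hm : ∀ g k, (V g : Matrix κ κ ℂ) * twist (s g) (V k : Matrix κ κ ℂ) =
    (w (g, k) : ℂ) • (V (g * k) : Matrix κ κ ℂ) := h.mul
  have e1 : (V g : Matrix κ κ ℂ) * twist (s g) ((V k : Matrix κ κ ℂ) *
      twist (s k) (V l : Matrix κ κ ℂ)) =
      ((w (g, k) : ℂ) * w (g * k, l)) • (V (g * k * l) : Matrix κ κ ℂ) := by
    rw [twist_mul, twist_twist, ← map_mul, ← mul_assoc, hm, Matrix.smul_mul, hm, smul_smul]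
  have e2 : (V g : Matrix κ κ ℂ) * twist (s g) ((V k : Matrix κ κ ℂ) *
      twist (s k) (V l : Matrix κ κ ℂ)) =
      ((w (k, l) ^ (s g : ℤ) : Circle) * (w (g, k * l) : ℂ)) •
        (V (g * k * l) : Matrix κ κ ℂ) := by
    rw [hm, twist_smul, Matrix.mul_smul, hm, smul_smul, ctwist_circle, mul_assoc]
  have e3 := smul_left_injective ℂ (V (g * k * l)).ne_zero (e1.symm.trans e2)
  rw [UT.smul_def, mul_comm]
  change (w (g, k) * w (g * k, l) : Circle) = w (k, l) ^ (s g : ℤ) * w (g, k * l)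
  ext
  simpa using e3

theorem IsVirtualRep.hasClass [Nonempty κ] {V : Γ → (Matrix κ κ ℂ)ˣ} {ω : Γ × Γ → UT s}
    (h : IsVirtualRep s D A V ω) : HasClass s D A (QuotientGroup.mk ⟨ω, h.isMulCocycle₂⟩) :=
  ⟨V, ⟨ω, h.isMulCocycle₂⟩, h, rfl⟩

/-- The class is unique, because the virtual representation is unique up to scalars `c g`; only
their phases matter, as the factor systems are unitary. -/
theorem HasClass.unique [Nonempty κ] (hA : IsInjective A) {c c' : H2 Γ (UT s)}
    (h : HasClass s D A c) (h' : HasClass s D A c') : c' = c := by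
  obtain ⟨V, ω, hV, rfl⟩ := h
  obtain ⟨W, ω', hW, rfl⟩ := h'
  have hex : ∀ g, ∃ c : ℂˣ, (W g : Matrix κ κ ℂ) = (c : ℂ) • (V g : Matrix κ κ ℂ) := fun g => by
    obtain ⟨θ, hθ⟩ := hV.covariant g
    obtain ⟨θ', hθ'⟩ := hW.covariant g
    exact (gauge_unique hA.span_eq_top (Circle.coe_ne_zero θ')
      fun p => (hθ' p.1 p.2).symm.trans (hθ p.1 p.2)).2
  choose c hc using hex
  let w : Γ × Γ → Circle := ω.1
  let w' : Γ × Γ → Circle := ω'.1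
  refine mk_eq_of_mul_coboundary (fun g => phase (c g)) fun g k => ?_
  have e := hW.mul g k
  rw [hc, hc, hc, twist_smul, Matrix.smul_mul, Matrix.mul_smul, hV.mul, smul_smul, smul_smul,
    smul_smul] at e
  have e1 : c g * (Units.map (ctwist (s g)).toMonoidHom (c k) * Circle.toUnits (w (g, k))) =
      Circle.toUnits (w' (g, k)) * c (g * k) := Units.ext
    ((mul_assoc _ _ _).symm.trans (smul_left_injective ℂ (V (g * k)).ne_zero e))
  have e2 := congrArg phase e1
  simp only [map_mul, phase_circle, phase_ctwist] at e2
  change w' (g, k) = phase (c g) * phase (c k) ^ (s g : ℤ) * w (g, k) / phase (c (g * k))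
  rw [eq_div_iff_mul_eq', ← e2, mul_assoc]

/-- A symmetry that preserves the one-site operator carries no charge per site. -/
theorem charge_eq_one [Nonempty κ] (hA : IsInjective A) {B : Tensor ι κ} {θ : ℂ}
    {V : (Matrix κ κ ℂ)ˣ} (hB : ∀ i j, B i j = θ • ((↑V⁻¹ : Matrix κ κ ℂ) * A i j * V))
    (h1 : mpdo B 1 = mpdo A 1) : θ = 1 := by
  have htr : ∀ i j, (A i j).trace = θ * (A i j).trace := fun i j => by
    have e := congrFun (congrFun h1 (fun _ => i)) (fun _ => j)
    rw [mpdo_one, mpdo_one, hB, Matrix.trace_smul, Matrix.trace_mul_cycle, Units.mul_inv,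
      one_mul] at e
    exact e.symm
  by_contra hne
  have hz : Matrix.traceLinearMap κ ℂ ℂ = 0 :=
    LinearMap.ext_on_range hA.span_eq_top fun p => by
      have : (θ - 1) * (A p.1 p.2).trace = 0 := by
        rw [sub_mul, one_mul, ← htr, sub_self]
      simpa [sub_eq_zero, hne] using this
  have := LinearMap.congr_fun hz 1
  simp at this

/-- If the symmetry preserves the transfer matrix, then its virtual representation preserves the
line spanned by the eigenvector `v` of the largest eigenvalue. The eigenvalues of `V_g` on this
line trivialize the class. -/
theorem IsVirtualRep.exists_coboundary {V : Γ → (Matrix κ κ ℂ)ˣ} {ω : Γ × Γ → Circle}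
    (hV : IsVirtualRep s D A V ω) (hA : IsStrongInjective A)
    (hT : ∀ g, transfer (tensorAct s D g A) = twist (s g) (transfer A))
    (h1 : ∀ g, mpdo (tensorAct s D g A) 1 = mpdo A 1) :
    ∃ φ : Γ → Circle, ∀ g k, ω (g, k) = φ g * φ k ^ (s g : ℤ) / φ (g * k) := by
  obtain ⟨r, hr, -⟩ := hA.transfer
  obtain ⟨⟨v, hv⟩, hv0, hspan⟩ := finrank_eq_one_iff'.mp hr
  have hv0 : v ≠ 0 := fun h => hv0 (Subtype.ext h)
  have hTv : (transfer A).mulVec v = (r : ℂ) • v := Module.End.mem_eigenspace_iff.mp hv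
  have huniq : ∀ w, (transfer A).mulVec w = (r : ℂ) • w → ∃ c : ℂ, w = c • v := fun w hw => by
    obtain ⟨c, hc⟩ := hspan ⟨w, Module.End.mem_eigenspace_iff.mpr hw⟩
    exact ⟨c, (congrArg Subtype.val hc).symm⟩
  have hgauge : ∀ g i j, tensorAct s D g A i j =
      (↑(V g)⁻¹ : Matrix κ κ ℂ) * A i j * (V g : Matrix κ κ ℂ) := fun g => by
    obtain ⟨θ, hθ⟩ := hV.covariant g
    have hκ : Nonempty κ := by
      by_contra h
      rw [not_nonempty_iff] at h
      exact hv0 (funext fun i => h.elim i)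
    have hθ1 := charge_eq_one hA.injective hθ (h1 g)
    intro i j
    rw [hθ, hθ1, one_smul]
  have hTg : ∀ g, twist (s g) (transfer A) =
      (↑(V g)⁻¹ : Matrix κ κ ℂ) * transfer A * (V g : Matrix κ κ ℂ) := fun g => by
    rw [← hT]
    simp only [transfer, hgauge, Finset.mul_sum, Finset.sum_mul]
  -- `V_g` maps the twist of `v` to an eigenvector of the transfer matrix at the real eigenvalue `r`.
  let tv : ℤˣ → κ → ℂ := fun ε => ctwist ε ∘ v
  have htv : ∀ g, tv (s g) ≠ 0 := fun g h => hv0 <| funext fun i =>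
    (map_eq_zero (ctwist (s g))).mp (congrFun h i)
  have hex : ∀ g, ∃ c : ℂˣ, (V g : Matrix κ κ ℂ).mulVec (tv (s g)) = (c : ℂ) • v := fun g => by
    have e1 : (twist (s g) (transfer A)).mulVec (tv (s g)) = (r : ℂ) • tv (s g) := by
      funext i
      have := congrArg (ctwist (s g)) (congrFun hTv i)
      rw [RingHom.map_mulVec, ← twist_eq_map] at this
      refine this.trans ?_
      have hr' : ctwist (s g) (r : ℂ) = r := by
        rcases Int.units_eq_one_or (s g) with h | h <;> simp [h]
      simp [tv, hr']
    have e2 : (transfer A).mulVec ((V g : Matrix κ κ ℂ).mulVec (tv (s g))) =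
        (r : ℂ) • (V g : Matrix κ κ ℂ).mulVec (tv (s g)) := by
      rw [← Matrix.mulVec_smul, ← e1, hTg, Matrix.mulVec_mulVec, Matrix.mulVec_mulVec,
        ← mul_assoc, ← mul_assoc, Units.mul_inv, one_mul]
    obtain ⟨c, hc⟩ := huniq _ e2
    refine ⟨Units.mk0 c fun h0 => htv g ?_, hc⟩
    have := congrArg (fun w => (↑(V g)⁻¹ : Matrix κ κ ℂ).mulVec w) hc
    simpa [h0, Matrix.mulVec_mulVec] using this
  choose c hc using hex
  refine ⟨fun g => phase (c g), fun g k => ?_⟩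
  have e : (c g * Units.map (ctwist (s g)).toMonoidHom (c k) : ℂˣ) =
      Circle.toUnits (ω (g, k)) * c (g * k) := by
    refine Units.ext (smul_left_injective ℂ hv0 ?_)
    have e1 : (twist (s g) (V k : Matrix κ κ ℂ)).mulVec (tv (s (g * k))) =
        ctwist (s g) (c k) • tv (s g) := by
      funext i
      have := congrArg (ctwist (s g)) (congrFun (hc k) i)
      rw [RingHom.map_mulVec, ← twist_eq_map] at this
      simp only [Pi.smul_apply, smul_eq_mul, map_mul] at this
      rw [Pi.smul_apply, smul_eq_mul]
      refine Eq.trans ?_ this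
      congr 2
      funext j
      simp [tv, ctwist_ctwist]
    have e2 := congrArg (fun M : Matrix κ κ ℂ => M.mulVec (tv (s (g * k)))) (hV.mul g k)
    simp only [← Matrix.mulVec_mulVec, Matrix.smul_mulVec, hc] at e2
    rw [e1, Matrix.mulVec_smul, hc, smul_smul, smul_smul] at e2
    change ((c g : ℂ) * ctwist (s g) (c k)) • v = ((ω (g, k) : ℂ) * c (g * k)) • v
    rw [mul_comm, e2]
  have e' := congrArg phase e
  simp only [map_mul, phase_circle, phase_ctwist] at e'
  exact eq_div_iff_mul_eq'.mpr e'.symm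

end VirtualRep

/-! ### On-site operations and the generated operators -/

section OnSite

variable {ι κ : Type*} [Fintype ι] [DecidableEq ι] [Fintype κ] [DecidableEq κ]

theorem prod_ofFn_sum {α R : Type*} [Fintype α] [Semiring R] {L : ℕ} (f : Fin L → α → R) :
    (List.ofFn fun x => ∑ a, f x a).prod =
      ∑ σ : Fin L → α, (List.ofFn fun x => f x (σ x)).prod := by
  induction L with
  | zero => simp
  | succ L ih =>
    rw [List.ofFn_succ, List.prod_cons, ih, Finset.sum_mul_sum,
      ← Fintype.sum_prod_type' (f := fun (a : α) (σ : Fin L → α) =>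
        f 0 a * (List.ofFn fun x => f x.succ (σ x)).prod)]
    refine Fintype.sum_equiv (Fin.consEquiv fun _ => α) _ _ fun p => ?_
    simp [Fin.consEquiv, List.ofFn_succ]

theorem prod_ofFn_smul {R : Type*} [Ring R] [Algebra ℂ R] {L : ℕ} (c : Fin L → ℂ)
    (f : Fin L → R) :
    (List.ofFn fun x => c x • f x).prod = (∏ x, c x) • (List.ofFn f).prod := by
  induction L with
  | zero => simp
  | succ L ih =>
    rw [List.ofFn_succ, List.ofFn_succ, List.prod_cons, List.prod_cons, ih, Fin.prod_univ_succ,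
      smul_mul_smul_comm]

/-- The action of `u` on the ket and of `v` on the bra of the local tensor. -/
def onSite (u v : Matrix ι ι ℂ) (A : Tensor ι κ) : Tensor ι κ :=
  fun i j => ∑ p : ι × ι, (u i p.1 * star (v j p.2)) • A p.1 p.2

theorem mpdo_onSite (u v : Matrix ι ι ℂ) (A : Tensor ι κ) (L : ℕ) :
    mpdo (onSite u v A) L = sitePow u L * mpdo A L * (sitePow v L).conjTranspose := by
  ext i j
  have h1 : mpdo (onSite u v A) L i j = ∑ σ : Fin L → ι × ι,
      (∏ x, (u (i x) (σ x).1 * star (v (j x) (σ x).2))) *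
        mpdo A L (fun x => (σ x).1) (fun x => (σ x).2) := by
    simp only [mpdo, onSite, Matrix.of_apply, prod_ofFn_sum, prod_ofFn_smul, Matrix.trace_sum,
      Matrix.trace_smul, smul_eq_mul]
  rw [h1]
  simp only [Matrix.mul_apply, Matrix.conjTranspose_apply, Finset.sum_mul]
  rw [Finset.sum_comm, ← Fintype.sum_prod_type' (f := fun k l =>
    sitePow u L i k * mpdo A L k l * star (sitePow v L j l))]
  refine Fintype.sum_equiv (Equiv.arrowProdEquivProdArrow _ _ _) _ _ fun σ => ?_
  change _ = sitePow u L i (fun x => (σ x).1) * mpdo A L (fun x => (σ x).1) (fun x => (σ x).2) *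
    star (sitePow v L j (fun x => (σ x).2))
  simp only [sitePow, Matrix.of_apply, Finset.prod_mul_distrib, star_prod]
  ring

theorem mpdo_twist (ε : ℤˣ) (A : Tensor ι κ) (L : ℕ) :
    mpdo (fun i j => twist ε (A i j)) L = twist ε (mpdo A L) := by
  ext i j
  simp only [mpdo, twist_eq_map, Matrix.of_apply, Matrix.map_apply]
  have h := (ctwist ε).mapMatrix.map_list_prod (List.ofFn fun x => A (i x) (j x))
  rw [List.map_ofFn] at h
  refine (congrArg Matrix.trace h.symm).trans ?_
  simp [Matrix.trace, map_sum]

theorem mpdo_swap (A : Tensor ι κ) (L : ℕ) :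
    mpdo (fun i j => A j i) L = (mpdo A L).transpose := rfl

theorem sitePow_one (L : ℕ) : sitePow (1 : Matrix ι ι ℂ) L = 1 := by
  ext i j
  simp only [sitePow, Matrix.of_apply, Matrix.one_apply, funext_iff]
  exact Fintype.prod_ite_zero (f := fun _ => (1 : ℂ)) |>.trans (by simp)

theorem sitePow_mul (u v : Matrix ι ι ℂ) (L : ℕ) :
    sitePow (u * v) L = sitePow u L * sitePow v L := by
  ext i j
  simp only [sitePow, Matrix.of_apply, Matrix.mul_apply, Fintype.prod_sum, Finset.prod_mul_distrib]

theorem transfer_onSite {u : Matrix ι ι ℂ} (hu : u.conjTranspose * u = 1) (A : Tensor ι κ) :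
    transfer (onSite u u A) = transfer A := by
  have h : ∀ p q : ι, ∑ i, u i p * star (u i q) = if q = p then 1 else 0 := fun p q => by
    have := congrFun (congrFun hu q) p
    rw [Matrix.mul_apply, Matrix.one_apply] at this
    rw [← this]
    exact Finset.sum_congr rfl fun i _ => mul_comm _ _
  simp only [transfer, onSite]
  rw [Finset.sum_comm]
  simp only [← Finset.sum_smul, h, Fintype.sum_prod_type, ite_smul, one_smul, zero_smul,
    Finset.sum_ite_eq', Finset.mem_univ, if_true]

theorem swapPow_one : swapPow ι 1 = 1 := by
  ext p q
  simp [swapPow, Matrix.one_apply]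

theorem mul_swapPow (M : Matrix (ι × ι) (ι × ι) ℂ) :
    M * swapPow ι (-1) = M.submatrix id Prod.swap := by
  ext p q
  rw [Matrix.mul_apply, Finset.sum_eq_single q.swap]
  · simp [swapPow]
  · intro b _ hb
    have : b.swap ≠ q := fun h => hb (by rw [← h, Prod.swap_swap])
    simp [swapPow, this]
  · simp

theorem swapPow_mul (M : Matrix (ι × ι) (ι × ι) ℂ) :
    swapPow ι (-1) * M = M.submatrix Prod.swap id := by
  ext p q
  rw [Matrix.mul_apply, Finset.sum_eq_single p.swap]
  · simp [swapPow]
  · intro b _ hb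
    simp [swapPow, hb.symm]
  · simp

theorem swapPow_mul_kronecker (a b : Matrix ι ι ℂ) :
    swapPow ι (-1) * (a ⊗ₖ b) = (b ⊗ₖ a) * swapPow ι (-1) := by
  rw [swapPow_mul, mul_swapPow]
  ext p q
  simp [mul_comm]

theorem swapPow_mul_swapPow (ε δ : ℤˣ) : swapPow ι ε * swapPow ι δ = swapPow ι (ε * δ) := by
  rcases Int.units_eq_one_or ε with rfl | rfl
  · rw [swapPow_one, one_mul, one_mul]
  rcases Int.units_eq_one_or δ with rfl | rfl
  · rw [swapPow_one, mul_one, mul_one]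
  rw [swapPow_mul, neg_mul_neg, one_mul, swapPow_one]
  ext p q
  simp [swapPow, Matrix.one_apply]

theorem twist_swapPow (ε δ : ℤˣ) : twist ε (swapPow ι δ) = swapPow ι δ := by
  rw [twist_eq_map]
  ext p q
  simp only [swapPow, Matrix.map_apply, Matrix.of_apply]
  split_ifs <;> simp

theorem twist_kronecker (ε : ℤˣ) (a b : Matrix ι ι ℂ) :
    twist ε (a ⊗ₖ b) = twist ε a ⊗ₖ twist ε b := by
  simp only [twist_eq_map]
  ext p q
  simp

theorem map_star_map_star {m n : Type*} (M : Matrix m n ℂ) : (M.map star).map star = M := by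
  ext; simp

variable {Γ : Type*} [Group Γ] {s : Γ →* ℤˣ}

theorem tensorAct_eq_onSite {D : Γ → Matrix (ι × ι) (ι × ι) ℂ} {g : Γ} {u v : Matrix ι ι ℂ}
    {ε : ℤˣ} (hD : D g = (u ⊗ₖ v.map star) * swapPow ι ε) (A : Tensor ι κ) :
    tensorAct s D g A =
      onSite u v (fun i j => twist (s g) (if ε = 1 then A i j else A j i)) := by
  funext i j
  simp only [tensorAct, onSite, hD]
  rcases Int.units_eq_one_or ε with rfl | rfl
  · simp [swapPow_one]
  · rw [mul_swapPow]
    refine Fintype.sum_equiv (Equiv.prodComm _ _) _ _ fun p => ?_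
    simp

/-- For a Hermitian operator the exchange of ket and bra is complex conjugation, so it only affects
the twist. -/
theorem mpdo_tensorAct {D : Γ → Matrix (ι × ι) (ι × ι) ℂ} {g : Γ} {u v : Matrix ι ι ℂ}
    {ε : ℤˣ} (hD : D g = (u ⊗ₖ v.map star) * swapPow ι ε) {A : Tensor ι κ} {L : ℕ}
    (hA : (mpdo A L).IsHermitian) :
    mpdo (tensorAct s D g A) L =
      sitePow u L * twist (s g * ε) (mpdo A L) * (sitePow v L).conjTranspose := by
  rw [tensorAct_eq_onSite hD, mpdo_onSite, mpdo_twist]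
  congr 2
  rcases Int.units_eq_one_or ε with rfl | rfl
  · simp
  · have : mpdo (fun i j => if (-1 : ℤˣ) = 1 then A i j else A j i) L = twist (-1) (mpdo A L) := by
      simp only [if_neg (by decide : ¬ (-1 : ℤˣ) = 1)]
      rw [twist_neg_one, mpdo_swap]
      conv_rhs => rw [← hA]
      ext
      simp
    rw [this, twist_twist]

/-- An on-site operation that acts on ket and bra by the same unitary preserves the transfer
matrix, up to complex conjugation. -/
theorem transfer_tensorAct {D : Γ → Matrix (ι × ι) (ι × ι) ℂ} {g : Γ} {u : Matrix ι ι ℂ}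
    {ε : ℤˣ} (hD : D g = (u ⊗ₖ u.map star) * swapPow ι ε) (hu : u.conjTranspose * u = 1)
    (A : Tensor ι κ) : transfer (tensorAct s D g A) = twist (s g) (transfer A) := by
  rw [tensorAct_eq_onSite hD, transfer_onSite hu]
  simp [transfer, twist_sum]

/-- A one-dimensional eigenspace requires a nonzero bond dimension. -/
theorem HasUniqueLargestEigenvalue.nonempty {T : Matrix κ κ ℂ}
    (h : HasUniqueLargestEigenvalue T) : Nonempty κ := by
  obtain ⟨r, hr, -⟩ := h
  by_contra hκ
  rw [not_nonempty_iff] at hκ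
  rw [Module.finrank_zero_of_subsingleton] at hr
  exact zero_ne_one hr

/-- The class of a virtual representation of a symmetry that preserves the transfer matrix and the
one-site operator is trivial. -/
theorem IsVirtualRep.mk_eq_one {D : Γ → Matrix (ι × ι) (ι × ι) ℂ} {A : Tensor ι κ}
    {V : Γ → (Matrix κ κ ℂ)ˣ} {ω : Z2 Γ (UT s)} (hV : IsVirtualRep s D A V ω.1)
    (hA : IsStrongInjective A)
    (hT : ∀ g, transfer (tensorAct s D g A) = twist (s g) (transfer A))
    (h1 : ∀ g, mpdo (tensorAct s D g A) 1 = mpdo A 1) :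
    (QuotientGroup.mk ω : H2 Γ (UT s)) = 1 := by
  obtain ⟨φ, hφ⟩ := hV.exists_coboundary hA hT h1
  refine mk_eq_of_mul_coboundary (ω := 1) φ fun g k => ?_
  refine (hφ g k).trans ?_
  change _ = φ g * φ k ^ (s g : ℤ) * 1 / φ (g * k)
  rw [mul_one]

theorem IsVirtualRep.restrict {Δ : Type*} [Group Δ] {t : Δ →* ℤˣ} {f : Δ →* Γ}
    (hf : ∀ x, s (f x) = t x) {D : Γ → Matrix (ι × ι) (ι × ι) ℂ} {A : Tensor ι κ}
    {V : Γ → (Matrix κ κ ℂ)ˣ} {ω : Γ × Γ → Circle} (hV : IsVirtualRep s D A V ω) :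
    IsVirtualRep t (fun x => D (f x)) A (fun x => V (f x)) (fun p => ω (f p.1, f p.2)) where
  covariant x := by
    obtain ⟨θ, hθ⟩ := hV.covariant (f x)
    refine ⟨θ, fun i j => ?_⟩
    rw [← hθ]
    simp only [tensorAct, hf]
  mul x y := by
    have := hV.mul (f x) (f y)
    rwa [hf, ← map_mul] at this

end OnSite

/-! ### Symmetric density operators -/

section Symmetric

variable {ι κ : Type*} [Fintype ι] [DecidableEq ι] [Fintype κ] [DecidableEq κ]

theorem unitary_conjTranspose_mul (u : Matrix.unitaryGroup ι ℂ) :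
    (u : Matrix ι ι ℂ).conjTranspose * (u : Matrix ι ι ℂ) = 1 :=
  Matrix.mem_unitaryGroup_iff'.mp u.2

section

variable {G K : Type*} [Group G] [Group K] {u : G × K →* Matrix.unitaryGroup ι ℂ}
  {A : Tensor ι κ}

theorem doubledOp_mul (x y : DoubledGroup G K) :
    doubledOp u x * twist (dsgn G K x) (doubledOp u y) = doubledOp u (x * y) := by
  obtain ⟨⟨g, h, k⟩, ε⟩ := x
  obtain ⟨⟨g', h', k'⟩, δ⟩ := y
  have hm : ∀ p q, (u p : Matrix ι ι ℂ) * (u q : Matrix ι ι ℂ) = (u (p * q) : Matrix ι ι ℂ) :=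
    fun p q => by rw [map_mul]; rfl
  have hm' : ∀ p q, (u p : Matrix ι ι ℂ).map star * (u q : Matrix ι ι ℂ).map star =
      (u (p * q) : Matrix ι ι ℂ).map star := fun p q => by
    rw [← hm, ← twist_neg_one, ← twist_neg_one, ← twist_neg_one, ← twist_mul]
  rcases Int.units_eq_one_or ε with rfl | rfl
  · change ((u (g, k) : Matrix ι ι ℂ) ⊗ₖ ((u (h, k) : Matrix ι ι ℂ).map star)) * swapPow ι 1 *
      twist 1 (((u (g', k') : Matrix ι ι ℂ) ⊗ₖ ((u (h', k') : Matrix ι ι ℂ).map star)) *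
        swapPow ι δ) =
      ((u (g * g', k * k') : Matrix ι ι ℂ) ⊗ₖ ((u (h * h', k * k') : Matrix ι ι ℂ).map star)) *
        swapPow ι (1 * δ)
    rw [twist_one, swapPow_one, mul_one, ← mul_assoc, ← Matrix.mul_kronecker_mul, hm, hm', one_mul]
    rfl
  · change ((u (g, k) : Matrix ι ι ℂ) ⊗ₖ ((u (h, k) : Matrix ι ι ℂ).map star)) * swapPow ι (-1) *
      twist (-1) (((u (g', k') : Matrix ι ι ℂ) ⊗ₖ ((u (h', k') : Matrix ι ι ℂ).map star)) *
        swapPow ι δ) =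
      ((u (g * h', k * k') : Matrix ι ι ℂ) ⊗ₖ ((u (h * g', k * k') : Matrix ι ι ℂ).map star)) *
        swapPow ι (-1 * δ)
    rw [twist_mul, twist_kronecker, twist_swapPow, twist_neg_one, twist_neg_one,
      map_star_map_star, ← mul_assoc, mul_assoc _ (swapPow ι (-1)), swapPow_mul_kronecker,
      ← mul_assoc, ← Matrix.mul_kronecker_mul, hm, hm', mul_assoc, swapPow_mul_swapPow]
    rfl

theorem IsSymmetricMPDO.isHermitian (hA : IsSymmetricMPDO u A) {L : ℕ} (hL : 1 ≤ L) :
    (mpdo A L).IsHermitian := (hA.density L hL).isHermitian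

theorem IsSymmetricMPDO.mpdo_tensorAct (hA : IsSymmetricMPDO u A) (x : DoubledGroup G K) {L : ℕ}
    (hL : 1 ≤ L) :
    mpdo (tensorAct (dsgn G K) (doubledOp u) x A) L =
      sitePow (u (x.left.1, x.left.2.2) : Matrix ι ι ℂ) L * mpdo A L *
        (sitePow (u (x.left.2.1, x.left.2.2) : Matrix ι ι ℂ) L).conjTranspose := by
  rw [MixedSPT.mpdo_tensorAct (D := doubledOp u) (g := x) rfl (hA.isHermitian hL)]
  have : dsgn G K x * x.right = 1 := Int.units_mul_self _
  rw [this, twist_one]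

/-- The doubled group acts on the tensor of a symmetric density operator. -/
theorem IsSymmetricMPDO.isSymmetryAction (hA : IsSymmetricMPDO u A) :
    IsSymmetryAction (dsgn G K) (doubledOp u) A where
  mul := doubledOp_mul
  phase x L hL := by
    obtain ⟨⟨g, h, k⟩, ε⟩ := x
    obtain ⟨θ, h1, -⟩ := hA.strong g L hL
    obtain ⟨θ', -, h2⟩ := hA.strong h L hL
    have hk := hA.weak k L hL
    refine ⟨θ * θ'⁻¹, ?_⟩
    rw [hA.mpdo_tensorAct _ hL]
    have e1 : ∀ g : G, sitePow (u (g, k) : Matrix ι ι ℂ) L =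
        sitePow (u (g, 1) : Matrix ι ι ℂ) L * sitePow (u (1, k) : Matrix ι ι ℂ) L := fun g => by
      have : ((g, k) : G × K) = (g, 1) * (1, k) := by simp
      rw [this, map_mul, ← sitePow_mul]
      rfl
    change sitePow (u (g, k) : Matrix ι ι ℂ) L * mpdo A L *
      (sitePow (u (h, k) : Matrix ι ι ℂ) L).conjTranspose = _
    rw [e1 g, e1 h, Matrix.conjTranspose_mul]
    have e2 : sitePow (u (g, 1) : Matrix ι ι ℂ) L * sitePow (u (1, k) : Matrix ι ι ℂ) L *
        mpdo A L * ((sitePow (u (1, k) : Matrix ι ι ℂ) L).conjTranspose *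
          (sitePow (u (h, 1) : Matrix ι ι ℂ) L).conjTranspose) =
        sitePow (u (g, 1) : Matrix ι ι ℂ) L * (sitePow (u (1, k) : Matrix ι ι ℂ) L *
          mpdo A L * (sitePow (u (1, k) : Matrix ι ι ℂ) L).conjTranspose) *
          (sitePow (u (h, 1) : Matrix ι ι ℂ) L).conjTranspose := by simp only [mul_assoc]
    rw [e2, hk, h1, Matrix.smul_mul, h2, smul_smul, Circle.coe_mul]

/-- Weak symmetry and Hermiticity protect nothing. -/
theorem resKH_eq_one_of_hasClass (hA : IsSymmetricMPDO u A) {c : DoubledH2 G K}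
    (hc : HasClass (dsgn G K) (doubledOp u) A c) : resKH G K c = 1 := by
  obtain ⟨V, ω, hV, rfl⟩ := hc
  have hV' := hV.restrict (t := MonoidHom.snd K ℤˣ) (f := inclKH G K) (fun _ => rfl)
  refine IsVirtualRep.mk_eq_one (ω := resZ2 (dsgn G K) (MonoidHom.snd K ℤˣ) (inclKH G K)
    (fun _ => rfl) ω) hV' hA.strongInjective (fun p => ?_) fun p => ?_
  · exact transfer_tensorAct (D := fun x => doubledOp u (inclKH G K x)) (g := p)
      (u := (u (1, p.1) : Matrix ι ι ℂ)) (ε := p.2) rfl (unitary_conjTranspose_mul _) A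
  · exact (hA.mpdo_tensorAct (inclKH G K p) le_rfl).trans (hA.weak p.1 1 le_rfl)

end

section TimeReversal

variable {u : Matrix.unitaryGroup ι ℂ} {A : Tensor ι κ}

/-- The unitary part of a power of the time-reversal operator. -/
def trPow (u : Matrix.unitaryGroup ι ℂ) (ε : ℤˣ) : Matrix ι ι ℂ :=
  if ε = 1 then 1 else (u : Matrix ι ι ℂ)

theorem trOp_eq (x : ℤˣ × ℤˣ) :
    trOp u x = (trPow u x.1 ⊗ₖ (trPow u x.1).map star) * swapPow ι x.2 := by
  rcases Int.units_eq_one_or x.1 with h | h <;> simp [trOp, trPow, h]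

theorem trPow_unitary (ε : ℤˣ) : (trPow u ε).conjTranspose * trPow u ε = 1 := by
  rcases Int.units_eq_one_or ε with rfl | rfl
  · simp [trPow]
  · simpa [trPow] using unitary_conjTranspose_mul u

theorem trOp_mul (hu : (u : Matrix ι ι ℂ) * (u : Matrix ι ι ℂ).map star = 1 ∨
    (u : Matrix ι ι ℂ) * (u : Matrix ι ι ℂ).map star = -1) (x y : ℤˣ × ℤˣ) :
    trOp u x * twist (trsgn x) (trOp u y) = trOp u (x * y) := by
  obtain ⟨a, ε⟩ := x
  obtain ⟨b, δ⟩ := y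
  have hsq : (u : Matrix ι ι ℂ).map star * (u : Matrix ι ι ℂ) =
      (u : Matrix ι ι ℂ) * (u : Matrix ι ι ℂ).map star := by
    rcases hu with h | h
    · have := congrArg (twist (-1)) h
      rw [← twist_neg_one, twist_mul, twist_twist, neg_mul_neg, one_mul, twist_one,
        twist_one_matrix] at this
      rw [h, ← twist_neg_one, this]
    · have := congrArg (twist (-1)) h
      rw [← twist_neg_one, twist_mul, twist_twist, neg_mul_neg, one_mul, twist_one,
        ← neg_one_smul ℂ (1 : Matrix ι ι ℂ), twist_smul, twist_one_matrix] at this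
      rw [h, ← twist_neg_one, this]
      simp
  have hkey : (trPow u a * twist a (trPow u b)) ⊗ₖ ((trPow u a).map star *
      (twist a (trPow u b)).map star) = trPow u (a * b) ⊗ₖ (trPow u (a * b)).map star := by
    rcases Int.units_eq_one_or a with rfl | rfl <;>
    rcases Int.units_eq_one_or b with rfl | rfl
    · simp [trPow]
    · simp [trPow]
    · simp [trPow]
    · simp only [trPow, twist_neg_one, map_star_map_star]
      simp only [neg_mul_neg, one_mul, if_true, if_neg (by decide : ¬ (-1 : ℤˣ) = 1)]
      rw [hsq]
      rcases hu with h | h <;> rw [h]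
      · simp
      · rw [← neg_one_smul ℂ (1 : Matrix ι ι ℂ), Matrix.smul_kronecker, Matrix.kronecker_smul]
        simp
  rw [trOp_eq, trOp_eq, trOp_eq]
  change (trPow u a ⊗ₖ (trPow u a).map star) * swapPow ι ε *
    twist (a * ε) ((trPow u b ⊗ₖ (trPow u b).map star) * swapPow ι δ) =
    (trPow u (a * b) ⊗ₖ (trPow u (a * b)).map star) * swapPow ι (ε * δ)
  have hswap : swapPow ι ε * twist (a * ε) (trPow u b ⊗ₖ (trPow u b).map star) =
      (twist a (trPow u b) ⊗ₖ (twist a (trPow u b)).map star) * swapPow ι ε := by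
    rw [twist_kronecker, ← twist_neg_one, ← twist_neg_one, twist_twist, twist_twist]
    rcases Int.units_eq_one_or ε with rfl | rfl
    · rw [swapPow_one, one_mul, mul_one, mul_one, mul_comm a]
    · rw [swapPow_mul_kronecker, mul_assoc a, neg_mul_neg, one_mul, mul_one, mul_comm a]
  rw [twist_mul, twist_swapPow, ← mul_assoc, mul_assoc _ (swapPow ι ε), hswap, ← mul_assoc,
    ← Matrix.mul_kronecker_mul, hkey, mul_assoc, swapPow_mul_swapPow]

theorem IsTimeReversalMPDO.mpdo_tensorAct (hA : IsTimeReversalMPDO u A) (x : ℤˣ × ℤˣ) {L : ℕ}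
    (hL : 1 ≤ L) : mpdo (tensorAct trsgn (trOp u) x A) L = mpdo A L := by
  rw [MixedSPT.mpdo_tensorAct (trOp_eq x) (hA.density L hL).isHermitian]
  obtain ⟨a, ε⟩ := x
  have : trsgn (a, ε) * ε = a := by
    change a * ε * ε = a
    rw [mul_assoc, Int.units_mul_self, mul_one]
  rw [this]
  rcases Int.units_eq_one_or a with rfl | rfl
  · simp [trPow, sitePow_one]
  · simpa [trPow, twist_neg_one] using hA.symm L hL

/-- Time reversal and Hermiticity protect nothing. -/
theorem IsTimeReversalMPDO.hasClass_iff (hA : IsTimeReversalMPDO u A)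
    (c : H2 (ℤˣ × ℤˣ) (UT trsgn)) : HasClass trsgn (trOp u) A c ↔ c = 1 := by
  have := hA.strongInjective.transfer.nonempty
  have hS : IsSymmetryAction trsgn (trOp u) A := ⟨trOp_mul hA.square, fun x L hL =>
    ⟨1, by rw [hA.mpdo_tensorAct x hL, Circle.coe_one, one_smul]⟩⟩
  have htriv : ∀ c, HasClass trsgn (trOp u) A c → c = 1 := by
    rintro _ ⟨V, ω, hV, rfl⟩
    exact hV.mk_eq_one hA.strongInjective
      (fun x => transfer_tensorAct (trOp_eq x) (trPow_unitary _) A)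
      (fun x => hA.mpdo_tensorAct x le_rfl)
  refine ⟨htriv c, ?_⟩
  rintro rfl
  obtain ⟨V, ω, hV⟩ := hS.exists_isVirtualRep hA.strongInjective.injective
  have h := hV.hasClass
  rwa [htriv _ h] at h

end TimeReversal

end Symmetric

/-! ### Powers of the transfer matrix -/

section Spectral

open Filter Topology

variable {κ : Type*} [Fintype κ] [DecidableEq κ]

open scoped Matrix.Norms.Operator in
/-- The powers of a matrix whose eigenvalues lie in the open unit disc tend to zero. -/
theorem tendsto_pow_of_forall_spectrum_lt_one {N : Matrix κ κ ℂ}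
    (h : ∀ μ ∈ spectrum ℂ N, ‖μ‖ < 1) : Tendsto (fun n : ℕ => N ^ n) atTop (𝓝 0) := by
  cases isEmpty_or_nonempty κ
  · have : ∀ M : Matrix κ κ ℂ, M = 0 := fun M => Subsingleton.elim _ _
    simp only [this]
    exact tendsto_const_nhds
  have hr : spectralRadius ℂ N < (1 : NNReal) :=
    spectrum.spectralRadius_lt_of_forall_lt N fun k hk => by
      have := h k hk
      rwa [← NNReal.coe_lt_coe]
  obtain ⟨q, hq1, hq2⟩ := ENNReal.lt_iff_exists_nnreal_btwn.mp hr
  have hev := (spectrum.pow_nnnorm_pow_one_div_tendsto_nhds_spectralRadius N).eventually_lt_const hq1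
  have hq2' : q < 1 := by exact_mod_cast hq2
  refine squeeze_zero_norm' ?_ (tendsto_pow_atTop_nhds_zero_of_lt_one q.2 hq2')
  filter_upwards [hev, eventually_gt_atTop 0] with n hn hn0
  have hn0' : (0 : ℝ) < n := by exact_mod_cast hn0
  have h1 : ((‖N ^ n‖₊ : ENNReal) ^ (1 / n : ℝ)) ^ (n : ℝ) ≤ (q : ENNReal) ^ (n : ℝ) :=
    ENNReal.rpow_le_rpow hn.le hn0'.le
  rw [← ENNReal.rpow_mul, one_div_mul_cancel hn0'.ne', ENNReal.rpow_one, ENNReal.rpow_natCast] at h1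
  exact_mod_cast h1

theorem mem_spectrum_iff_exists_mulVec {M : Matrix κ κ ℂ} {μ : ℂ} :
    μ ∈ spectrum ℂ M ↔ ∃ v ≠ 0, M.mulVec v = μ • v := by
  rw [← Matrix.spectrum_toLin', ← Module.End.hasEigenvalue_iff_mem_spectrum]
  constructor
  · intro h
    obtain ⟨v, hv⟩ := h.exists_hasEigenvector
    exact ⟨v, hv.2, hv.apply_eq_smul⟩
  · rintro ⟨v, hv0, hv⟩
    exact Module.End.hasEigenvalue_of_hasEigenvector
      ⟨Module.End.mem_eigenspace_iff.mpr hv, hv0⟩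

/-- The trace is the sum of the eigenvalues, so its growth needs no bound on the Jordan blocks. -/
theorem norm_trace_pow_le {T : Matrix κ κ ℂ} {r : ℝ} (h : ∀ μ ∈ spectrum ℂ T, ‖μ‖ ≤ r) (n : ℕ) :
    ‖(T ^ n).trace‖ ≤ Fintype.card κ * r ^ n := by
  cases isEmpty_or_nonempty κ
  · simp [Matrix.trace]
  rw [Matrix.trace_eq_sum_roots_charpoly]
  have h1 : ∀ μ ∈ (T ^ n).charpoly.roots, ‖μ‖ ≤ r ^ n := fun μ hμ => by
    have h2 : μ ∈ spectrum ℂ (T ^ n) := by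
      rw [Matrix.mem_spectrum_iff_isRoot_charpoly]
      exact (Polynomial.mem_roots'.mp hμ).2
    rw [spectrum.map_pow_of_nonempty (spectrum.nonempty_of_isAlgClosed_of_finiteDimensional ℂ T)]
      at h2
    obtain ⟨ν, hν, rfl⟩ := h2
    simp only [norm_pow]
    exact pow_le_pow_left₀ (norm_nonneg _) (h ν hν) n
  have hr : 0 ≤ r := by
    obtain ⟨ν, hν⟩ := spectrum.nonempty_of_isAlgClosed_of_finiteDimensional ℂ T
    exact (norm_nonneg _).trans (h ν hν)
  have h3 : ((T ^ n).charpoly.roots.map norm).sum ≤ Multiset.card (T ^ n).charpoly.roots • r ^ n := by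
    have := Multiset.sum_le_card_nsmul ((T ^ n).charpoly.roots.map norm) (r ^ n) (by
      intro x hx
      obtain ⟨μ, hμ, rfl⟩ := Multiset.mem_map.mp hx
      exact h1 μ hμ)
    rwa [Multiset.card_map] at this
  refine (norm_multiset_sum_le _).trans (h3.trans ?_)
  rw [nsmul_eq_mul]
  refine mul_le_mul_of_nonneg_right ?_ (pow_nonneg hr n)
  have := Polynomial.card_roots' (T ^ n).charpoly
  rw [Matrix.charpoly_natDegree_eq_dim] at this
  exact_mod_cast this

/-- If the largest eigenvalue `r` of `T` is nondegenerate and the powers of `T / r` are bounded,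
then these powers converge to a projection of rank one. Boundedness excludes a Jordan block at
`r`. -/
theorem exists_tendsto_pow {T : Matrix κ κ ℂ} {r : ℝ} (hr : 0 < r)
    (h1 : Module.finrank ℂ (Module.End.eigenspace (Matrix.toLin' T) (r : ℂ)) = 1)
    (h2 : ∀ μ : ℂ, Module.End.HasEigenvalue (Matrix.toLin' T) μ → μ ≠ (r : ℂ) → ‖μ‖ < r)
    (hb : ∀ i j, ∃ C : ℝ, ∀ n : ℕ, ‖(T ^ n) i j‖ ≤ C * r ^ n) :
    ∃ R L : κ → ℂ, L ⬝ᵥ R = 1 ∧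
      Tendsto (fun n : ℕ => ((r : ℂ)⁻¹) ^ n • T ^ n) atTop (𝓝 (Matrix.vecMulVec R L)) := by
  have hr0 : (r : ℂ) ≠ 0 := by exact_mod_cast hr.ne'
  obtain ⟨⟨v, hv⟩, hv0, hspan⟩ := finrank_eq_one_iff'.mp h1
  have hv0 : v ≠ 0 := fun h => hv0 (Subtype.ext h)
  have hTv : T.mulVec v = (r : ℂ) • v := Module.End.mem_eigenspace_iff.mp hv
  have huniq : ∀ w, T.mulVec w = (r : ℂ) • w → ∃ c : ℂ, w = c • v := fun w hw => by
    obtain ⟨c, hc⟩ := hspan ⟨w, Module.End.mem_eigenspace_iff.mpr hw⟩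
    exact ⟨c, (congrArg Subtype.val hc).symm⟩
  set S : Matrix κ κ ℂ := (r : ℂ)⁻¹ • T with hS
  have hSpow : ∀ n : ℕ, ((r : ℂ)⁻¹) ^ n • T ^ n = S ^ n := fun n => (smul_pow _ _ _).symm
  have hSv : S.mulVec v = v := by rw [hS, Matrix.smul_mulVec, hTv, inv_smul_smul₀ hr0]
  have hST : ∀ w c, S.mulVec w = c • w → T.mulVec w = ((r : ℂ) * c) • w := fun w c hw => by
    rw [mul_smul, ← hw, hS, Matrix.smul_mulVec, smul_inv_smul₀ hr0]
  have hbS : ∀ i j, ∃ C : ℝ, ∀ n : ℕ, ‖(S ^ n) i j‖ ≤ C := fun i j => by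
    obtain ⟨C, hC⟩ := hb i j
    refine ⟨C, fun n => ?_⟩
    rw [← hSpow, Matrix.smul_apply, norm_smul, norm_pow, norm_inv, Complex.norm_real,
      Real.norm_of_nonneg hr.le, inv_pow, inv_mul_le_iff₀ (pow_pos hr n), mul_comm]
    exact hC n
  -- Otherwise a generalized eigenvector `w` grows linearly under the powers of `S`.
  have hnot : v ∉ LinearMap.range (Matrix.toLin' (S - 1)) := by
    rintro ⟨w, hw⟩
    rw [Matrix.toLin'_apply, Matrix.sub_mulVec, Matrix.one_mulVec, sub_eq_iff_eq_add] at hw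
    have hpow : ∀ n : ℕ, (S ^ n).mulVec w = w + (n : ℂ) • v := fun n => by
      induction n with
      | zero => simp
      | succ n ih =>
        rw [pow_succ', ← Matrix.mulVec_mulVec, ih, Matrix.mulVec_add, Matrix.mulVec_smul, hSv, hw]
        push_cast
        rw [add_smul, one_smul]
        abel
    obtain ⟨i, hi⟩ := Function.ne_iff.mp hv0
    choose C hC using hbS i
    have hbound : ∀ n : ℕ, (n : ℝ) * ‖v i‖ ≤ (∑ j, C j * ‖w j‖) + ‖w i‖ := fun n => by
      have e1 : (n : ℂ) * v i = ((S ^ n).mulVec w) i - w i := by rw [hpow]; simp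
      have e2 : ‖(n : ℂ) * v i‖ = n * ‖v i‖ := by rw [norm_mul, Complex.norm_natCast]
      rw [← e2, e1]
      refine (norm_sub_le _ _).trans (add_le_add_left ?_ _)
      refine (norm_sum_le _ _).trans (Finset.sum_le_sum fun j _ => ?_)
      rw [norm_mul]
      exact mul_le_mul_of_nonneg_right (hC j n) (norm_nonneg _)
    obtain ⟨n, hn⟩ := exists_nat_gt (((∑ j, C j * ‖w j‖) + ‖w i‖) / ‖v i‖)
    rw [div_lt_iff₀ (norm_pos_iff.mpr hi)] at hn
    exact absurd (hbound n) (not_le.mpr hn)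
  obtain ⟨f, hfv, hf⟩ := Submodule.exists_le_ker_of_notMem hnot
  -- The left fixed vector, normalized against the right one.
  let L : κ → ℂ := fun i => (f v)⁻¹ * f (Pi.single i 1)
  have hL : ∀ w, L ⬝ᵥ w = (f v)⁻¹ * f w := fun w => by
    conv_rhs => rw [← Matrix.one_mulVec w, Matrix.mulVec_eq_sum]
    simp only [dotProduct, L, map_sum, Finset.mul_sum]
    refine Finset.sum_congr rfl fun i _ => ?_
    have : (MulOpposite.op (w i) • (1 : Matrix κ κ ℂ).transpose i) =
        (w i) • (Pi.single i 1 : κ → ℂ) := by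
      funext j
      simp [Matrix.one_apply, Pi.single_apply, eq_comm]
    rw [this, map_smul, smul_eq_mul]
    ring
  have hLv : L ⬝ᵥ v = 1 := by rw [hL, inv_mul_cancel₀ hfv]
  have hLS : Matrix.vecMul L S = L := by
    refine dotProduct_eq _ _ fun w => ?_
    rw [← Matrix.dotProduct_mulVec, hL, hL]
    have : f ((S - 1).mulVec w) = 0 := hf ⟨w, rfl⟩
    rw [Matrix.sub_mulVec, Matrix.one_mulVec, map_sub, sub_eq_zero] at this
    rw [this]
  refine ⟨v, L, hLv, ?_⟩
  simp only [hSpow]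
  set Q := Matrix.vecMulVec v L with hQ
  have hSQ : S * Q = Q := by rw [hQ, Matrix.mul_vecMulVec, hSv]
  have hQS : Q * S = Q := by rw [hQ, Matrix.vecMulVec_mul, hLS]
  have hQQ : Q * Q = Q := by
    rw [hQ, Matrix.vecMulVec_mul_vecMulVec, hLv]; simp
  have hQw : ∀ w, Q.mulVec w = (L ⬝ᵥ w) • v := fun w => by
    rw [hQ, Matrix.vecMulVec_mulVec]; simp
  have hN : ∀ n : ℕ, (S - Q) ^ (n + 1) = S ^ (n + 1) - Q := fun n => by
    have hSnQ : ∀ n : ℕ, S ^ n * Q = Q := fun n => by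
      induction n with
      | zero => simp
      | succ n ih => rw [pow_succ, mul_assoc, hSQ, ih]
    induction n with
    | zero => simp
    | succ n ih =>
      rw [pow_succ, ih, sub_mul, mul_sub, mul_sub, hSnQ, hQS, hQQ, ← pow_succ]
      abel
  have hlim : Tendsto (fun n : ℕ => (S - Q) ^ n) atTop (𝓝 0) := by
    refine tendsto_pow_of_forall_spectrum_lt_one fun μ hμ => ?_
    obtain ⟨w, hw0, hw⟩ := mem_spectrum_iff_exists_mulVec.mp hμ
    by_cases hμ0 : μ = 0
    · simp [hμ0]
    have hQw0 : Q.mulVec w = 0 := by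
      have e : Q.mulVec ((S - Q).mulVec w) = 0 := by
        rw [Matrix.mulVec_mulVec, mul_sub, hQS, hQQ, sub_self, Matrix.zero_mulVec]
      rw [hw, Matrix.mulVec_smul] at e
      exact (smul_eq_zero.mp e).resolve_left hμ0
    have hSw : S.mulVec w = μ • w := by
      rw [Matrix.sub_mulVec, hQw0, sub_zero] at hw
      exact hw
    have hTw := hST w μ hSw
    have hne : (r : ℂ) * μ ≠ r := fun he => by
      rw [he] at hTw
      obtain ⟨c, rfl⟩ := huniq w hTw
      rw [hQw, dotProduct_smul, hLv, smul_eq_mul, mul_one] at hQw0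
      exact hw0 hQw0
    have := h2 _ (Module.End.hasEigenvalue_of_hasEigenvector
      ⟨Module.End.mem_eigenspace_iff.mpr hTw, hw0⟩) hne
    rw [norm_mul, Complex.norm_real, Real.norm_of_nonneg hr.le] at this
    exact (mul_lt_iff_lt_one_right hr).mp this
  rw [← tendsto_add_atTop_iff_nat 1]
  have h3 := ((tendsto_add_atTop_iff_nat 1).mpr hlim).add_const Q
  rw [zero_add] at h3
  refine h3.congr fun n => ?_
  rw [hN, sub_add_cancel]

/-- A largest eigenvalue is positive if the trace is. -/
theorem pos_of_trace_pos {T : Matrix κ κ ℂ} {r : ℝ}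
    (h2 : ∀ μ : ℂ, Module.End.HasEigenvalue (Matrix.toLin' T) μ → μ ≠ (r : ℂ) → ‖μ‖ < r)
    (ht : 0 < T.trace) : 0 < r := by
  by_contra hr
  have hall : ∀ μ ∈ T.charpoly.roots, μ = (r : ℂ) := fun μ hμ => by
    by_contra hne
    have h3 : μ ∈ spectrum ℂ T := by
      rw [Matrix.mem_spectrum_iff_isRoot_charpoly]
      exact (Polynomial.mem_roots'.mp hμ).2
    rw [← Matrix.spectrum_toLin', ← Module.End.hasEigenvalue_iff_mem_spectrum] at h3
    exact hr ((norm_nonneg _).trans_lt (h2 μ h3 hne))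
  rw [Matrix.trace_eq_sum_roots_charpoly, Multiset.eq_replicate_of_mem hall,
    Multiset.sum_replicate, nsmul_eq_mul] at ht
  have h4 : (0 : ℝ) < (Multiset.card T.charpoly.roots : ℝ) * r := by exact_mod_cast ht
  exact absurd h4 (not_lt.mpr (mul_nonpos_of_nonneg_of_nonpos (Nat.cast_nonneg _) (not_lt.mp hr)))

end Spectral

/-! ### Positivity -/

section Positivity

open Filter Topology Matrix

variable {ι κ : Type*} [Fintype ι] [DecidableEq ι] [Fintype κ] [DecidableEq κ]
  {A : Tensor ι κ}

/-- The matrix on the virtual space obtained by inserting the on-site operator `X` into the trace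
of the density operator, `X ↦ ∑ᵢⱼ Xⱼᵢ Aⁱʲ`. -/
def bondOp (A : Tensor ι κ) : Matrix ι ι ℂ →ₗ[ℂ] Matrix κ κ ℂ where
  toFun X := ∑ p : ι × ι, X p.2 p.1 • A p.1 p.2
  map_add' X Y := by simp [add_smul, Finset.sum_add_distrib]
  map_smul' c X := by simp [mul_smul, Finset.smul_sum]

theorem bondOp_apply (X : Matrix ι ι ℂ) : bondOp A X = ∑ p : ι × ι, X p.2 p.1 • A p.1 p.2 := rfl

theorem bondOp_one : bondOp A 1 = transfer A := by
  simp only [bondOp_apply, transfer, Fintype.sum_prod_type, Matrix.one_apply, ite_smul, one_smul,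
    zero_smul, Finset.sum_ite_eq', Finset.mem_univ, if_true]

theorem bondOp_single (i j : ι) : bondOp A (Matrix.single j i 1) = A i j := by
  rw [bondOp_apply, Finset.sum_eq_single (i, j)]
  · simp
  · rintro ⟨i', j'⟩ _ h
    rw [Matrix.single_apply, if_neg, zero_smul]
    rintro ⟨rfl, rfl⟩
    exact h rfl
  · simp

theorem bondOp_surjective (hA : IsInjective A) : Function.Surjective (bondOp A) := by
  rw [← LinearMap.range_eq_top, eq_top_iff, ← hA.span_eq_top, Submodule.span_le]
  rintro _ ⟨p, rfl⟩
  exact ⟨_, bondOp_single p.1 p.2⟩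

/-- The tensor product of on-site operators. -/
def productOp {L : ℕ} (X : Fin L → Matrix ι ι ℂ) : Matrix (Fin L → ι) (Fin L → ι) ℂ :=
  Matrix.of fun i j => ∏ k, X k (i k) (j k)

theorem productOp_mul {L : ℕ} (X Y : Fin L → Matrix ι ι ℂ) :
    productOp X * productOp Y = productOp fun k => X k * Y k := by
  ext i j
  simp only [productOp, Matrix.of_apply, Matrix.mul_apply, Fintype.prod_sum,
    Finset.prod_mul_distrib]

theorem productOp_conjTranspose {L : ℕ} (X : Fin L → Matrix ι ι ℂ) :
    (productOp X)ᴴ = productOp fun k => (X k)ᴴ := by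
  ext i j
  simp [productOp, Matrix.conjTranspose_apply]

theorem trace_mpdo_mul_productOp {L : ℕ} (X : Fin L → Matrix ι ι ℂ) :
    (mpdo A L * productOp X).trace = (List.ofFn fun k => bondOp A (X k)).prod.trace := by
  simp only [bondOp_apply, prod_ofFn_sum, prod_ofFn_smul, Matrix.trace_sum, Matrix.trace_smul]
  rw [Matrix.trace]
  simp only [Matrix.diag_apply, Matrix.mul_apply]
  rw [← Fintype.sum_prod_type' (f := fun i j => mpdo A L i j * productOp X j i)]
  symm
  refine Fintype.sum_equiv (Equiv.arrowProdEquivProdArrow _ _ _) _ _ fun σ => ?_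
  rw [smul_eq_mul, mul_comm]
  rfl

/-- Expectation values in a density operator form positive semidefinite Gram matrices. -/
theorem IsDensity.posSemidef_gram (hA : IsDensity A) {L : ℕ} (hL : 1 ≤ L) {n : Type*} [Fintype n]
    (X : n → Fin L → Matrix ι ι ℂ) :
    (Matrix.of fun a b =>
      (List.ofFn fun k => bondOp A ((X a k)ᴴ * X b k)).prod.trace).PosSemidef := by
  have hρ := hA L hL
  set P : n → Matrix (Fin L → ι) (Fin L → ι) ℂ := fun a => productOp (X a) with hP
  have hM : (Matrix.of fun a b => (List.ofFn fun k => bondOp A ((X a k)ᴴ * X b k)).prod.trace) =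
      Matrix.of fun a b => (mpdo A L * ((P a)ᴴ * P b)).trace := by
    ext a b
    simp only [Matrix.of_apply, hP, productOp_conjTranspose, productOp_mul,
      trace_mpdo_mul_productOp]
  rw [hM]
  refine .of_dotProduct_mulVec_nonneg ?_ fun x => ?_
  · ext a b
    rw [Matrix.conjTranspose_apply, Matrix.of_apply, Matrix.of_apply, ← Matrix.trace_conjTranspose]
    simp only [Matrix.conjTranspose_mul, Matrix.conjTranspose_conjTranspose, hρ.isHermitian.eq]
    rw [Matrix.trace_mul_comm]
  · have h := (hρ.mul_mul_conjTranspose_same (∑ b, x b • P b)).trace_nonneg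
    rw [Matrix.trace_mul_cycle, Matrix.trace_mul_comm] at h
    refine h.trans_eq ?_
    simp only [Matrix.conjTranspose_sum, Matrix.conjTranspose_smul, Finset.sum_mul, Finset.mul_sum,
      Matrix.trace_sum, dotProduct, Matrix.mulVec, Matrix.of_apply, Pi.star_apply,
      Matrix.smul_mul, Matrix.mul_smul, Matrix.trace_smul, smul_eq_mul]
    rw [Finset.sum_comm]
    refine Finset.sum_congr rfl fun a _ => Finset.sum_congr rfl fun b _ => ?_
    ring

/-! #### Products along the ring -/

section SeqProd

variable {R : Type*} [Monoid R]

/-- The ordered product `F 0 ⋯ F (L - 1)`. -/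
def seqProd (F : ℕ → R) (L : ℕ) : R := (List.ofFn fun k : Fin L => F k).prod

theorem seqProd_succ (F : ℕ → R) (L : ℕ) :
    seqProd F (L + 1) = F 0 * seqProd (fun k => F (k + 1)) L := by
  simp [seqProd, List.ofFn_succ]

theorem seqProd_add (F : ℕ → R) (m n : ℕ) :
    seqProd F (m + n) = seqProd F m * seqProd (fun k => F (m + k)) n := by
  induction m generalizing F with
  | zero => simp [seqProd]
  | succ m ih =>
    rw [show m + 1 + n = m + n + 1 by omega, seqProd_succ, seqProd_succ, ih, mul_assoc]
    simp only [Nat.add_right_comm _ 1]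

theorem seqProd_const {F : ℕ → R} {L : ℕ} {c : R} (h : ∀ k < L, F k = c) :
    seqProd F L = c ^ L := by
  induction L generalizing F with
  | zero => simp [seqProd]
  | succ L ih =>
    rw [seqProd_succ, ih fun k hk => h _ (by omega), h 0 (by omega), pow_succ']

theorem seqProd_one (F : ℕ → R) : seqProd F 1 = F 0 := by simp [seqProd]

end SeqProd

/-- Positivity of a one-site operator next to a segment of the ring. -/
theorem IsDensity.trace_bondOp_nonneg (hA : IsDensity A) (W : Matrix ι ι ℂ) (n : ℕ) :
    0 ≤ (bondOp A (Wᴴ * W) * transfer A ^ n).trace := by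
  let X : Unit → ℕ → Matrix ι ι ℂ := fun _ k => if k = 0 then W else 1
  have h := (hA.posSemidef_gram (L := n + 1) (by omega) fun a k => X a k).diag_nonneg (i := ())
  have e : (List.ofFn fun k : Fin (n + 1) => bondOp A ((X () k)ᴴ * X () k)).prod =
      bondOp A (Wᴴ * W) * transfer A ^ n := by
    change seqProd (fun k => bondOp A ((X () k)ᴴ * X () k)) (n + 1) = _
    rw [seqProd_succ, seqProd_const (c := transfer A)]
    · simp [X]
    · intro k _
      simp [X, bondOp_one]
  rwa [Matrix.of_apply, e] at h

/-- A positive functional is bounded on matrix units by its value at the identity. -/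
theorem norm_apply_single_le {f : Matrix ι ι ℂ →ₗ[ℂ] ℂ}
    (hf : ∀ W : Matrix ι ι ℂ, 0 ≤ f (Wᴴ * W)) (i j : ι) :
    ‖f (Matrix.single i j 1)‖ ≤ ‖f 1‖ := by
  have hvec : ∀ y : ι → ℂ, 0 ≤ f (vecMulVec y (star y)) := fun y => by
    have := hf (vecMulVec (Pi.single i 1) (star y))
    rwa [conjTranspose_vecMulVec, star_star, Matrix.vecMulVec_mul_vecMulVec, Pi.star_single,
      star_one, single_dotProduct, Pi.single_eq_same, one_mul, one_smul] at this
  have hdiag : ∀ k, 0 ≤ f (Matrix.single k k 1) := fun k => by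
    have := hvec (Pi.single k 1)
    rwa [Pi.star_single, star_one, ← Matrix.single_eq_single_vecMulVec_single] at this
  have hone : f 1 = ∑ k, f (Matrix.single k k 1) := by
    rw [← map_sum]
    congr 1
    ext a b
    simp [Matrix.sum_apply, Matrix.single_apply, Matrix.one_apply, ite_and]
  have hle : ∀ k, (f (Matrix.single k k 1)).re ≤ (f 1).re := fun k => by
    rw [hone, Complex.re_sum]
    exact Finset.single_le_sum (f := fun k => (f (Matrix.single k k 1)).re)
      (fun l _ => (Complex.nonneg_iff.mp (hdiag l)).1) (Finset.mem_univ k)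
  have hq : ∀ β : ℂ, ‖β‖ = 1 → 0 ≤ f (Matrix.single i i 1) + f (Matrix.single j j 1) +
      β * f (Matrix.single j i 1) + star β * f (Matrix.single i j 1) := fun β hβ => by
    have h1 := hvec (Pi.single i 1 + β • Pi.single j 1)
    have h2 : Matrix.vecMulVec (Pi.single i 1 + β • Pi.single j 1 : ι → ℂ)
        (star (Pi.single i 1 + β • Pi.single j 1 : ι → ℂ)) =
        Matrix.single i i 1 + Matrix.single j j 1 + β • Matrix.single j i 1 +
          star β • Matrix.single i j 1 := by
      have hβ' : β * star β = 1 := by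
        rw [Complex.star_def, Complex.mul_conj, Complex.normSq_eq_norm_sq, hβ]; simp
      have hs : ∀ a b : ι, Matrix.vecMulVec (Pi.single a 1 : ι → ℂ) (Pi.single b 1) =
          Matrix.single a b 1 := fun a b =>
        (Matrix.single_eq_single_vecMulVec_single a b).symm
      rw [star_add, star_smul, Matrix.add_vecMulVec, Matrix.vecMulVec_add, Matrix.vecMulVec_add]
      simp only [Matrix.smul_vecMulVec, Matrix.vecMulVec_smul, Pi.star_single, star_one, hs,
        smul_smul, mul_comm (star β), hβ', one_smul]
      abel
    rwa [h2, map_add, map_add, map_add, map_smul, map_smul] at h1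
  set a := f (Matrix.single i j 1)
  set b := f (Matrix.single j i 1)
  obtain ⟨-, hi⟩ := Complex.nonneg_iff.mp (hdiag i)
  obtain ⟨-, hj⟩ := Complex.nonneg_iff.mp (hdiag j)
  have q1 := (Complex.nonneg_iff.mp (hq 1 (by simp))).2
  have q2 := (Complex.nonneg_iff.mp (hq Complex.I (by simp))).2
  simp only [Complex.add_im, ← hi, ← hj, one_mul, star_one, Complex.mul_im, Complex.I_re,
    Complex.I_im, Complex.star_def, Complex.conj_re, Complex.conj_im] at q1 q2
  have hba : b = star a := by
    apply Complex.ext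
    · rw [Complex.star_def, Complex.conj_re]; linarith
    · rw [Complex.star_def, Complex.conj_im]; linarith
  have hfin : 2 * ‖a‖ ≤ 2 * (f 1).re := by
    by_cases ha : a = 0
    · have := (Complex.nonneg_iff.mp (hdiag i)).1.trans (hle i)
      simpa [ha] using this
    have hn : (‖a‖ : ℂ) ≠ 0 := by exact_mod_cast norm_ne_zero_iff.mpr ha
    have h := (Complex.nonneg_iff.mp (hq (-(a / ‖a‖)) (by
      rw [norm_neg, norm_div, Complex.norm_real, norm_norm, div_self (norm_ne_zero_iff.mpr ha)]))).1
    have e1 : -(a / ‖a‖) * star a = -(‖a‖ : ℂ) := by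
      rw [neg_mul, div_mul_eq_mul_div, Complex.star_def, Complex.mul_conj, Complex.normSq_eq_norm_sq]
      push_cast
      rw [pow_two, mul_div_assoc, div_self hn, mul_one]
    have e2 : star (-(a / ‖a‖)) * a = -(‖a‖ : ℂ) := by
      have := congrArg star e1
      rw [star_mul, star_star, mul_comm] at this
      rw [this]
      simp
    rw [hba, e1, e2] at h
    simp only [Complex.add_re, Complex.neg_re, Complex.ofReal_re] at h
    linarith [hle i, hle j]
  exact (by linarith : ‖a‖ ≤ (f 1).re).trans ((le_abs_self _).trans (Complex.abs_re_le_norm _))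

/-- The normalized powers of the transfer matrix of a density operator converge to a projection of
rank one. Positivity bounds `tr(Aⁱʲ Tⁿ)` by `tr Tⁿ⁺¹`, which grows like `rⁿ`; since the matrices of
the tensor span, the powers of `T / r` are bounded. -/
theorem exists_tendsto_transfer_pow (hA : IsStrongInjective A) (hd : IsDensity A) :
    ∃ (r : ℝ) (R L : κ → ℂ), 0 < r ∧ L ⬝ᵥ R = 1 ∧
      Tendsto (fun n : ℕ => ((r : ℂ)⁻¹) ^ n • transfer A ^ n) atTop (𝓝 (vecMulVec R L)) := by
  have := hA.transfer.nonempty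
  obtain ⟨r, h1, h2⟩ := hA.transfer
  have hpos : ∀ n i j, ‖(A i j * transfer A ^ n).trace‖ ≤ ‖(transfer A ^ (n + 1)).trace‖ :=
    fun n i j => by
      let f : Matrix ι ι ℂ →ₗ[ℂ] ℂ :=
        traceLinearMap κ ℂ ℂ ∘ₗ LinearMap.mulRight ℂ (transfer A ^ n) ∘ₗ bondOp A
      have := norm_apply_single_le (f := f) (fun W => hd.trace_bondOp_nonneg W n) j i
      simpa [f, bondOp_single, bondOp_one, ← pow_succ'] using this
  have htr : 0 < (transfer A).trace := by
    have h0 : 0 ≤ (transfer A).trace := by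
      simpa [bondOp_one] using hd.trace_bondOp_nonneg 1 0
    refine h0.lt_of_ne fun h => ?_
    have hz : traceLinearMap κ ℂ ℂ = 0 :=
      LinearMap.ext_on_range hA.injective.span_eq_top fun p => by
        have := hpos 0 p.1 p.2
        simpa [← h] using this
    have := LinearMap.congr_fun hz 1
    simp at this
  have hr := pos_of_trace_pos h2 htr
  have hspec : ∀ μ ∈ spectrum ℂ (transfer A), ‖μ‖ ≤ r := fun μ hμ => by
    rw [← Matrix.spectrum_toLin', ← Module.End.hasEigenvalue_iff_mem_spectrum] at hμ
    by_cases h : μ = r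
    · rw [h, Complex.norm_real, Real.norm_of_nonneg hr.le]
    · exact (h2 μ hμ h).le
  have hbound : ∀ X : Matrix κ κ ℂ, ∃ C : ℝ, ∀ n : ℕ,
      ‖(X * transfer A ^ n).trace‖ ≤ C * r ^ n := fun X => by
    have hX : X ∈ Submodule.span ℂ (Set.range fun p : ι × ι => A p.1 p.2) := by
      rw [hA.injective.span_eq_top]; trivial
    induction hX using Submodule.span_induction with
    | mem x hx =>
      obtain ⟨p, rfl⟩ := hx
      refine ⟨Fintype.card κ * r, fun n => (hpos n p.1 p.2).trans
        ((norm_trace_pow_le hspec (n + 1)).trans_eq ?_)⟩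
      rw [pow_succ']
      ring
    | zero => exact ⟨0, fun n => by simp⟩
    | add x y _ _ hx hy =>
      obtain ⟨C, hC⟩ := hx
      obtain ⟨C', hC'⟩ := hy
      refine ⟨C + C', fun n => ?_⟩
      rw [add_mul, trace_add, add_mul]
      exact (norm_add_le _ _).trans (add_le_add (hC n) (hC' n))
    | smul c x _ hx =>
      obtain ⟨C, hC⟩ := hx
      refine ⟨‖c‖ * C, fun n => ?_⟩
      rw [Matrix.smul_mul, trace_smul, norm_smul, mul_assoc]
      exact mul_le_mul_of_nonneg_left (hC n) (norm_nonneg _)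
  obtain ⟨R, L, h⟩ := exists_tendsto_pow hr h1 h2 fun i j => by
    obtain ⟨C, hC⟩ := hbound (Matrix.single j i 1)
    refine ⟨C, fun n => ?_⟩
    have := hC n
    rwa [Matrix.trace_single_mul, one_smul] at this
  exact ⟨r, R, L, hr, h⟩

end Positivity

/-! ### String order parameters -/

section StringOrder

open Filter Topology Matrix

variable {ι κ : Type*} [Fintype ι] [DecidableEq ι] [Fintype κ] [DecidableEq κ]
  {A : Tensor ι κ}

/-- For large `N` the quadratic terms give `Re ((1 + β) z) ≥ 0` for every phase `β`, which forces
`z ≥ 0`: take `β` such that `β z = -|z|`. -/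
theorem nonneg_of_forall_quadratic {D : ℝ} {z : ℂ}
    (h : ∀ N : ℕ, 1 ≤ N → ∀ β : ℂ, ‖β‖ = 1 →
      0 ≤ N * D + ((N : ℝ) ^ 2 - N) * z.re + (N : ℝ) ^ 2 * (β * z).re) : 0 ≤ z := by
  have key : ∀ β : ℂ, ‖β‖ = 1 → 0 ≤ z.re + (β * z).re := fun β hβ => by
    by_contra hneg
    rw [not_le] at hneg
    obtain ⟨N, hN⟩ := exists_nat_gt ((|D - z.re|) / -(z.re + (β * z).re))
    rw [div_lt_iff₀ (by linarith)] at hN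
    have h1 := h (N + 1) (by omega) β hβ
    push_cast at h1
    have h2 : 0 ≤ ((N : ℝ) + 1) * ((D - z.re) + (N + 1) * (z.re + (β * z).re)) := by
      linarith
    have h3 := nonneg_of_mul_nonneg_right h2 (by positivity)
    have h4 := le_abs_self (D - z.re)
    linarith
  by_cases hz : z = 0
  · rw [hz]
  have hn : (‖z‖ : ℂ) ≠ 0 := by exact_mod_cast norm_ne_zero_iff.mpr hz
  have h1 := key (-(star z / ‖z‖)) (by
    rw [norm_neg, norm_div, Complex.norm_real, norm_norm, norm_star,
      div_self (norm_ne_zero_iff.mpr hz)])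
  have e1 : -(star z / ‖z‖) * z = -(‖z‖ : ℂ) := by
    rw [neg_mul, div_mul_eq_mul_div, mul_comm, Complex.star_def, Complex.mul_conj,
      Complex.normSq_eq_norm_sq]
    push_cast
    rw [pow_two, mul_div_assoc, div_self hn, mul_one]
  rw [e1, Complex.neg_re, Complex.ofReal_re] at h1
  have h2 : z.re = ‖z‖ := le_antisymm (Complex.re_le_norm z) (by linarith)
  have h3 := Complex.sq_norm_sub_sq_re z
  rw [h2, sub_self] at h3
  exact Complex.nonneg_iff.mpr
    ⟨by rw [h2]; exact norm_nonneg z, ((pow_eq_zero_iff two_ne_zero).mp h3.symm).symm⟩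

/-- The string operator on site `k`: the symmetry operator `U` on all sites before `p` and the end
operator `O` at `p`. -/
def stringOp (U O : Matrix ι ι ℂ) (p k : ℕ) : Matrix ι ι ℂ :=
  if k < p then U else if k = p then O else 1

variable {U O : Matrix ι ι ℂ} {a : (Matrix κ κ ℂ)ˣ}

/-- The strings cancel before `p`; between the end points a single string acts as conjugation by
`a`. -/
theorem trace_string_of_lt (hU : Uᴴ * U = 1)
    (ha : ∀ X, bondOp A (X * U) = (↑a⁻¹ : Matrix κ κ ℂ) * bondOp A X * a) (p d e : ℕ) :
    (seqProd (fun k => bondOp A ((stringOp U O p k)ᴴ * stringOp U O (p + 1 + d) k))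
      (p + 1 + d + 1 + e)).trace =
      ((↑a⁻¹ : Matrix κ κ ℂ) * bondOp A Oᴴ * transfer A ^ d * a * bondOp A O *
        transfer A ^ (e + p)).trace := by
  have hTa : bondOp A U = (↑a⁻¹ : Matrix κ κ ℂ) * transfer A * a := by
    have := ha 1
    rwa [one_mul, bondOp_one] at this
  have hpow : ∀ d : ℕ, ((↑a⁻¹ : Matrix κ κ ℂ) * transfer A * a) ^ d =
      (↑a⁻¹ : Matrix κ κ ℂ) * transfer A ^ d * a := fun d => by
    induction d with
    | zero => simp
    | succ d ih =>
      rw [pow_succ, ih, pow_succ]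
      simp only [mul_assoc, Units.mul_inv_cancel_left]
  rw [seqProd_add, seqProd_add, seqProd_add, seqProd_add, seqProd_one, seqProd_one,
    seqProd_const (c := transfer A) (L := p), seqProd_const (c := bondOp A U) (L := d),
    seqProd_const (c := transfer A) (L := e)]
  · have e1 : (stringOp U O p (p + 0))ᴴ * stringOp U O (p + 1 + d) (p + 0) = Oᴴ * U := by
      rw [stringOp, stringOp, if_neg (by omega), if_pos (by omega), if_pos (by omega)]
    have e2 : (stringOp U O p (p + 1 + d + 0))ᴴ * stringOp U O (p + 1 + d) (p + 1 + d + 0) = O := by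
      rw [stringOp, stringOp, if_neg (by omega), if_neg (by omega), if_neg (by omega),
        if_pos (by omega), conjTranspose_one, one_mul]
    rw [e1, e2, ha, hTa, hpow, pow_add]
    simp only [mul_assoc]
    rw [Matrix.trace_mul_comm (transfer A ^ p)]
    simp only [mul_assoc, Units.mul_inv_cancel_left]
  · intro k hk
    rw [stringOp, stringOp, if_neg (by omega), if_neg (by omega), if_neg (by omega),
      if_neg (by omega), conjTranspose_one, one_mul, bondOp_one]
  · intro k hk
    rw [stringOp, stringOp, if_neg (by omega), if_neg (by omega), if_pos (by omega),
      conjTranspose_one, one_mul]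
  · intro k hk
    rw [stringOp, stringOp, if_pos hk, if_pos (by omega), hU, bondOp_one]

theorem trace_string_self (hU : Uᴴ * U = 1) (p e : ℕ) :
    (seqProd (fun k => bondOp A ((stringOp U O p k)ᴴ * stringOp U O p k)) (p + 1 + e)).trace =
      (bondOp A (Oᴴ * O) * transfer A ^ (e + p)).trace := by
  rw [seqProd_add, seqProd_add, seqProd_one, seqProd_const (c := transfer A) (L := p),
    seqProd_const (c := transfer A) (L := e)]
  · have e1 : (stringOp U O p (p + 0))ᴴ * stringOp U O p (p + 0) = Oᴴ * O := by
      rw [stringOp, if_neg (by omega), if_pos (by omega)]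
    rw [e1, pow_add, Matrix.mul_assoc, Matrix.trace_mul_comm, Matrix.mul_assoc]
  · intro k hk
    rw [stringOp, if_neg (by omega), if_neg (by omega), conjTranspose_one, one_mul, bondOp_one]
  · intro k hk
    rw [stringOp, if_pos hk, hU, bondOp_one]

/-- The correlator of two string operators whose end points move apart along both arcs of the ring.
The two sites with end operators do not contribute powers of the transfer matrix, whence the
exponent `L - 2`. -/
theorem tendsto_trace_string {r : ℝ} {P : Matrix κ κ ℂ}
    (hP : Tendsto (fun n : ℕ => ((r : ℂ)⁻¹) ^ n • transfer A ^ n) atTop (𝓝 P))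
    (hU : Uᴴ * U = 1)
    (ha : ∀ X, bondOp A (X * U) = (↑a⁻¹ : Matrix κ κ ℂ) * bondOp A X * a) (O : Matrix ι ι ℂ)
    {p q L : ℕ → ℕ} (hpq : ∀ s, p s + 1 + s ≤ q s) (hqL : ∀ s, q s + 1 ≤ L s)
    (hL : ∀ s, s + q s + 1 ≤ L s + p s) :
    Tendsto (fun s => ((r : ℂ)⁻¹) ^ (L s - 2) * (seqProd (fun k =>
      bondOp A ((stringOp U O (p s) k)ᴴ * stringOp U O (q s) k)) (L s)).trace) atTop
      (𝓝 ((↑a⁻¹ : Matrix κ κ ℂ) * bondOp A Oᴴ * P * a * bondOp A O * P).trace) := by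
  have hdec : ∀ s, ∃ d e, s ≤ d ∧ s ≤ e + p s ∧ q s = p s + 1 + d ∧ L s = p s + 1 + d + 1 + e :=
    fun s => by
      have h1 := hpq s
      have h2 := hqL s
      have h3 := hL s
      exact ⟨q s - p s - 1, L s - q s - 1, by omega, by omega, by omega, by omega⟩
  choose d e hd1 he1 hpj hLs using hdec
  have hdt : Tendsto d atTop atTop := tendsto_atTop_mono hd1 tendsto_id
  have het : Tendsto (fun s => e s + p s) atTop atTop := tendsto_atTop_mono he1 tendsto_id
  have hc : Continuous fun y : Matrix κ κ ℂ × Matrix κ κ ℂ =>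
      ((↑a⁻¹ : Matrix κ κ ℂ) * bondOp A Oᴴ * y.1 * a * bondOp A O * y.2).trace :=
    ((((continuous_const.mul continuous_fst).mul continuous_const).mul
      continuous_const).mul continuous_snd).matrix_trace
  refine ((hc.tendsto (P, P)).comp ((hP.comp hdt).prodMk_nhds (hP.comp het))).congr fun s => ?_
  have hexp : p s + 1 + d s + 1 + e s - 2 = d s + (e s + p s) := by omega
  rw [hLs, hpj, trace_string_of_lt hU ha, hexp, pow_add]
  simp only [Function.comp_apply, Matrix.mul_smul, Matrix.smul_mul, Matrix.trace_smul, smul_smul,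
    smul_eq_mul]
  ring

/-- The norm of a string operator. The exponent `L - 2` is the normalization of the correlators. -/
theorem tendsto_trace_string_self {r : ℝ} (hr : 0 < r) {P : Matrix κ κ ℂ}
    (hP : Tendsto (fun n : ℕ => ((r : ℂ)⁻¹) ^ n • transfer A ^ n) atTop (𝓝 P))
    (hU : Uᴴ * U = 1) (O : Matrix ι ι ℂ) {p L : ℕ → ℕ} (hpL : ∀ s, p s + 1 ≤ L s)
    (hL : ∀ s, s + 2 ≤ L s) :
    Tendsto (fun s => ((r : ℂ)⁻¹) ^ (L s - 2) * (seqProd (fun k =>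
      bondOp A ((stringOp U O (p s) k)ᴴ * stringOp U O (p s) k)) (L s)).trace) atTop
      (𝓝 ((r : ℂ) * (bondOp A (Oᴴ * O) * P).trace)) := by
  have hr0 : (r : ℂ) ≠ 0 := by exact_mod_cast hr.ne'
  have hdec : ∀ s, ∃ e, L s = p s + 1 + e ∧ s ≤ e + p s ∧ (e + p s) = L s - 2 + 1 := fun s => by
    have h1 := hpL s
    have h2 := hL s
    exact ⟨L s - p s - 1, by omega, by omega, by omega⟩
  choose e hLs he1 he2 using hdec
  have het : Tendsto (fun s => e s + p s) atTop atTop := tendsto_atTop_mono he1 tendsto_id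
  have hc : Continuous fun y : Matrix κ κ ℂ => (r : ℂ) * (bondOp A (Oᴴ * O) * y).trace :=
    continuous_const.mul (continuous_const.mul continuous_id).matrix_trace
  have hlim : Tendsto (fun s => (r : ℂ) * (bondOp A (Oᴴ * O) *
      (((r : ℂ)⁻¹) ^ (e s + p s) • transfer A ^ (e s + p s))).trace) atTop
      (𝓝 ((r : ℂ) * (bondOp A (Oᴴ * O) * P).trace)) := (hc.tendsto P).comp (hP.comp het)
  refine hlim.congr fun s => ?_
  have hM : (seqProd (fun k => bondOp A ((stringOp U O (p s) k)ᴴ * stringOp U O (p s) k))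
      (L s)).trace = (bondOp A (Oᴴ * O) * transfer A ^ (e s + p s)).trace := by
    rw [hLs, trace_string_self hU]
  have e3 : (r : ℂ) * (r : ℂ)⁻¹ ^ (e s + p s) = (r : ℂ)⁻¹ ^ (L s - 2) := by
    rw [he2, pow_succ', mul_inv_cancel_left₀ hr0]
  rw [hM, Matrix.mul_smul, Matrix.trace_smul, smul_eq_mul, ← mul_assoc, e3]

/-- The quadratic form of a positive semidefinite matrix with diagonal `D` and with `z` above the
diagonal, at the vector that equals `1` in the first half and `β` in the second (divided by two).
The real parts of the entries off the diagonal within each half are all `z.re`. -/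
theorem quadratic_nonneg {N : ℕ} {D z : ℂ} {q : Fin N ⊕ Fin N → Fin N ⊕ Fin N → ℂ}
    (hq : ∀ x : Fin N ⊕ Fin N → ℂ, 0 ≤ (∑ i, ∑ j, star (x i) * q i j * x j).re)
    (hd : ∀ f : Fin N → Fin N ⊕ Fin N, Function.Injective f → ∀ i j,
      (q (f i) (f j)).re = if i = j then D.re else z.re)
    (hq12 : ∀ i j : Fin N, q (Sum.inl i) (Sum.inr j) = z)
    (hq21 : ∀ i j : Fin N, q (Sum.inr i) (Sum.inl j) = star z) {β : ℂ} (hβ : ‖β‖ = 1) :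
    0 ≤ N * D.re + ((N : ℝ) ^ 2 - N) * z.re + (N : ℝ) ^ 2 * (β * z).re := by
  have hquad := hq (Sum.elim (fun _ => 1) (fun _ => β))
  have hblock : ∀ f : Fin N → Fin N ⊕ Fin N, Function.Injective f →
      (∑ i, ∑ j, q (f i) (f j)).re = N * D.re + ((N : ℝ) ^ 2 - N) * z.re := fun f hf => by
    have h1 : ∀ i j, (q (f i) (f j)).re = z.re + if i = j then D.re - z.re else 0 := fun i j => by
      rw [hd f hf]
      split_ifs <;> simp
    simp only [Complex.re_sum, h1, Finset.sum_add_distrib, Finset.sum_const, Finset.card_univ,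
      Fintype.card_fin, nsmul_eq_mul, Finset.sum_ite_eq, Finset.mem_univ, if_true]
    ring
  have hββ : star β * β = 1 := by
    rw [mul_comm, Complex.star_def, Complex.mul_conj, Complex.normSq_eq_norm_sq, hβ]; simp
  have e22 : ∀ i j : Fin N, star β * q (Sum.inr i) (Sum.inr j) * β =
      q (Sum.inr i) (Sum.inr j) := fun i j => by
    rw [mul_right_comm, hββ, one_mul]
  simp only [Fintype.sum_sum_type, Sum.elim_inl, Sum.elim_inr, star_one, one_mul, mul_one,
    hq12, hq21, e22, Finset.sum_add_distrib, Finset.sum_const, Finset.card_univ,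
    Fintype.card_fin, nsmul_eq_mul, Complex.add_re, hblock _ Sum.inl_injective,
    hblock _ Sum.inr_injective] at hquad
  have e3 : ((N : ℂ) * ((N : ℂ) * (z * β))).re = (N : ℝ) ^ 2 * (β * z).re := by
    rw [← mul_assoc, ← Nat.cast_mul, ← Complex.ofReal_natCast, Complex.re_ofReal_mul,
      mul_comm z]
    push_cast
    ring
  have e4 : ((N : ℂ) * ((N : ℂ) * (star β * star z))).re = (N : ℝ) ^ 2 * (β * z).re := by
    rw [← star_mul', Complex.star_def, ← mul_assoc, ← Nat.cast_mul, ← Complex.ofReal_natCast,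
      Complex.re_ofReal_mul, Complex.conj_re]
    push_cast
    ring
  rw [e3, e4] at hquad
  linarith

/-- Long-range order of a string operator is nonnegative: the string operators with far separated
end points have a positive semidefinite Gram matrix, all of whose entries above the diagonal agree
in the limit. -/
theorem stringOrder_nonneg (hd : IsDensity A) {r : ℝ} (hr : 0 < r) {P : Matrix κ κ ℂ}
    (hP : Tendsto (fun n : ℕ => ((r : ℂ)⁻¹) ^ n • transfer A ^ n) atTop (𝓝 P))
    (hU : Uᴴ * U = 1)
    (ha : ∀ X, bondOp A (X * U) = (↑a⁻¹ : Matrix κ κ ℂ) * bondOp A X * a) (O : Matrix ι ι ℂ) :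
    0 ≤ ((↑a⁻¹ : Matrix κ κ ℂ) * bondOp A Oᴴ * P * a * bondOp A O * P).trace := by
  obtain ⟨z, hz⟩ : ∃ z, z = ((↑a⁻¹ : Matrix κ κ ℂ) * bondOp A Oᴴ * P * a * bondOp A O * P).trace :=
    ⟨_, rfl⟩
  obtain ⟨D, hD⟩ : ∃ D, D = (r : ℂ) * (bondOp A (Oᴴ * O) * P).trace := ⟨_, rfl⟩
  rw [← hz]
  refine nonneg_of_forall_quadratic (D := D.re) fun N hN β hβ => ?_
  -- `2N` end points, which are equally spaced on a ring of `2N(s + 1)` sites.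
  obtain ⟨pos, hpos1, hpos2⟩ : ∃ pos : Fin N ⊕ Fin N → ℕ,
      (∀ i : Fin N, pos (Sum.inl i) = i) ∧ ∀ i : Fin N, pos (Sum.inr i) = N + i :=
    ⟨Sum.elim (fun i => i) (fun j => N + j), fun _ => rfl, fun _ => rfl⟩
  have hpos : ∀ i, pos i < 2 * N := by
    rintro (i | i) <;> simp only [hpos1, hpos2] <;> omega
  have hinj : ∀ i j, pos i = pos j → i = j := by
    rintro (i | i) (j | j) h <;> simp only [hpos1, hpos2] at h
    · exact congrArg Sum.inl (Fin.ext h)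
    · omega
    · omega
    · exact congrArg Sum.inr (Fin.ext (by omega))
  obtain ⟨M, hM⟩ : ∃ M : ℕ → Matrix (Fin N ⊕ Fin N) (Fin N ⊕ Fin N) ℂ, ∀ s i j, M s i j =
      (seqProd (fun k => bondOp A ((stringOp U O (pos i * (s + 1)) k)ᴴ *
        stringOp U O (pos j * (s + 1)) k)) (2 * N * (s + 1))).trace :=
    ⟨fun s => Matrix.of fun i j => _, fun _ _ _ => rfl⟩
  have hMpsd : ∀ s, (M s).PosSemidef := fun s => by
    have h := hd.posSemidef_gram (L := 2 * N * (s + 1)) (Nat.mul_pos (by omega) s.succ_pos)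
      fun i (k : Fin (2 * N * (s + 1))) => stringOp U O (pos i * (s + 1)) k
    convert h using 1
    ext i j
    rw [hM, Matrix.of_apply, seqProd]
  have hlt : ∀ i j, pos i < pos j →
      Tendsto (fun s => ((r : ℂ)⁻¹) ^ (2 * N * (s + 1) - 2) * M s i j) atTop (𝓝 z) :=
    fun i j hij => by
      simp only [hM, hz]
      have h0 : ∀ s, pos i * (s + 1) + s + 1 ≤ pos j * (s + 1) := fun s => by
        have := Nat.mul_le_mul_right (s + 1) hij
        rwa [Nat.succ_mul] at this
      have h1 : ∀ s, pos j * (s + 1) + s + 1 ≤ 2 * N * (s + 1) := fun s => by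
        have := Nat.mul_le_mul_right (s + 1) (hpos j)
        rwa [Nat.succ_mul] at this
      exact tendsto_trace_string hP hU ha O (fun s => by have := h0 s; omega)
        (fun s => by have := h1 s; omega) (fun s => by have := h1 s; omega)
  obtain ⟨q, hqdef⟩ : ∃ q : Fin N ⊕ Fin N → Fin N ⊕ Fin N → ℂ, ∀ i j, q i j =
      if i = j then D else if pos i < pos j then z else star z := ⟨fun i j => _, fun _ _ => rfl⟩
  have hlim : ∀ i j, Tendsto (fun s => ((r : ℂ)⁻¹) ^ (2 * N * (s + 1) - 2) * M s i j) atTop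
      (𝓝 (q i j)) := fun i j => by
    rcases lt_trichotomy (pos i) (pos j) with h | h | h
    · have hne : i ≠ j := fun e => by rw [e] at h; exact lt_irrefl _ h
      rw [hqdef, if_neg hne, if_pos h]
      exact hlt i j h
    · obtain rfl := hinj i j h
      rw [hqdef, if_pos rfl, hD]
      simp only [hM]
      have h1 : ∀ s, pos i * (s + 1) + s + 1 ≤ 2 * N * (s + 1) := fun s => by
        have := Nat.mul_le_mul_right (s + 1) (hpos i)
        rwa [Nat.succ_mul] at this
      have h2 : ∀ s, 2 * (s + 1) ≤ 2 * N * (s + 1) := fun s => Nat.mul_le_mul_right _ (by omega)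
      exact tendsto_trace_string_self hr hP hU O (fun s => by have := h1 s; omega)
        (fun s => by have := h2 s; omega)
    · have hne : i ≠ j := fun e => by rw [e] at h; exact lt_irrefl _ h
      rw [hqdef, if_neg hne, if_neg h.not_gt]
      refine ((continuous_star.tendsto z).comp (hlt j i h)).congr fun s => ?_
      have h1 := (hMpsd s).isHermitian.apply i j
      have h2 : star ((r : ℂ)⁻¹) = (r : ℂ)⁻¹ := by
        rw [← Complex.ofReal_inv, Complex.star_def, Complex.conj_ofReal]
      rw [Function.comp_apply, star_mul', h1, star_pow, h2]
  refine quadratic_nonneg (q := q) (fun x => ?_) (fun f hf i j => ?_) (fun i j => ?_)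
    (fun i j => ?_) hβ
  · have ht : Tendsto (fun s => (∑ i, ∑ j, star (x i) *
        (((r : ℂ)⁻¹) ^ (2 * N * (s + 1) - 2) * M s i j) * x j).re) atTop
        (𝓝 (∑ i, ∑ j, star (x i) * q i j * x j).re) := by
      refine (Complex.continuous_re.tendsto _).comp ?_
      exact tendsto_finsetSum _ fun i _ => tendsto_finsetSum _ fun j _ =>
        ((hlim i j).const_mul _).mul_const _
    refine ge_of_tendsto' ht fun s => ?_
    have h1 := (hMpsd s).dotProduct_mulVec_nonneg x
    have h2 : ∑ i, ∑ j, star (x i) * (((r : ℂ)⁻¹) ^ (2 * N * (s + 1) - 2) * M s i j) * x j =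
        (((r⁻¹) ^ (2 * N * (s + 1) - 2) : ℝ) : ℂ) * (star x ⬝ᵥ (M s).mulVec x) := by
      simp only [dotProduct, mulVec, Finset.mul_sum, Pi.star_apply]
      refine Finset.sum_congr rfl fun i _ => Finset.sum_congr rfl fun j _ => ?_
      push_cast
      ring
    rw [h2, Complex.re_ofReal_mul]
    exact mul_nonneg (by positivity) (Complex.nonneg_iff.mp h1).1
  · simp only [hqdef, hf.eq_iff]
    split_ifs <;> simp
  · rw [hqdef, if_neg (by simp), hpos1, hpos2, if_pos (by omega)]
  · rw [hqdef, if_neg (by simp), hpos1, hpos2, if_neg (by omega)]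

end StringOrder

/-! ### Absence of a mixed anomaly between ket and bra -/

section MixedAnomaly

open Filter Topology Matrix

variable {ι κ : Type*} [Fintype ι] [DecidableEq ι] [Fintype κ] [DecidableEq κ]
  {A : Tensor ι κ}

theorem bondOp_onSite (u v X : Matrix ι ι ℂ) : bondOp (onSite u v A) X = bondOp A (vᴴ * X * u) := by
  simp only [bondOp_apply, onSite, Finset.smul_sum, smul_smul]
  rw [Finset.sum_comm]
  refine Finset.sum_congr rfl fun p _ => ?_
  rw [← Finset.sum_smul]
  congr 1
  simp only [Fintype.sum_prod_type, Matrix.mul_apply, Finset.sum_mul, Matrix.conjTranspose_apply]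
  exact Finset.sum_congr rfl fun i _ => Finset.sum_congr rfl fun j _ => by ring

/-- The antilinear automorphism `M ↦ b M* b⁻¹` of the matrix algebra. -/
def conjBy (b : (Matrix κ κ ℂ)ˣ) : Matrix κ κ ℂ →+* Matrix κ κ ℂ where
  toFun M := b * twist (-1) M * (↑b⁻¹ : Matrix κ κ ℂ)
  map_one' := by simp
  map_mul' M N := by rw [twist_mul]; simp only [mul_assoc, Units.inv_mul_cancel_left]
  map_zero' := by simp [twist_eq_map]
  map_add' M N := by
    rw [← add_mul, ← mul_add]
    congr 2
    ext i j
    simp [twist_eq_map]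

theorem conjBy_apply (b : (Matrix κ κ ℂ)ˣ) (M : Matrix κ κ ℂ) :
    conjBy b M = b * twist (-1) M * (↑b⁻¹ : Matrix κ κ ℂ) := rfl

theorem conjBy_smul (b : (Matrix κ κ ℂ)ˣ) (c : ℂ) (M : Matrix κ κ ℂ) :
    conjBy b (c • M) = star c • conjBy b M := by
  rw [conjBy_apply, twist_smul, ctwist_neg_one, Matrix.mul_smul, Matrix.smul_mul, conjBy_apply]

theorem continuous_conjBy (b : (Matrix κ κ ℂ)ˣ) : Continuous (conjBy b) := by
  have : Continuous fun M : Matrix κ κ ℂ =>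
      (b : Matrix κ κ ℂ) * M.map star * (↑b⁻¹ : Matrix κ κ ℂ) :=
    (continuous_const.mul (continuous_id.matrix_map continuous_star)).mul continuous_const
  refine this.congr fun M => ?_
  rw [conjBy_apply, twist_neg_one]

/-- If `a` implements a unitary on the ket and conjugation by `b` implements the adjoint, then
`a (b a* b⁻¹)` acts on the limit of the powers of the transfer matrix by a positive number. -/
theorem exists_pos_mul_conjBy (hA : IsInjective A) (hd : IsDensity A) {r : ℝ} (hr : 0 < r)
    {R L : κ → ℂ} (hLR : L ⬝ᵥ R = 1)
    (hP : Tendsto (fun n : ℕ => ((r : ℂ)⁻¹) ^ n • transfer A ^ n) atTop (𝓝 (vecMulVec R L)))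
    {b : (Matrix κ κ ℂ)ˣ} (hb : ∀ X, bondOp A Xᴴ = conjBy b (bondOp A X))
    {U : Matrix ι ι ℂ} {a : (Matrix κ κ ℂ)ˣ} (hU : Uᴴ * U = 1)
    (ha : ∀ X, bondOp A (X * U) = (↑a⁻¹ : Matrix κ κ ℂ) * bondOp A X * a) :
    ∃ c : ℂ, 0 < c ∧ vecMulVec R L * (a * conjBy b a) = c • vecMulVec R L := by
  obtain ⟨P, hPdef⟩ : ∃ P, P = vecMulVec R L := ⟨_, rfl⟩
  obtain ⟨t, ht⟩ : ∃ t : (Matrix κ κ ℂ)ˣ, t = Units.map (conjBy b).toMonoidHom a := ⟨_, rfl⟩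
  have ht1 : (t : Matrix κ κ ℂ) = conjBy b a := by rw [ht]; rfl
  have ht2 : (↑t⁻¹ : Matrix κ κ ℂ) = conjBy b (↑a⁻¹ : Matrix κ κ ℂ) := by
    rw [ht, ← map_inv]; rfl
  have hinv : ∀ M, conjBy b (conjBy b M) = M := fun M => by
    obtain ⟨X, rfl⟩ := bondOp_surjective hA M
    rw [← hb, ← hb, conjTranspose_conjTranspose]
  have hT : conjBy b (transfer A) = transfer A := by
    rw [← bondOp_one, ← hb, conjTranspose_one]
  have ha' : ∀ X, bondOp A (Uᴴ * X) = (↑t⁻¹ : Matrix κ κ ℂ) * bondOp A X * t := fun X => by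
    have h := hb (Xᴴ * U)
    rw [conjTranspose_mul, conjTranspose_conjTranspose, ha, (conjBy b).map_mul,
      (conjBy b).map_mul, ← ht1, ← ht2, hb, hinv] at h
    exact h
  -- Conjugating the identity by `U` yields both sides of `T = (a t)⁻¹ T (a t)`.
  have hcomm : Commute (transfer A) ((a * t : (Matrix κ κ ℂ)ˣ) : Matrix κ κ ℂ) := by
    have h1 := ha' U
    have h2 := ha 1
    rw [one_mul] at h2
    rw [hU, h2, bondOp_one] at h1
    have h3 : transfer A =
        (↑(a * t)⁻¹ : Matrix κ κ ℂ) * transfer A * ((a * t : (Matrix κ κ ℂ)ˣ) : Matrix κ κ ℂ) := by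
      rw [_root_.mul_inv_rev, Units.val_mul, Units.val_mul]
      simpa only [mul_assoc] using h1
    have h4 := congrArg (fun M => ((a * t : (Matrix κ κ ℂ)ˣ) : Matrix κ κ ℂ) * M) h3
    simp only [mul_assoc, Units.mul_inv_cancel_left] at h4
    exact h4.symm
  rw [← hPdef] at hP ⊢
  have hPcomm : P * ((a * t : (Matrix κ κ ℂ)ˣ) : Matrix κ κ ℂ) =
      ((a * t : (Matrix κ κ ℂ)ˣ) : Matrix κ κ ℂ) * P := by
    refine tendsto_nhds_unique (hP.mul_const _) ((hP.const_mul _).congr fun n => ?_)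
    rw [Matrix.mul_smul, Matrix.smul_mul, ((hcomm.pow_left n).eq)]
  have hPτ : conjBy b P = P := by
    refine tendsto_nhds_unique (((continuous_conjBy b).tendsto P).comp hP) (hP.congr fun n => ?_)
    rw [Function.comp_apply, conjBy_smul, map_pow, hT, star_pow, ← Complex.ofReal_inv,
      Complex.star_def, Complex.conj_ofReal]
  have hPXP : ∀ X, P * X * P = (L ⬝ᵥ X *ᵥ R) • P := fun X => by
    rw [hPdef, Matrix.mul_assoc, Matrix.mul_vecMulVec, Matrix.vecMulVec_mul_vecMulVec,
      Matrix.vecMulVec_smul]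
  have hPP : P * P = P := by
    have := hPXP 1
    rwa [mul_one, one_mulVec, hLR, one_smul] at this
  have htrP : P.trace = 1 := by
    rw [hPdef, Matrix.trace_vecMulVec, dotProduct_comm, hLR]
  have hP0 : P ≠ 0 := fun h => by
    rw [h, trace_zero] at htrP
    exact zero_ne_one htrP
  obtain ⟨c, hc⟩ : ∃ c : ℂ, P * ((a * t : (Matrix κ κ ℂ)ˣ) : Matrix κ κ ℂ) = c • P :=
    ⟨_, by rw [← hPXP ((a * t : (Matrix κ κ ℂ)ˣ) : Matrix κ κ ℂ), mul_assoc, ← hPcomm,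
      ← mul_assoc, hPP]⟩
  have hc0 : c ≠ 0 := by
    rintro rfl
    rw [zero_smul] at hc
    exact hP0 ((Units.mul_left_eq_zero _).mp hc)
  rw [← ht1, ← Units.val_mul]
  refine ⟨c, lt_of_le_of_ne ?_ hc0.symm, hc⟩
  -- With this end operator, the long-range order of the string is the scalar `c`.
  obtain ⟨O, hO⟩ := bondOp_surjective hA ((t : Matrix κ κ ℂ) * P)
  have hO' : bondOp A Oᴴ = a * P := by
    rw [hb, hO, map_mul, hPτ, ht1, hinv]
  have h := stringOrder_nonneg hd hr hP hU ha O
  have e : (↑a⁻¹ : Matrix κ κ ℂ) * bondOp A Oᴴ * P * a * bondOp A O * P = c • P := by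
    rw [hO, hO', Units.inv_mul_cancel_left, hPP, mul_assoc, mul_assoc, mul_assoc, hPP,
      ← mul_assoc (a : Matrix κ κ ℂ), ← Units.val_mul, ← mul_assoc, hc, Matrix.smul_mul, hPP]
  rwa [e, trace_smul, htrP, smul_eq_mul, mul_one] at h

variable {G K : Type*} [Group G] [Group K] {u : G × K →* Matrix.unitaryGroup ι ℂ}

/-- The Hermiticity symmetry carries no charge per site, so it implements the adjoint exactly. -/
theorem IsVirtualRep.bondOp_conjTranspose (hA : IsSymmetricMPDO u A)
    {V : DoubledGroup G K → (Matrix κ κ ℂ)ˣ} {ω : DoubledGroup G K × DoubledGroup G K → Circle}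
    (hV : IsVirtualRep (dsgn G K) (doubledOp u) A V ω) (X : Matrix ι ι ℂ) :
    bondOp A Xᴴ = conjBy (V (hermElt G K)) (bondOp A X) := by
  have := hA.strongInjective.transfer.nonempty
  obtain ⟨θ, hθ⟩ := hV.covariant (hermElt G K)
  have hone : ((u (1, 1) : Matrix.unitaryGroup ι ℂ) : Matrix ι ι ℂ) = 1 := by
    rw [show ((1, 1) : G × K) = 1 from rfl, map_one]; rfl
  have h1 : mpdo (tensorAct (dsgn G K) (doubledOp u) (hermElt G K) A) 1 = mpdo A 1 := by
    rw [hA.mpdo_tensorAct _ le_rfl]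
    change sitePow (u (1, 1) : Matrix ι ι ℂ) 1 * mpdo A 1 *
      (sitePow (u (1, 1) : Matrix ι ι ℂ) 1).conjTranspose = _
    rw [hone, sitePow_one, conjTranspose_one, one_mul, mul_one]
  have hθ1 := charge_eq_one hA.strongInjective.injective hθ h1
  have hact : ∀ i j, tensorAct (dsgn G K) (doubledOp u) (hermElt G K) A i j =
      twist (-1) (A j i) := fun i j => by
    rw [tensorAct_eq_onSite (u := 1) (v := 1) (ε := -1)]
    · simp only [onSite, Matrix.one_apply, Fintype.sum_prod_type]
      simp only [apply_ite star, star_one, star_zero, mul_ite, mul_one, mul_zero, ite_smul,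
        one_smul, zero_smul, Finset.sum_ite_eq, Finset.mem_univ, if_true,
        if_neg (by decide : ¬ (-1 : ℤˣ) = 1)]
      rfl
    · change ((u (1, 1) : Matrix ι ι ℂ) ⊗ₖ ((u (1, 1) : Matrix ι ι ℂ).map star)) *
        swapPow ι (-1) = _
      rw [hone]
  have hAij : ∀ i j, A i j = conjBy (V (hermElt G K)) (A j i) := fun i j => by
    have h := hθ i j
    rw [hact, hθ1, one_smul] at h
    rw [conjBy_apply, h]
    simp only [mul_assoc, Units.mul_inv_cancel_left, Units.mul_inv, mul_one]
  simp only [bondOp_apply, map_sum, conjBy_smul, Matrix.conjTranspose_apply]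
  refine Fintype.sum_equiv (Equiv.prodComm _ _) _ _ fun p => ?_
  simp only [Equiv.prodComm_apply, Prod.fst_swap, Prod.snd_swap]
  rw [← hAij]

/-- The charge per site of `G_l` can be absorbed in the on-site unitary. -/
theorem IsVirtualRep.bondOp_inclL
    {V : DoubledGroup G K → (Matrix κ κ ℂ)ˣ} {ω : DoubledGroup G K × DoubledGroup G K → Circle}
    (hV : IsVirtualRep (dsgn G K) (doubledOp u) A V ω) (g : G) :
    ∃ U : Matrix ι ι ℂ, Uᴴ * U = 1 ∧ ∀ X, bondOp A (X * U) =
      (↑(V (inclL G K g))⁻¹ : Matrix κ κ ℂ) * bondOp A X * (V (inclL G K g) : Matrix κ κ ℂ) := by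
  obtain ⟨θ, hθ⟩ := hV.covariant (inclL G K g)
  have hone : ((u (1, 1) : Matrix.unitaryGroup ι ℂ) : Matrix ι ι ℂ) = 1 := by
    rw [show ((1, 1) : G × K) = 1 from rfl, map_one]; rfl
  have hact : tensorAct (dsgn G K) (doubledOp u) (inclL G K g) A =
      onSite (u (g, 1) : Matrix ι ι ℂ) 1 A := by
    rw [tensorAct_eq_onSite (u := (u (g, 1) : Matrix ι ι ℂ)) (v := 1) (ε := 1)]
    · change onSite _ _ (fun i j => twist 1 (if (1 : ℤˣ) = 1 then A i j else A j i)) = _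
      simp only [if_true, twist_one]
    · change ((u (g, 1) : Matrix ι ι ℂ) ⊗ₖ ((u (1, 1) : Matrix ι ι ℂ).map star)) *
        swapPow ι 1 = _
      rw [hone]
  have hθθ : star ((θ⁻¹ : Circle) : ℂ) * ((θ⁻¹ : Circle) : ℂ) = 1 := by
    rw [Complex.star_def, mul_comm, Complex.mul_conj, Circle.normSq_coe, Complex.ofReal_one]
  refine ⟨((θ⁻¹ : Circle) : ℂ) • (u (g, 1) : Matrix ι ι ℂ), ?_, fun X => ?_⟩
  · rw [conjTranspose_smul, Matrix.smul_mul, Matrix.mul_smul, unitary_conjTranspose_mul,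
      smul_smul, hθθ, one_smul]
  · have h := bondOp_onSite (A := A) (u (g, 1) : Matrix ι ι ℂ) 1 X
    rw [conjTranspose_one, one_mul, ← hact] at h
    rw [Matrix.mul_smul, map_smul, ← h]
    simp only [bondOp_apply, hθ, smul_smul, Finset.smul_sum, Finset.mul_sum, Finset.sum_mul,
      Matrix.mul_smul, Matrix.smul_mul]
    refine Finset.sum_congr rfl fun p _ => ?_
    congr 1
    rw [Circle.coe_inv]
    field_simp [Circle.coe_ne_zero θ]

/-- The matrices `V_g (b V_g* b⁻¹)`, where `b` is the Hermiticity symmetry, are multiplicative in `g`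
up to the slant product: commuting `V_h` past the conjugate of `V_g`, which is proportional to the
matrix of `g` in `G_r`, costs this phase. -/
theorem mul_conjBy_mul {V : DoubledGroup G K → (Matrix κ κ ℂ)ˣ}
    {ω : DoubledGroup G K × DoubledGroup G K → Circle}
    (hV : ∀ x y, (V x : Matrix κ κ ℂ) * twist (dsgn G K x) (V y : Matrix κ κ ℂ) =
      (ω (x, y) : ℂ) • (V (x * y) : Matrix κ κ ℂ)) (g h : G) :
    (V (inclL G K (g * h)) : Matrix κ κ ℂ) *
        conjBy (V (hermElt G K)) (V (inclL G K (g * h)) : Matrix κ κ ℂ) =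
      ((ω (inclL G K h, inclR G K g) / ω (inclR G K g, inclL G K h) : Circle) : ℂ) •
        ((V (inclL G K g) : Matrix κ κ ℂ) *
          conjBy (V (hermElt G K)) (V (inclL G K g) : Matrix κ κ ℂ) *
        ((V (inclL G K h) : Matrix κ κ ℂ) *
          conjBy (V (hermElt G K)) (V (inclL G K h) : Matrix κ κ ℂ))) := by
  have hVL : ∀ g y, (V (inclL G K g) : Matrix κ κ ℂ) * (V y : Matrix κ κ ℂ) =
      (ω (inclL G K g, y) : ℂ) • (V (inclL G K g * y) : Matrix κ κ ℂ) := fun g y => by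
    rw [← hV, show dsgn G K (inclL G K g) = 1 from rfl, twist_one]
  have hVR : ∀ g y, (V (inclR G K g) : Matrix κ κ ℂ) * (V y : Matrix κ κ ℂ) =
      (ω (inclR G K g, y) : ℂ) • (V (inclR G K g * y) : Matrix κ κ ℂ) := fun g y => by
    rw [← hV, show dsgn G K (inclR G K g) = 1 from rfl, twist_one]
  have hHL : hermElt G K * inclL G K g = inclR G K g * hermElt G K := by
    refine SemidirectProduct.ext ?_ rfl
    change ((1 * 1, 1 * g, 1 * 1) : G × G × K) = (1 * 1, g * 1, 1 * 1)
    rw [one_mul g, mul_one g]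
  -- Conjugation by the Hermiticity symmetry exchanges the two copies of `G`.
  obtain ⟨l, hl⟩ : ∃ l : ℂ, conjBy (V (hermElt G K)) (V (inclL G K g) : Matrix κ κ ℂ) =
      l • (V (inclR G K g) : Matrix κ κ ℂ) := by
    have h1 := hV (hermElt G K) (inclL G K g)
    have h2 := hVR g (hermElt G K)
    rw [hHL] at h1
    have h3 : (V (inclR G K g * hermElt G K) : Matrix κ κ ℂ) =
        (ω (inclR G K g, hermElt G K) : ℂ)⁻¹ •
          ((V (inclR G K g) : Matrix κ κ ℂ) * (V (hermElt G K) : Matrix κ κ ℂ)) := by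
      rw [h2, smul_smul, inv_mul_cancel₀ (Circle.coe_ne_zero _), one_smul]
    refine ⟨ω (hermElt G K, inclL G K g) * (ω (inclR G K g, hermElt G K) : ℂ)⁻¹, ?_⟩
    rw [conjBy_apply, show (-1 : ℤˣ) = dsgn G K (hermElt G K) from rfl, h1, h3, smul_smul,
      Matrix.smul_mul, mul_assoc, Units.mul_inv, mul_one]
  have hcomm : (V (inclL G K h) : Matrix κ κ ℂ) *
      conjBy (V (hermElt G K)) (V (inclL G K g) : Matrix κ κ ℂ) =
      ((ω (inclL G K h, inclR G K g) / ω (inclR G K g, inclL G K h) : Circle) : ℂ) •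
        (conjBy (V (hermElt G K)) (V (inclL G K g) : Matrix κ κ ℂ) *
          (V (inclL G K h) : Matrix κ κ ℂ)) := by
    have hc : inclL G K h * inclR G K g = inclR G K g * inclL G K h := by
      ext <;> simp [inclL, inclR]
    rw [hl, Matrix.mul_smul, Matrix.smul_mul, hVL, hVR, hc, smul_smul, smul_smul, smul_smul,
      Circle.coe_div]
    congr 1
    field_simp [Circle.coe_ne_zero]
  have hgh : (V (inclL G K (g * h)) : Matrix κ κ ℂ) = (ω (inclL G K g, inclL G K h) : ℂ)⁻¹ •
      ((V (inclL G K g) : Matrix κ κ ℂ) * (V (inclL G K h) : Matrix κ κ ℂ)) := by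
    rw [hVL, smul_smul, inv_mul_cancel₀ (Circle.coe_ne_zero _), one_smul, map_mul]
  have hww : ∀ w : Circle, (w : ℂ)⁻¹ * star (w : ℂ)⁻¹ = 1 := fun w => by
    rw [← Circle.coe_inv, Complex.star_def, Complex.mul_conj, Circle.normSq_coe,
      Complex.ofReal_one]
  rw [hgh, conjBy_smul, Matrix.mul_smul, Matrix.smul_mul, smul_smul, mul_comm (star _), hww,
    one_smul, map_mul]
  calc _ = (V (inclL G K g) : Matrix κ κ ℂ) * ((V (inclL G K h) : Matrix κ κ ℂ) *
        conjBy (V (hermElt G K)) (V (inclL G K g) : Matrix κ κ ℂ)) *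
          conjBy (V (hermElt G K)) (V (inclL G K h) : Matrix κ κ ℂ) := by simp only [mul_assoc]
    _ = _ := by
      rw [hcomm]
      simp only [Matrix.mul_smul, Matrix.smul_mul, mul_assoc]

/-- Positivity forbids a mixed anomaly between the two copies of the strong symmetry: the phase
`σ` is a quotient of positive numbers. -/
theorem slantLR_eq_one_of_hasClass (hA : IsSymmetricMPDO u A) {c : DoubledH2 G K}
    (hc : HasClass (dsgn G K) (doubledOp u) A c) : slantLR G K c = 1 := by
  obtain ⟨V, ω, hV, rfl⟩ := hc
  obtain ⟨r, R, L, hr, hLR, hP⟩ := exists_tendsto_transfer_pow hA.strongInjective hA.density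
  have hex : ∀ g : G, ∃ c : ℂ, 0 < c ∧ vecMulVec R L * ((V (inclL G K g) : Matrix κ κ ℂ) *
      conjBy (V (hermElt G K)) (V (inclL G K g) : Matrix κ κ ℂ)) = c • vecMulVec R L := fun g => by
    obtain ⟨U, hU, ha⟩ := hV.bondOp_inclL g
    exact exists_pos_mul_conjBy hA.strongInjective.injective hA.density hr hLR hP
      (hV.bondOp_conjTranspose hA) hU ha
  choose c hc0 hc using hex
  have hP0 : vecMulVec R L ≠ 0 := fun h => by
    have := congrArg Matrix.trace h
    rw [Matrix.trace_vecMulVec, dotProduct_comm, hLR, trace_zero] at this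
    exact one_ne_zero this
  let w : DoubledGroup G K × DoubledGroup G K → Circle := ω.1
  have key : ∀ g h, w (inclL G K h, inclR G K g) / w (inclR G K g, inclL G K h) = 1 :=
    fun g h => by
      obtain ⟨σ, hσ⟩ : ∃ σ, σ = w (inclL G K h, inclR G K g) / w (inclR G K g, inclL G K h) :=
        ⟨_, rfl⟩
      have h1 := congrArg (fun M => vecMulVec R L * M) (mul_conjBy_mul (ω := w) hV.mul g h)
      simp only [← hσ, Matrix.mul_smul] at h1
      rw [hc, ← mul_assoc, hc, Matrix.smul_mul, hc, smul_smul, smul_smul] at h1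
      have h2 := smul_left_injective ℂ hP0 h1
      have h3 : (0 : ℂ) < c g * c h := mul_pos (hc0 g) (hc0 h)
      have h4 : (σ : ℂ) = c (g * h) / (c g * c h) := by
        rw [eq_div_iff h3.ne', h2, mul_assoc]
      have h5 : (0 : ℂ) ≤ σ := by
        rw [h4]
        exact div_nonneg (hc0 _).le h3.le
      rw [← hσ]
      ext
      rw [← Complex.norm_of_nonneg' h5, Circle.norm_coe, Complex.ofReal_one, Circle.coe_one]
  ext1 h
  ext1 g
  exact key g h

end MixedAnomaly

/-! ### Realization by fixed-point states -/

section FixedPoint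

open Matrix

/-- Gauge transformations of the bond do not change the generated operators. -/
theorem mpdo_gauge {ι κ : Type*} [Fintype κ] [DecidableEq κ] {A B : Tensor ι κ}
    {W : (Matrix κ κ ℂ)ˣ} (h : ∀ i j, B i j = (↑W⁻¹ : Matrix κ κ ℂ) * A i j * W) (L : ℕ) :
    mpdo B L = mpdo A L := by
  have hp : ∀ l : List (Matrix κ κ ℂ),
      (l.map fun M => (↑W⁻¹ : Matrix κ κ ℂ) * M * W).prod = (↑W⁻¹ : Matrix κ κ ℂ) * l.prod * W :=
    fun l => by
      induction l with
      | nil => simp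
      | cons M l ih =>
        rw [List.map_cons, List.prod_cons, ih, List.prod_cons]
        simp only [mul_assoc, Units.mul_inv_cancel_left]
  ext i j
  have e : (List.ofFn fun x => B (i x) (j x)) =
      (List.ofFn fun x => A (i x) (j x)).map fun M => (↑W⁻¹ : Matrix κ κ ℂ) * M * W := by
    rw [List.map_ofFn]
    exact congrArg _ (funext fun x => h _ _)
  rw [mpdo, mpdo, of_apply, of_apply, e, hp, trace_mul_cycle, Units.mul_inv, one_mul]

/-- A rank-one matrix `v vᵀ` with `v · v > 0` has a unique largest eigenvalue. -/
theorem hasUniqueLargestEigenvalue_vecMulVec {κ : Type*} [Fintype κ] [DecidableEq κ]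
    {v : κ → ℂ} {r : ℝ} (hr : 0 < r) (hv : v ⬝ᵥ v = r) :
    HasUniqueLargestEigenvalue (vecMulVec v v) := by
  have hr0 : (r : ℂ) ≠ 0 := by exact_mod_cast hr.ne'
  have hmul : ∀ x, (toLin' (vecMulVec v v)) x = (v ⬝ᵥ x) • v := fun x => by
    rw [toLin'_apply, vecMulVec_mulVec]
    simp
  have hv0 : v ≠ 0 := by
    rintro rfl
    rw [dotProduct_zero] at hv
    exact hr0 hv.symm
  refine ⟨r, finrank_eq_one_iff'.mpr ⟨⟨v, ?_⟩, fun h => hv0 (congrArg Subtype.val h), ?_⟩, ?_⟩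
  · rw [Module.End.mem_eigenspace_iff, hmul, hv]
  · rintro ⟨x, hx⟩
    rw [Module.End.mem_eigenspace_iff, hmul] at hx
    refine ⟨(r : ℂ)⁻¹ * (v ⬝ᵥ x), Subtype.ext ?_⟩
    change ((r : ℂ)⁻¹ * (v ⬝ᵥ x)) • v = x
    rw [mul_smul, hx, smul_smul, inv_mul_cancel₀ hr0, one_smul]
  · intro μ hμ hne
    obtain ⟨x, hx⟩ := hμ.exists_hasEigenvector
    have h1 := hx.apply_eq_smul
    rw [hmul] at h1
    have h2 := congrArg (fun y => v ⬝ᵥ y) h1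
    simp only [dotProduct_smul, smul_eq_mul, hv] at h2
    have h3 : v ⬝ᵥ x = 0 := by
      by_contra h
      rw [mul_comm] at h2
      exact hne (mul_right_cancel₀ h h2).symm
    rw [h3, zero_smul] at h1
    rw [(smul_eq_zero.mp h1.symm).resolve_right hx.2, norm_zero]
    exact hr

variable {μ ι : Type*} [Fintype μ] [DecidableEq μ] [Fintype ι] [DecidableEq ι] (e : ι ≃ μ × μ)

/-- The matrix unit whose row and column are the two components of `e i`. -/
def pairUnit (i : ι) : Matrix μ μ ℂ := Matrix.single (e i).1 (e i).2 1

/-- The local tensor of `|ψ⟩⟨ψ|`, where `ψ` is the matrix product state built from all matrix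
units: neighbouring sites share maximally entangled pairs. -/
def pairTensor : Tensor ι ι := fun i j => (pairUnit e i ⊗ₖ pairUnit e j).submatrix e e

theorem pairUnit_map_star (i : ι) : (pairUnit e i).map star = pairUnit e i := by
  ext a b
  simp only [pairUnit, map_apply, single_apply]
  split_ifs <;> simp

theorem pairTensor_apply (i j a b : ι) : pairTensor e i j a b =
    if (e a = ((e i).1, (e j).1) ∧ e b = ((e i).2, (e j).2)) then 1 else 0 := by
  simp only [pairTensor, pairUnit, submatrix_apply, kroneckerMap_apply, single_apply, Prod.ext_iff,
    mul_ite, mul_one, mul_zero]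
  split_ifs <;> first | rfl | (exfalso; simp_all)

theorem pairTensor_isInjective : IsInjective (pairTensor e) := by
  intro X Y h
  funext a b
  have key : ∀ Z : ι → ι → ℂ, (∑ a', ∑ b', pairTensor e (e.symm ((e a).1, (e b).1))
      (e.symm ((e a).2, (e b).2)) a' b' * Z a' b') = Z a b := fun Z => by
    rw [Finset.sum_eq_single a, Finset.sum_eq_single b]
    · rw [pairTensor_apply, if_pos (by simp), one_mul]
    · intro b' _ hb
      rw [pairTensor_apply, if_neg, zero_mul]
      rintro ⟨-, h2⟩
      exact hb (e.injective (by simpa using h2))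
    · simp
    · intro a' _ ha
      refine Finset.sum_eq_zero fun b' _ => ?_
      rw [pairTensor_apply, if_neg, zero_mul]
      rintro ⟨h1, -⟩
      exact ha (e.injective (by simpa using h1))
    · simp
  have h' := congrFun h (e.symm ((e a).1, (e b).1), e.symm ((e a).2, (e b).2))
  simp only [key] at h'
  exact h'

theorem transfer_pairTensor : transfer (pairTensor e) =
    vecMulVec (fun a => if (e a).1 = (e a).2 then 1 else 0)
      (fun a => if (e a).1 = (e a).2 then 1 else 0) := by
  ext a b
  rw [transfer, Matrix.sum_apply, vecMulVec_apply]
  simp only [pairTensor_apply]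
  rw [Finset.sum_eq_single (e.symm ((e a).1, (e b).1))]
  · simp only [Equiv.apply_symm_apply, Prod.ext_iff, true_and]
    simp only [eq_comm (a := (e a).2), eq_comm (a := (e b).2), mul_ite, mul_one, mul_zero]
    split_ifs <;> first | rfl | (exfalso; simp_all)
  · rintro i - hi
    rw [if_neg]
    rintro ⟨h1, h2⟩
    refine hi (e.injective ?_)
    rw [Equiv.apply_symm_apply, h1, h2]
  · simp

theorem pairTensor_isStrongInjective [Nonempty μ] : IsStrongInjective (pairTensor e) where
  injective := pairTensor_isInjective e
  transfer := by
    rw [transfer_pairTensor]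
    refine hasUniqueLargestEigenvalue_vecMulVec (r := Fintype.card μ)
      (by exact_mod_cast Fintype.card_pos) ?_
    rw [dotProduct, ← e.symm.sum_comp, Fintype.sum_prod_type]
    simp

/-- The generated operators are `|ψ⟩⟨ψ|`; the amplitudes of `ψ` are real. -/
theorem pairTensor_isDensity : IsDensity (pairTensor e) := by
  intro L _
  let ψ : (Fin L → ι) → ℂ := fun i => (List.ofFn fun x => pairUnit e (i x)).prod.trace
  have hψ : star ψ = ψ := by
    funext i
    have h := (starRingEnd ℂ).mapMatrix.map_list_prod (List.ofFn fun x => pairUnit e (i x))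
    rw [List.map_ofFn] at h
    have h2 : ((starRingEnd ℂ).mapMatrix ∘ fun x => pairUnit e (i x)) =
        fun x => pairUnit e (i x) := funext fun x => pairUnit_map_star e (i x)
    replace h := h.trans (congrArg (fun f => (List.ofFn f).prod) h2)
    change star (List.ofFn fun x => pairUnit e (i x)).prod.trace = _
    conv_rhs => rw [show ψ i = (List.ofFn fun x => pairUnit e (i x)).prod.trace from rfl, ← h]
    simp [Matrix.trace]
  have hprod : ∀ n (M N : Fin n → Matrix μ μ ℂ),
      (List.ofFn fun x => (M x ⊗ₖ N x).submatrix e e).prod =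
        ((List.ofFn M).prod ⊗ₖ (List.ofFn N).prod).submatrix e e := fun n => by
    induction n with
    | zero => intro M N; simp
    | succ n ih =>
      intro M N
      rw [List.ofFn_succ, List.ofFn_succ, List.ofFn_succ, List.prod_cons, List.prod_cons,
        List.prod_cons, ih, submatrix_mul_equiv, mul_kronecker_mul]
  have hρ : mpdo (pairTensor e) L = vecMulVec ψ (star ψ) := by
    ext i j
    rw [hψ, mpdo, of_apply, vecMulVec_apply]
    simp only [pairTensor]
    rw [hprod, ← trace_kronecker, Matrix.trace, Matrix.trace, ← e.sum_comp]
    rfl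
  rw [hρ]
  exact posSemidef_vecMulVec_self_star ψ

/-- The on-site operator that acts on `pairTensor` as conjugation by a unitary `V` of the bond. -/
def pairOp (V : Matrix μ μ ℂ) : Matrix ι ι ℂ := (V.map star ⊗ₖ V).submatrix e e

theorem pairOp_one : pairOp e (1 : Matrix μ μ ℂ) = 1 := by
  rw [pairOp, ← twist_neg_one, twist_one_matrix, one_kronecker_one, submatrix_one_equiv]

theorem pairOp_mul (V W : Matrix μ μ ℂ) : pairOp e (V * W) = pairOp e V * pairOp e W := by
  rw [pairOp, pairOp, pairOp, submatrix_mul_equiv, ← mul_kronecker_mul, ← twist_neg_one, twist_mul,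
    twist_neg_one, twist_neg_one]

theorem pairOp_smul (z : Circle) (V : Matrix μ μ ℂ) : pairOp e ((z : ℂ) • V) = pairOp e V := by
  have h : (z : ℂ) * star (z : ℂ) = 1 := by
    rw [Complex.star_def, Complex.mul_conj, Circle.normSq_coe, Complex.ofReal_one]
  rw [pairOp, pairOp, ← twist_neg_one, twist_smul, ctwist_neg_one, smul_kronecker, kronecker_smul,
    smul_smul, mul_comm, h, one_smul, twist_neg_one]

theorem pairOp_unitary {V : Matrix μ μ ℂ} (hV : Vᴴ * V = 1) : (pairOp e V)ᴴ * pairOp e V = 1 := by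
  have h : (pairOp e V)ᴴ = pairOp e Vᴴ := by
    ext i j
    simp [pairOp]
  rw [h, ← pairOp_mul, hV, pairOp_one]

theorem sum_pairOp_smul (V : Matrix μ μ ℂ) (i : ι) :
    ∑ k, pairOp e V i k • pairUnit e k = Vᴴ * pairUnit e i * V := by
  rw [← e.symm.sum_comp]
  ext c d
  simp only [pairOp, pairUnit, Matrix.sum_apply, Matrix.smul_apply, submatrix_apply,
    Equiv.apply_symm_apply, kroneckerMap_apply, map_apply, single_apply, smul_eq_mul, mul_ite,
    mul_one, mul_zero]
  rw [Finset.sum_eq_single (c, d)]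
  · rw [Matrix.mul_apply, Finset.sum_eq_single (e i).2]
    · rw [Matrix.mul_apply, Finset.sum_eq_single (e i).1]
      · simp [conjTranspose_apply]
      · intro b _ hb
        rw [single_apply, if_neg (fun h => hb h.1.symm), mul_zero]
      · simp
    · intro b _ hb
      rw [Matrix.mul_apply, Finset.sum_eq_zero, zero_mul]
      intro x _
      rw [single_apply, if_neg (fun h => hb h.2.symm), mul_zero]
    · simp
  · rintro ⟨x, y⟩ _ hxy
    rw [if_neg]
    rintro ⟨rfl, rfl⟩
    exact hxy rfl
  · simp

theorem sum_star_pairOp_smul (V : Matrix μ μ ℂ) (i : ι) :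
    ∑ k, star (pairOp e V i k) • pairUnit e k = (Vᴴ * pairUnit e i * V).map star := by
  rw [← sum_pairOp_smul, ← twist_neg_one, twist_sum]
  refine Finset.sum_congr rfl fun k _ => ?_
  rw [twist_smul, ctwist_neg_one, twist_neg_one, pairUnit_map_star]

theorem onSite_pairTensor (V W : Matrix μ μ ℂ) (i j : ι) :
    onSite (pairOp e V) (pairOp e W) (pairTensor e) i j =
      ((V ⊗ₖ W.map star)ᴴ * (pairUnit e i ⊗ₖ pairUnit e j) * (V ⊗ₖ W.map star)).submatrix e e := by
  have h1 : onSite (pairOp e V) (pairOp e W) (pairTensor e) i j =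
      ((∑ k, pairOp e V i k • pairUnit e k) ⊗ₖ
        (∑ k, star (pairOp e W j k) • pairUnit e k)).submatrix e e := by
    ext a b
    simp only [onSite, pairTensor, Matrix.sum_apply, Matrix.smul_apply, submatrix_apply,
      kroneckerMap_apply, Finset.sum_mul_sum, Fintype.sum_prod_type, smul_eq_mul]
    exact Finset.sum_congr rfl fun k _ => Finset.sum_congr rfl fun l _ => by ring
  have h2 : (Wᴴ * pairUnit e j * W).map star =
      (W.map star)ᴴ * pairUnit e j * W.map star := by
    rw [← twist_neg_one, twist_mul, twist_mul, twist_neg_one, twist_neg_one, twist_neg_one,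
      pairUnit_map_star]
    rfl
  rw [h1, sum_pairOp_smul, sum_star_pairOp_smul, h2, mul_kronecker_mul, mul_kronecker_mul,
    conjTranspose_kronecker]

/-- A unitary of the doubled bond space as an invertible matrix indexed by `ι`. -/
def pairGauge {M : Matrix (μ × μ) (μ × μ) ℂ} (hM : Mᴴ * M = 1) : (Matrix ι ι ℂ)ˣ where
  val := M.submatrix e e
  inv := Mᴴ.submatrix e e
  val_inv := by rw [submatrix_mul_equiv, mul_eq_one_comm.mp hM, submatrix_one_equiv]
  inv_val := by rw [submatrix_mul_equiv, hM, submatrix_one_equiv]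

theorem kronecker_unitary {V W : Matrix μ μ ℂ} (hV : Vᴴ * V = 1) (hW : Wᴴ * W = 1) :
    (V ⊗ₖ W.map star)ᴴ * (V ⊗ₖ W.map star) = 1 := by
  have : (W.map star)ᴴ * W.map star = 1 := by
    have h := congrArg (twist (-1)) hW
    rwa [twist_mul, twist_one_matrix, twist_neg_one, twist_neg_one] at h
  rw [conjTranspose_kronecker, ← mul_kronecker_mul, hV, this, one_kronecker_one]

theorem mpdo_onSite_pairTensor {V W : Matrix μ μ ℂ} (hV : Vᴴ * V = 1) (hW : Wᴴ * W = 1) (L : ℕ) :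
    mpdo (onSite (pairOp e V) (pairOp e W) (pairTensor e)) L = mpdo (pairTensor e) L := by
  refine mpdo_gauge (W := pairGauge e (kronecker_unitary hV hW)) (fun i j => ?_) L
  rw [onSite_pairTensor]
  change _ = ((V ⊗ₖ W.map star)ᴴ).submatrix e e * pairTensor e i j *
    (V ⊗ₖ W.map star).submatrix e e
  rw [pairTensor, submatrix_mul_equiv, submatrix_mul_equiv]

end FixedPoint

section Regular

open Matrix

variable {Q : Type*} [Group Q] [Fintype Q] [DecidableEq Q] (β : Z2 Q (UT (1 : Q →* ℤˣ)))

/-- The regular projective representation with factor system `β`. -/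
def regRep (q : Q) : Matrix Q Q ℂ :=
  Matrix.of fun y x => if y = q * x then (circleVal β (q, x) : ℂ) else 0

theorem regRep_mul (q q' : Q) :
    regRep β q * regRep β q' = (circleVal β (q, q') : ℂ) • regRep β (q * q') := by
  ext y x
  have h : circleVal β (q * q', x) * circleVal β (q, q') =
      circleVal β (q', x) * circleVal β (q, q' * x) := by
    have := β.2 q q' x
    rwa [UT.smul_of_eq_one rfl] at this
  rw [Matrix.mul_apply, Finset.sum_eq_single (q' * x)]
  · simp only [regRep, of_apply, if_true, Matrix.smul_apply, smul_eq_mul, mul_assoc]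
    split_ifs
    · rw [← Circle.coe_mul, ← Circle.coe_mul, mul_comm (circleVal β (q, q')), h, mul_comm]
    · simp
  · intro b _ hb
    simp [regRep, hb]
  · simp

theorem regRep_unitary (q : Q) : (regRep β q)ᴴ * regRep β q = 1 := by
  ext x x'
  rw [Matrix.mul_apply, Finset.sum_eq_single (q * x)]
  · simp only [regRep, conjTranspose_apply, of_apply, if_true, mul_right_inj, one_apply]
    split_ifs with h
    · subst h
      rw [Complex.star_def, mul_comm, Complex.mul_conj, Circle.normSq_coe, Complex.ofReal_one]
    · simp
  · intro b _ hb
    simp [regRep, hb]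
  · simp

variable {ι : Type*} [Fintype ι] [DecidableEq ι] (e : ι ≃ Q × Q)

/-- The on-site representation of the fixed-point state: the tensor product of the projective
representation and its conjugate. -/
def pairRep : Q →* unitaryGroup ι ℂ :=
  MonoidHom.mk' (fun q => ⟨pairOp e (regRep β q),
    mem_unitaryGroup_iff'.mpr (pairOp_unitary e (regRep_unitary β q))⟩) fun q q' => by
      refine Subtype.ext ?_
      change pairOp e (regRep β (q * q')) = pairOp e (regRep β q) * pairOp e (regRep β q')
      rw [← pairOp_mul, regRep_mul, pairOp_smul]

theorem coe_pairRep (q : Q) : (pairRep β e q : Matrix ι ι ℂ) = pairOp e (regRep β q) := rfl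

end Regular

section Realization

open Matrix

variable {G K : Type*} [Group G] [Group K] [Fintype (G × K)] [DecidableEq (G × K)]
  (β : Z2 (G × K) (UT (1 : G × K →* ℤˣ)))
  {ι : Type*} [Fintype ι] [DecidableEq ι] (e : ι ≃ (G × K) × (G × K))

theorem pairTensor_isSymmetricMPDO : IsSymmetricMPDO (pairRep β e) (pairTensor e) where
  strongInjective := pairTensor_isStrongInjective e
  density := pairTensor_isDensity e
  strong g L _ := by
    have h1 : (1 : Matrix (G × K) (G × K) ℂ)ᴴ * 1 = 1 := by simp
    refine ⟨1, ?_, ?_⟩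
    · have h := mpdo_onSite_pairTensor e (regRep_unitary β (g, 1)) h1 L
      rw [mpdo_onSite, pairOp_one, sitePow_one, conjTranspose_one, mul_one] at h
      rw [coe_pairRep, h, Circle.coe_one, one_smul]
    · have h := mpdo_onSite_pairTensor e h1 (regRep_unitary β (g, 1)) L
      rw [mpdo_onSite, pairOp_one, sitePow_one, one_mul] at h
      rw [coe_pairRep, h, inv_one, Circle.coe_one, one_smul]
  weak k L _ := by
    have h := mpdo_onSite_pairTensor e (regRep_unitary β (1, k)) (regRep_unitary β (1, k)) L
    rwa [mpdo_onSite] at h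

/-- The virtual action of the doubled group on the fixed-point state. -/
def pairVirtual (x : DoubledGroup G K) : Matrix ((G × K) × (G × K)) ((G × K) × (G × K)) ℂ :=
  (regRep β (x.left.1, x.left.2.2) ⊗ₖ (regRep β (x.left.2.1, x.left.2.2)).map star) *
    swapPow (G × K) x.right

theorem swapPow_conjTranspose {μ : Type*} [Fintype μ] [DecidableEq μ] (ε : ℤˣ) :
    (swapPow μ ε)ᴴ = swapPow μ ε := by
  rcases Int.units_eq_one_or ε with rfl | rfl
  · rw [swapPow_one, conjTranspose_one]
  · ext p q
    have h : q.swap = p ↔ p.swap = q :=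
      ⟨fun h => by rw [← h, Prod.swap_swap], fun h => by rw [← h, Prod.swap_swap]⟩
    simp only [swapPow, conjTranspose_apply, of_apply, if_neg (by decide : ¬ (-1 : ℤˣ) = 1), h]
    split_ifs <;> simp

theorem pairVirtual_unitary (x : DoubledGroup G K) :
    (pairVirtual β x)ᴴ * pairVirtual β x = 1 := by
  rw [pairVirtual, conjTranspose_mul, mul_assoc, ← mul_assoc (_ᴴ) (_ ⊗ₖ _),
    kronecker_unitary (regRep_unitary β _) (regRep_unitary β _), one_mul, swapPow_conjTranspose,
    swapPow_mul_swapPow, Int.units_mul_self, swapPow_one]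

theorem pairVirtual_mul (x y : DoubledGroup G K) :
    pairVirtual β x * twist (dsgn G K x) (pairVirtual β y) =
      (circleVal (doubledCocycle β) (x, y) : ℂ) • pairVirtual β (x * y) := by
  obtain ⟨⟨g, h, k⟩, ε⟩ := x
  obtain ⟨⟨g', h', k'⟩, δ⟩ := y
  have hm : ∀ p q p' q' : G × K, (regRep β p * regRep β q) ⊗ₖ
      ((regRep β p').map star * (regRep β q').map star) =
      ((circleVal β (p, q) / circleVal β (p', q') : Circle) : ℂ) •
        (regRep β (p * q) ⊗ₖ (regRep β (p' * q')).map star) := fun p q p' q' => by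
    rw [← twist_neg_one, ← twist_neg_one, ← twist_mul, regRep_mul, regRep_mul, twist_smul,
      ctwist_neg_one, smul_kronecker, kronecker_smul, smul_smul, twist_neg_one, div_eq_mul_inv,
      Circle.coe_mul, Circle.coe_inv_eq_conj, Complex.star_def]
  rcases Int.units_eq_one_or ε with rfl | rfl
  · change (regRep β (g, k) ⊗ₖ (regRep β (h, k)).map star) * swapPow (G × K) 1 *
      twist 1 ((regRep β (g', k') ⊗ₖ (regRep β (h', k')).map star) * swapPow (G × K) δ) =
      ((circleVal β ((g, k), (g', k')) / circleVal β ((h, k), (h', k')) : Circle) : ℂ) •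
        ((regRep β ((g, k) * (g', k')) ⊗ₖ (regRep β ((h, k) * (h', k'))).map star) *
          swapPow (G × K) (1 * δ))
    rw [twist_one, swapPow_one, mul_one, ← mul_assoc, ← mul_kronecker_mul, hm, one_mul,
      smul_mul]
  · change (regRep β (g, k) ⊗ₖ (regRep β (h, k)).map star) * swapPow (G × K) (-1) *
      twist (-1) ((regRep β (g', k') ⊗ₖ (regRep β (h', k')).map star) * swapPow (G × K) δ) =
      ((circleVal β ((g, k), (h', k')) / circleVal β ((h, k), (g', k')) : Circle) : ℂ) •
        ((regRep β ((g, k) * (h', k')) ⊗ₖ (regRep β ((h, k) * (g', k'))).map star) *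
          swapPow (G × K) (-1 * δ))
    rw [twist_mul, twist_kronecker, twist_swapPow, twist_neg_one, twist_neg_one,
      map_star_map_star, ← mul_assoc, mul_assoc _ (swapPow (G × K) (-1)), swapPow_mul_kronecker,
      ← mul_assoc, ← mul_kronecker_mul, hm, mul_assoc, swapPow_mul_swapPow, smul_mul]

/-- The factor system of the fixed-point state is the doubled cocycle. -/
theorem isVirtualRep_pairVirtual :
    IsVirtualRep (dsgn G K) (doubledOp (pairRep β e)) (pairTensor e)
      (fun x => pairGauge e (pairVirtual_unitary β x)) (circleVal (doubledCocycle β)) where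
  covariant x := by
    refine ⟨1, fun i j => ?_⟩
    have hx : dsgn G K x = x.right := rfl
    -- Exchanging ket and bra, up to complex conjugation, is conjugation by the swap of the bond.
    have hswap : (fun i j => twist (dsgn G K x) (if x.right = 1 then pairTensor e i j
        else pairTensor e j i)) = fun i j => (swapPow (G × K) x.right *
          (pairUnit e i ⊗ₖ pairUnit e j) * swapPow (G × K) x.right).submatrix e e := by
      funext i j
      rw [hx]
      rcases Int.units_eq_one_or x.right with h | h <;> rw [h]
      · rw [twist_one, if_pos rfl, swapPow_one, one_mul, mul_one, pairTensor]
      · rw [if_neg (by decide), swapPow_mul_kronecker, mul_assoc, swapPow_mul_swapPow,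
          Int.units_mul_self, swapPow_one, mul_one, twist_neg_one, pairTensor, ← submatrix_map,
          ← twist_neg_one, twist_kronecker, twist_neg_one, twist_neg_one, pairUnit_map_star,
          pairUnit_map_star]
    have hlin : ∀ u v : Matrix ι ι ℂ, onSite u v (fun i j => (swapPow (G × K) x.right *
        (pairUnit e i ⊗ₖ pairUnit e j) * swapPow (G × K) x.right).submatrix e e) i j =
        (swapPow (G × K) x.right).submatrix e e * onSite u v (pairTensor e) i j *
          (swapPow (G × K) x.right).submatrix e e := fun u v => by
      simp only [onSite, Finset.mul_sum, Finset.sum_mul, Matrix.mul_smul, Matrix.smul_mul,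
        pairTensor, submatrix_mul_equiv]
    rw [tensorAct_eq_onSite (D := doubledOp (pairRep β e)) (g := x) rfl, hswap, hlin, coe_pairRep,
      coe_pairRep, onSite_pairTensor, Circle.coe_one, one_smul]
    change _ = (pairVirtual β x)ᴴ.submatrix e e * pairTensor e i j *
      (pairVirtual β x).submatrix e e
    rw [pairTensor, submatrix_mul_equiv, submatrix_mul_equiv, submatrix_mul_equiv,
      submatrix_mul_equiv, pairVirtual, conjTranspose_mul,
      swapPow_conjTranspose]
    simp only [mul_assoc]
  mul x y := by
    change (pairVirtual β x).submatrix e e * twist (dsgn G K x) ((pairVirtual β y).submatrix e e) =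
      _ • (pairVirtual β (x * y)).submatrix e e
    rw [twist_eq_map, ← submatrix_map, submatrix_mul_equiv, ← twist_eq_map, pairVirtual_mul]
    rfl

end Realization

/-- For finite groups every constrained class is realized by a fixed-point state. -/
theorem isRealized_of_mem_constrainedClasses {G K : Type*} [Group G] [Group K] [Finite G] [Finite K]
    {c : DoubledH2 G K} (hc : c ∈ constrainedClasses G K) : IsRealized c := by
  classical
  obtain ⟨α, χ, rfl⟩ := exists_eq_doubledClass hc
  have := Fintype.ofFinite (G × K)
  let e := (Fintype.equivFin ((G × K) × (G × K))).symm
  exact ⟨_, _, pairRep (productCocycle α χ) e, pairTensor e, pairTensor_isSymmetricMPDO _ e, _, _,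
    isVirtualRep_pairVirtual (productCocycle α χ) e, rfl⟩

/-- The class of a symmetric density operator satisfies all constraints. -/
theorem IsRealized.mem_constrainedClasses {G K : Type*} [Group G] [Group K] {c : DoubledH2 G K}
    (h : IsRealized c) : c ∈ constrainedClasses G K := by
  obtain ⟨d, χ, u, A, hA, hc⟩ := h
  have hKH := resKH_eq_one_of_hasClass hA hc
  obtain ⟨ω, rfl, hn⟩ := exists_isHermNormal (resH_eq_one_of_resKH hKH)
  exact MixedSPT.mem_constrainedClasses.mpr
    ⟨hKH, hn.resR_eq, slantLR_eq_one_of_hasClass hA hc, hn.slantRK_eq⟩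

end MixedSPT

end

open MixedSPT in
theorem mainTheorem1 (G K : Type*) [Group G] [Group K] :
    -- The doubled state has a unique class in `H²((G_l × G_r × K) ⋊ Z₂^H, U_T(1))`.
    (∀ (d χ : ℕ) (u : G × K →* Matrix.unitaryGroup (Fin d) ℂ) (A : Tensor (Fin d) (Fin χ)),
      IsSymmetricMPDO u A →
        (∃! c : DoubledH2 G K, HasClass (dsgn G K) (doubledOp u) A c) ∧
        ∀ (V : DoubledGroup G K → (Matrix (Fin χ) (Fin χ) ℂ)ˣ)
          (ω : DoubledGroup G K × DoubledGroup G K → UT (dsgn G K)),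
          IsVirtualRep (dsgn G K) (doubledOp u) A V ω → groupCohomology.IsMulCocycle₂ ω) ∧
    -- Constraints on the class.
    (∀ c : DoubledH2 G K, IsRealized c →
      -- Hermiticity and weak symmetry protect nothing, separately or together.
      (resH G K c = 1 ∧ resK G K c = 1 ∧ resKH G K c = 1) ∧
      -- There is no mixed anomaly between Hermiticity and the physical symmetry.
      (∃ ω : Z2 (DoubledGroup G K) (UT (dsgn G K)), QuotientGroup.mk ω = c ∧
        ω.1 (hermElt G K, hermElt G K) = 1 ∧
        (∀ x : G × G × K, ω.1 (SemidirectProduct.inl x, hermElt G K) = 1 ∧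
          ω.1 (hermElt G K, SemidirectProduct.inl x) = 1) ∧
        ∀ x y : G × G × K,
          ω.1 (SemidirectProduct.inl x, SemidirectProduct.inl y) =
            (ω.1 (SemidirectProduct.inl (hermAut G K (-1) x),
              SemidirectProduct.inl (hermAut G K (-1) y)))⁻¹) ∧
      -- Hermiticity.
      resR G K c = (resL G K c)⁻¹ ∧ slantRK G K c = (slantLK G K c)⁻¹ ∧
      -- Semi-positivity: there is no mixed anomaly between `G_l` and `G_r`.
      slantLR G K c = 1) ∧
    -- The constrained classes form the group `H²(G, U(1)) ⊕ H¹(G, H¹(K, U(1)))`.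
    (Function.Bijective
      (((resL G K).prod (slantLK G K)).comp (constrainedClasses G K).subtype)) ∧
    -- For finite groups, every one of them occurs.
    (Finite G → Finite K → ∀ c : DoubledH2 G K, IsRealized c ↔ c ∈ constrainedClasses G K) ∧
    -- Time reversal protects nothing.
    (∀ (d χ : ℕ) (u : Matrix.unitaryGroup (Fin d) ℂ) (A : Tensor (Fin d) (Fin χ)),
      IsTimeReversalMPDO u A →
        ∀ c : H2 (ℤˣ × ℤˣ) (UT trsgn), HasClass trsgn (trOp u) A c ↔ c = 1) := by
  refine ⟨fun d χ u A hA => ?_, fun c hc => ?_, bijective_resL_slantLK, fun _ _ c => ⟨fun hc => ?_,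
    isRealized_of_mem_constrainedClasses⟩, fun d χ u A hA c => hA.hasClass_iff c⟩
  · have := hA.strongInjective.transfer.nonempty
    have hinj := hA.strongInjective.injective
    obtain ⟨V, ω, hV⟩ := hA.isSymmetryAction.exists_isVirtualRep hinj
    exact ⟨⟨_, IsVirtualRep.hasClass hV, fun c hc => HasClass.unique hinj
      (IsVirtualRep.hasClass hV) hc⟩, fun W ω' hW => hW.isMulCocycle₂⟩
  · obtain ⟨hKH, hR, hLR, hRK⟩ := mem_constrainedClasses.mp hc.mem_constrainedClasses
    obtain ⟨ω, hω, hn⟩ := exists_isHermNormal (resH_eq_one_of_resKH hKH)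
    exact ⟨⟨resH_eq_one_of_resKH hKH, resK_eq_one_of_resKH hKH, hKH⟩, ⟨ω, hω, hn⟩, hR, hRK, hLR⟩
  · exact hc.mem_constrainedClasses
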